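/- **Notation.** $|\cdot|$ is the Euclidean norm on $\mathbb{R}^2$, $e(x)=e^{2\pi i x}$, $(x,y)^\perp=(y,-x)$, and $\delta_{\mathbf n}=1$ if $\mathbf n=\mathbf 0$, $\delta_{\mathbf n}=0$ if $\mathbf n\in\mathbb{Z}^2\setminus\{\mathbf 0\}$. For $\mathbf r\in\mathbb{Z}^2$ and $q\in\mathbb{N}=\{1,2,\dots\}$, $\gcd(\mathbf r)$ is the gcd of the entries of $\mathbf r$ and $\gcd(\mathbf r,q)$ the gcd of these entries and $q$; $\mathbf c\in\mathbb{Z}^2$ is primitive if $\gcd(\mathbf c)=1$. $\sum^*_{\mathbf a \bmod q}$ is the sum over classes $\mathbf a\in(\mathbb{Z}/q)^2$ with $\gcd(\mathbf a,q)=1$. Put $\Lambda(\mathbf a,q)=\{k\mathbf a+q\mathbf y: k\in\mathbb{Z},\ \mathbf y\in\mathbb{Z}^2\}$. Fix smooth non-negative functions $\omega,\omega_0:\mathbb{R}\to\mathbb{R}$ with $\int\omega=\int\omega_0=1$, $\omega$ supported on $(1/2,1)$, $\omega_0$ even, supported on $(-1/2,1/2)$, and $\omega_0(0)=1$. Let $c=\big(\int_{\mathbb{R}^2}\omega(|\mathbf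 x|)\,d\mathbf x\big)^{-1}$ and, for $y>0$, $$h(y,z)=\sum_{j\ge 1}\frac1{yj}\Big(\omega(yj)-\omega\Big(\frac{|z|}{yj}\Big)\Big).$$ For real $Q\ge1$, $q,k\in\mathbb{N}$, $\mathbf r\in\mathbb{Z}^2$, $\mathbf w\in\mathbb{R}^2$ let $$p_{1,q}(\mathbf w)=-\frac{2c}{Q}\int_{\mathbb{R}^2}\omega_0\Big(\frac{|\mathbf x|}{Q^{3/2}}\Big)\sum_{j\ge1}\frac1{q^2j^2}\,\omega\Big(\frac{|\mathbf x|}{jqQ^{1/2}}\Big)e(-\mathbf w\cdot\mathbf x)\,d\mathbf x,$$ $$p_{2,\mathbf r,k,q}(\mathbf w)=\frac{c}{Q^3}\int_{\mathbb{R}^2}\omega_0\Big(\frac{|\mathbf x|}{Q^{3/2}}\Big)h\Big(\frac{kq}{Q},\frac{\mathbf r\cdot\mathbf x}{Q^2}\Big)e(-\mathbf w\cdot\mathbf x)\,d\mathbf x .$$ **Theorem.** All implied constants below may depend on $\omega,\omega_0$ and on the displayed subscripts, and on nothing else. For every real $Q\ge1$ there are functions $p_\Lambda:\mathbb{R}^2\to\mathbb{C}$,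 depending only on $\omega$, $\omega_0$, $Q$ and the lattice $\Lambda\subseteq\mathbb{Z}^2$, such that for all $q\in\mathbb{N}$ and $\mathbf a\in\mathbb{Z}^2$ with $\gcd(\mathbf a,q)=1$ $$p_{\Lambda(\mathbf a,q)}(\mathbf w)=p_{1,q}(\mathbf w)+\sum_{\substack{\mathbf r\in\Lambda(\mathbf a,q)\\ k=\gcd(\mathbf r)/\gcd(\mathbf r,q)}}\omega\Big(\frac{|\mathbf r|}{Q^{1/2}}\Big)p_{2,\mathbf r,k,q}(\mathbf w),$$ and such that the following holds. The functions $p_{\Lambda(\mathbf a,q)}$, $p_{1,q}$, $p_{2,\mathbf r,k,q}$ are integrable on $\mathbb{R}^2$, and: 1. For all $N>0$, $Q\ge 1$ and $\mathbf n\in\mathbb{Z}^2$, $$\delta_{\mathbf n}=\sum_{1\le q\le Q}\ \sideset{}{^*}\sum_{\mathbf a\bmod q}\int_{\mathbb{R}^2}p_{\Lambda(\mathbf a,q)}(\mathbf w)\,e\big((\mathbf a/q+\mathbf w)\cdot\mathbf n\big)\,d\mathbf w+O_N(Q^{-N}).$$ 2. For all $\delta>0$ and $N>0$: $p_{\Lambda(\mathbf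 a,q)}(\mathbf w)=1+O_{N,\delta}(Q^{-N})$ whenever $Q\ge 1$, $\gcd(\mathbf a,q)=1$, $q<Q^{1/2-\delta}$ and $|\mathbf w|<q^{-1}Q^{-1-\delta}$. 3. For all $N>0$, $Q\ge1$, $q,k\in\mathbb{N}$ and $\mathbf w\in\mathbb{R}^2$, $$p_{1,q}(\mathbf w)\ll_N\frac{Q}{q(1+|\mathbf w|Q^{3/2})}\,(1+|\mathbf w|qQ^{1/2})^{-N},$$ and, for all $\mathbf r\in\mathbb{Z}^2$ with $\tfrac12Q^{1/2}\le|\mathbf r|\le Q^{1/2}$, $$p_{2,\mathbf r,k,q}(\mathbf w)\ll_N\big(1+|\mathbf w|kqQ^{1/2}+|\mathbf w\cdot\mathbf r^\perp|Q\big)^{-N}.$$ 4. The sums over $\mathbf a$ and $\mathbf r$ may be interchanged: for all $N>0$, $Q\ge 1$ and $\mathbf n\in\mathbb{Z}^2$, $$\begin{aligned}\delta_{\mathbf n}={}&\sum_{1\le q\le Q}\ \sideset{}{^*}\sum_{\mathbf a\bmod q}\int_{\mathbb{R}^2}p_{1,q}(\mathbf w)\,e\big((\mathbf a/q+\mathbf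 w)\cdot\mathbf n\big)\,d\mathbf w\\&+\sum_{\substack{d,k\in\mathbb{N}\\ \mathbf c\in\mathbb{Z}^2\ \mathrm{primitive}\\ \mathbf r=dk\mathbf c}}\omega\Big(\frac{|\mathbf r|}{Q^{1/2}}\Big)\sum_{\substack{1\le q\le Q/k\\ d\mid q\\ \gcd(q/d,k)=1}}\ \sideset{}{^*}\sum_{\substack{\mathbf a\bmod q\\ q\mid d\mathbf c\cdot\mathbf a^\perp}}\int_{\mathbb{R}^2}p_{2,\mathbf r,k,q}(\mathbf w)\,e\big((\mathbf a/q+\mathbf w)\cdot\mathbf n\big)\,d\mathbf w+O_N(Q^{-N}).\end{aligned}$$ -/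

import Mathlib

open MeasureTheory

noncomputable section

namespace DeltaSymbol

/-- The real plane with its Euclidean norm, inner product and Lebesgue measure. -/
abbrev Plane : Type := EuclideanSpace ℝ (Fin 2)

/-- An integer vector viewed as a point of the plane. -/
def toPlane (v : Fin 2 → ℤ) : Plane := !₂[(v 0 : ℝ), (v 1 : ℝ)]

/-- `(x, y)^⊥ = (y, -x)`. -/
def perp (v : Plane) : Plane := !₂[v 1, -v 0]

/-- The integer `r · a^⊥`, for integer vectors `r` and `a`. -/
def dotPerp (r a : Fin 2 → ℤ) : ℤ := r 0 * a 1 - r 1 * a 0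

/-- `e(x) = exp(2 π i x)`. -/
def e (x : ℝ) : ℂ := Complex.exp (2 * (Real.pi : ℂ) * Complex.I * (x : ℂ))

/-- The delta symbol on `ℤ²`. -/
def delta (n : Fin 2 → ℤ) : ℂ := if n = 0 then 1 else 0

/-- The greatest common divisor of the two entries of an integer vector. -/
def vecGcd (v : Fin 2 → ℤ) : ℕ := Int.gcd (v 0) (v 1)

/-- `gcd(v, q)`: the greatest common divisor of `q` and both entries of `v`. -/
def gcdWith (v : Fin 2 → ℤ) (q : ℕ) : ℕ := Nat.gcd (vecGcd v) q

/-- Representatives of the classes `a mod q` in `(ℤ/q)²` with `gcd(a, q) = 1`: the vectors with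
entries in `{0, …, q - 1}` that are coprime to `q`. -/
def reducedResidues (q : ℕ) : Finset (Fin 2 → ℤ) :=
  (Fintype.piFinset fun _ : Fin 2 => Finset.Ico (0 : ℤ) (q : ℤ)).filter fun a => gcdWith a q = 1

/-- The lattice `Λ(a, q) = {k a + q y : k ∈ ℤ, y ∈ ℤ²}`. -/
def lattice (a : Fin 2 → ℤ) (q : ℕ) : AddSubgroup (Fin 2 → ℤ) where
  carrier := {v | ∃ (k : ℤ) (y : Fin 2 → ℤ), v = k • a + (q : ℤ) • y}
  zero_mem' := ⟨0, 0, by simp⟩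
  add_mem' := by
    rintro _ _ ⟨k, y, rfl⟩ ⟨l, z, rfl⟩
    exact ⟨k + l, y + z, by rw [add_smul, smul_add]; abel⟩
  neg_mem' := by
    rintro _ ⟨k, y, rfl⟩
    exact ⟨-k, -y, by rw [neg_smul, smul_neg]; abel⟩

/-- The additive character `e((a/q + w) · n)`. -/
def arcChar (a : Fin 2 → ℤ) (q : ℕ) (w : Plane) (n : Fin 2 → ℤ) : ℂ :=
  e (inner ℝ ((q : ℝ)⁻¹ • toPlane a + w) (toPlane n))

/-- The weights `ω`: smooth, non-negative, supported on `(1/2, 1)`, with integral `1`. -/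
structure IsWeight (ω : ℝ → ℝ) : Prop where
  smooth : ContDiff ℝ ((⊤ : ℕ∞) : WithTop ℕ∞) ω
  nonneg : ∀ x, 0 ≤ ω x
  support : Function.support ω ⊆ Set.Ioo (1 / 2) 1
  integral_eq_one : ∫ x, ω x = 1

/-- The cut-off functions `ω₀`: smooth, non-negative, even, supported on `(-1/2, 1/2)`, with
`ω₀(0) = 1` and integral `1`. -/
structure IsCutoff (ω₀ : ℝ → ℝ) : Prop where
  smooth : ContDiff ℝ ((⊤ : ℕ∞) : WithTop ℕ∞) ω₀
  nonneg : ∀ x, 0 ≤ ω₀ x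
  even : ∀ x, ω₀ (-x) = ω₀ x
  support : Function.support ω₀ ⊆ Set.Ioo (-1 / 2) (1 / 2)
  apply_zero : ω₀ 0 = 1
  integral_eq_one : ∫ x, ω₀ x = 1

/-- The constant `c = (∫_{ℝ²} ω(|x|) dx)⁻¹`. -/
def normConst (ω : ℝ → ℝ) : ℝ := (∫ x : Plane, ω ‖x‖)⁻¹

/-- `h(y, z) = ∑_{j ≥ 1} (1 / (y j)) (ω(y j) - ω(|z| / (y j)))`, used for `y > 0`, where only
finitely many terms are non-zero. -/
def h (ω : ℝ → ℝ) (y z : ℝ) : ℝ :=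
  ∑' j : ℕ+, (1 / (y * (j : ℕ))) * (ω (y * (j : ℕ)) - ω (|z| / (y * (j : ℕ))))

/-- The function `p_{1,q}` at the point `w`:
`-(2c/Q) ∫ ω₀(|x|/Q^{3/2}) ∑_{j ≥ 1} (q j)⁻² ω(|x|/(j q Q^{1/2})) e(-w · x) dx`. -/
def p1 (ω₀ ω : ℝ → ℝ) (Q : ℝ) (q : ℕ) (w : Plane) : ℂ :=
  ((-(2 * normConst ω / Q) : ℝ) : ℂ) *
    ∫ x : Plane,
      ((ω₀ (‖x‖ / Q ^ (3 / 2 : ℝ)) *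
        (∑' j : ℕ+, (1 / ((q : ℝ) ^ 2 * ((j : ℕ) : ℝ) ^ 2)) *
          ω (‖x‖ / ((j : ℕ) * q * Q ^ (1 / 2 : ℝ)))) : ℝ) : ℂ) * e (-inner ℝ w x)

/-- The function `p_{2,r,k,q}` at the point `w`:
`(c/Q³) ∫ ω₀(|x|/Q^{3/2}) h(k q / Q, r · x / Q²) e(-w · x) dx`. -/
def p2 (ω₀ ω : ℝ → ℝ) (Q : ℝ) (r : Fin 2 → ℤ) (k q : ℕ) (w : Plane) : ℂ :=
  ((normConst ω / Q ^ 3 : ℝ) : ℂ) *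
    ∫ x : Plane,
      ((ω₀ (‖x‖ / Q ^ (3 / 2 : ℝ)) *
        h ω ((k : ℝ) * q / Q) (inner ℝ (toPlane r) x / Q ^ 2) : ℝ) : ℂ) * e (-inner ℝ w x)

/-- The weight `ω(|r| / Q^{1/2})` of an integer vector; it vanishes for all but finitely many
`r`. -/
def vecWeight (ω : ℝ → ℝ) (Q : ℝ) (r : Fin 2 → ℤ) : ℂ :=
  ((ω (‖toPlane r‖ / Q ^ (1 / 2 : ℝ)) : ℝ) : ℂ)

/-- The triples `(d, k, c)` with `d, k ≥ 1` and `c ∈ ℤ²` primitive. -/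
abbrev Triple : Type := ℕ+ × ℕ+ × {c : Fin 2 → ℤ // vecGcd c = 1}

/-- The contribution of `(d, k, c)`, with `r = d k c`, to the interchanged sum:
`ω(|r|/Q^{1/2}) ∑_{q ≤ Q/k, d ∣ q, gcd(q/d, k) = 1} ∑*_{a mod q, q ∣ d c · a^⊥}
  ∫ p_{2,r,k,q}(w) e((a/q + w) · n) dw`. -/
def interchangedTerm (ω₀ ω : ℝ → ℝ) (Q : ℝ) (n : Fin 2 → ℤ) (d k : ℕ) (c : Fin 2 → ℤ) : ℂ :=
  vecWeight ω Q ((d * k : ℕ) • c) *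
    ∑ q ∈ (Finset.Icc 1 ⌊Q / k⌋₊).filter (fun q => d ∣ q ∧ Nat.gcd (q / d) k = 1),
      ∑ a ∈ (reducedResidues q).filter (fun a => (q : ℤ) ∣ dotPerp (d • c) a),
        (∫ w : Plane, p2 ω₀ ω Q ((d * k : ℕ) • c) k q w * arcChar a q w n)

end DeltaSymbol

end

/-!
The identity is an identity of Fourier transforms. Both `p₁` and `p₂` are transforms `ft` of smooth
functions with compact support (`density1`, `density2`; the smoothness at the origin comes from
`contDiff_even_comp_norm`). Hence they are integrable, and Fourier inversion turns their integrals
against `e((a/q + w) · n)` into `e(a · n / q)` times the value of the density at `n`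
(`integral_p1_mul_arcChar`, `integral_p2_mul_arcChar`). The sum over a lattice is a function of the
lattice alone because `Λ(a, q)` determines `q` (`eq_of_lattice_eq`, `latticeModulus`).

*The delta symbol.* For `gcd(a, q) = 1` one has `r ∈ Λ(a, q)` if and only if `q ∣ r · a^⊥`, and
`p₂` vanishes for `k q ≥ Q`; therefore the two arrangements of the sum agree with one finite
expression, `deltaSum` (`sum_integral_latticeKernel`, `tsum_interchangedTerm`). For a fixed `r` the
number `k q` is the least common multiple of `gcd(r)` and `q`. Sorting the series defining `h` by
`L = k q j` (`sum_mul_sum_lcm_eq`) completes the sums over `a` to sums over all classes modulo `L`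
with `L ∣ r · b^⊥`, which are evaluated in `sum_divisors_reducedResidues_dvd_eq`. What is left is a
sum over divisors `l` of an integer `m` with `r · n = gcd(r)² m`, and its terms `l` and `m / l`
cancel (`sum_divisors_sub_eq_zero`) unless `r · n = 0`. If `n ≠ 0`, the remaining `r` are the
vectors `± n^⊥ / l` with `l ∣ gcd(n)`, and up to an error from replacing a Riemann sum of `ω` by its
integral their contribution is exactly the negative of that of `p₁` (`sum_vecWeight_orthogonal`). If
`n = 0`, the contribution of `p₁` vanishes and that of `p₂` counts integer points with a smooth
weight (`exists_sum_vecWeight_bound`). This gives `exists_delta_sub_deltaSum_bound`.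

*Decay.* The kernel `p₁` is a finite sum of dilates of one family of rapidly decreasing functions
(`p1_eq_sum_bumpFt`, `exists_p1_bound`). For `p₂` the point is that `h(η, ·)` is an approximate
identity (`exists_integral_mul_h_bound`). As long as `η |v|` is small the transform of
`ω₀(|y|) h(η, ρ · y)` is therefore close to an integral over the line `ρ · y = 0`, which decays in
the direction of `ρ^⊥` (`exists_ft_kernel_approx`); for larger `|v|` every term of the series for
`h` decays by itself (`exists_ft_kernel_bound_of_large`). Together these give `exists_p2_bound`.

*Small moduli.* When `q` and `w` are small, every `p₂` may be replaced by its line integral. The sum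
over the lattice is then a sum over translates of `q ℤ²`, and Poisson summation in the plane
evaluates it as `c (Q / q) ∫ bumpFt(t, t v) dt` with `v = Q^{3/2} w` (`exists_sum_p2_approx`).
Poisson summation over `j` shows that `p₁` is `1` minus the same quantity (`exists_p1_approx`): the
`1` is the missing term `j = 0` of the sum over `j`. Adding the two gives
`exists_latticeKernel_sub_one_bound`.

The only analytic input beyond Fourier inversion is Poisson summation with an error term that is
uniform in the function (`exists_poisson_bound`, `exists_poisson_bound_plane`).
-/

namespace DeltaSymbol

open scoped ContDiff FourierTransform

/-! ### Smoothness of even functions of the norm -/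

/-- Differentiation under the integral sign replaces `(m, g)` by `(m + 1, g')`, so that the
induction on the order of differentiability runs over all `m` and `g` at once. -/
lemma contDiff_integral_pow_mul_comp_mul (n : ℕ) :
    ∀ (m : ℕ) (g : ℝ → ℝ), ContDiff ℝ ∞ g →
      ContDiff ℝ n (fun x : ℝ => ∫ s in (0 : ℝ)..1, s ^ m * g (s * x)) := by
  have key : ∀ (m : ℕ) (g : ℝ → ℝ), ContDiff ℝ ∞ g → ∀ x : ℝ,
      HasDerivAt (fun x : ℝ => ∫ s in (0 : ℝ)..1, s ^ m * g (s * x))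
        (∫ s in (0 : ℝ)..1, s ^ (m + 1) * deriv g (s * x)) x := by
    intro m g hg x
    have hg' : Continuous (deriv g) := hg.continuous_deriv (by simp)
    have hgc := hg.continuous
    obtain ⟨B, hB⟩ := (isCompact_Icc (a := -(|x| + 1)) (b := |x| + 1)).exists_bound_of_continuousOn
      hg'.continuousOn
    refine (intervalIntegral.hasDerivAt_integral_of_dominated_loc_of_deriv_le
      (F := fun x s => s ^ m * g (s * x)) (F' := fun x s => s ^ (m + 1) * deriv g (s * x))
      (s := Metric.ball x 1) (bound := fun _ => B) (Metric.ball_mem_nhds x one_pos) ?_ ?_ ?_ ?_ ?_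
      ?_).2
    · exact Filter.Eventually.of_forall fun y => (by fun_prop : Continuous _).aestronglyMeasurable
    · exact (by fun_prop : Continuous _).intervalIntegrable _ _
    · exact (by fun_prop : Continuous _).aestronglyMeasurable
    · refine Filter.Eventually.of_forall fun s hs y hy => ?_
      rw [Set.uIoc_of_le zero_le_one] at hs
      have hy' : |y| ≤ |x| + 1 := by
        have h1 : |y - x| < 1 := by simpa [Real.dist_eq] using hy
        have h2 := abs_add_le (y - x) x
        simp only [sub_add_cancel] at h2
        linarith
      have hsy : |s * y| ≤ |x| + 1 := by
        rw [abs_mul, abs_of_pos hs.1]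
        nlinarith [abs_nonneg y, hs.1, hs.2]
      have h3 := hB (s * y) (abs_le.1 hsy)
      rw [norm_mul, norm_pow, Real.norm_eq_abs, abs_of_pos hs.1]
      have h4 : s ^ (m + 1) ≤ 1 := pow_le_one₀ hs.1.le hs.2
      nlinarith [norm_nonneg (deriv g (s * y)), pow_pos hs.1 (m + 1)]
    · exact intervalIntegrable_const
    · refine Filter.Eventually.of_forall fun s _ y _ => ?_
      have h1 : HasDerivAt g (deriv g (s * y)) (s * y) :=
        ((hg.differentiable (by simp)) _).hasDerivAt
      have h2 : HasDerivAt (fun y : ℝ => s * y) s y := by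
        simpa using (hasDerivAt_id y).const_mul s
      convert! (h1.comp y h2).const_mul (s ^ m) using 1
      ring
  induction n with
  | zero =>
    intro m g hg
    refine contDiff_zero.2 (continuous_iff_continuousAt.2 fun x => (key m g hg x).continuousAt)
  | succ n ih =>
    intro m g hg
    have : ((n + 1 : ℕ) : WithTop ℕ∞) = (n : WithTop ℕ∞) + 1 := by norm_cast
    rw [this, contDiff_succ_iff_deriv]
    refine ⟨fun x => (key m g hg x).differentiableAt, by simp, ?_⟩
    rw [show deriv (fun x : ℝ => ∫ s in (0 : ℝ)..1, s ^ m * g (s * x)) = _ from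
      funext fun x => (key m g hg x).deriv]
    exact ih (m + 1) (deriv g) (contDiff_infty_iff_deriv.1 hg).2

/-- The derivative of a smooth even function is `t` times a smooth even function. -/
lemma exists_deriv_eq_mul_of_even {f : ℝ → ℝ} (hf : ContDiff ℝ ∞ f) (he : ∀ x, f (-x) = f x) :
    ∃ F : ℝ → ℝ, ContDiff ℝ ∞ F ∧ (∀ x, F (-x) = F x) ∧ ∀ x, deriv f x = x * F x := by
  have hf' : ContDiff ℝ ∞ (deriv f) := (contDiff_infty_iff_deriv.1 hf).2
  have hf'' : ContDiff ℝ ∞ (deriv (deriv f)) := (contDiff_infty_iff_deriv.1 hf').2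
  have hodd : ∀ x, deriv f (-x) = -deriv f x := by
    intro x
    have h1 : deriv (fun y => f (-y)) x = -deriv f (-x) := deriv_comp_neg f x
    rw [show (fun y => f (-y)) = f from funext he] at h1
    linarith
  have heven : ∀ x, deriv (deriv f) (-x) = deriv (deriv f) x := by
    intro x
    have h1 : deriv (fun y => deriv f (-y)) x = -deriv (deriv f) (-x) := deriv_comp_neg _ x
    rw [show (fun y => deriv f (-y)) = fun y => -deriv f y from funext hodd] at h1
    simp only [deriv.fun_neg] at h1
    linarith
  refine ⟨fun x => ∫ s in (0 : ℝ)..1, deriv (deriv f) (s * x), ?_, ?_, ?_⟩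
  · refine contDiff_infty.2 fun n => ?_
    simpa using contDiff_integral_pow_mul_comp_mul n 0 _ hf''
  · intro x
    simp [heven]
  · intro x
    have h0 : deriv f 0 = 0 := by
      have := hodd 0
      simp only [neg_zero] at this
      linarith
    have hd : ∀ s ∈ Set.uIcc (0 : ℝ) 1,
        HasDerivAt (fun s : ℝ => deriv f (s * x)) (deriv (deriv f) (s * x) * x) s := by
      intro s _
      have h1 : HasDerivAt (deriv f) (deriv (deriv f) (s * x)) (s * x) :=
        ((hf'.differentiable (by simp)) _).hasDerivAt
      have h2 : HasDerivAt (fun s : ℝ => s * x) x s := by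
        simpa using (hasDerivAt_id s).mul_const x
      exact h1.comp s h2
    have hc : Continuous (fun s => deriv (deriv f) (s * x) * x) := by
      have := hf''.continuous
      fun_prop
    have h := intervalIntegral.integral_eq_sub_of_hasDerivAt hd (hc.intervalIntegrable _ _)
    rw [intervalIntegral.integral_mul_const] at h
    simp only [one_mul, zero_mul, h0, sub_zero] at h
    rw [← h, mul_comm]

/-- A smooth even function of the norm is smooth, also at the origin. -/
theorem contDiff_even_comp_norm {E : Type*} [NormedAddCommGroup E] [InnerProductSpace ℝ E]
    {f : ℝ → ℝ} (hf : ContDiff ℝ ∞ f) (he : ∀ x, f (-x) = f x) :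
    ContDiff ℝ ∞ (fun x : E => f ‖x‖) := by
  refine contDiff_infty.2 fun n => ?_
  induction n generalizing f with
  | zero => exact contDiff_zero.2 (hf.continuous.comp continuous_norm)
  | succ n ih =>
    -- the derivative at `x` is `F(‖x‖) ⟪x, ·⟫` with `F` smooth and even
    obtain ⟨F, hF, hFe, hFd⟩ := exists_deriv_eq_mul_of_even hf he
    have hfd : ∀ x : E, HasFDerivAt (fun x : E => f ‖x‖) (F ‖x‖ • innerSL ℝ x) x := by
      intro x
      rcases eq_or_ne x 0 with rfl | hx
      · have h0 : HasDerivAt f 0 0 := by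
          have := ((hf.differentiable (by simp)) 0).hasDerivAt
          rwa [hFd, zero_mul] at this
        have h1 := hasDerivAt_iff_isLittleO_nhds_zero.1 h0
        have h2 : Filter.Tendsto (fun x : E => ‖x‖) (nhds 0) (nhds 0) := by
          simpa using (continuous_norm (E := E)).tendsto 0
        have h3 := h1.comp_tendsto h2
        simp only [map_zero, smul_zero]
        rw [hasFDerivAt_iff_isLittleO_nhds_zero]
        have h4 := h3.norm_right
        simp only [Function.comp_def, zero_add, smul_zero, sub_zero, Real.norm_eq_abs,
          abs_norm] at h4
        simpa using h4.of_norm_right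
      · have hn : HasFDerivAt (fun x : E => ‖x‖) (‖x‖⁻¹ • innerSL ℝ x) x := by
          have h1 := (hasStrictFDerivAt_norm_sq x).hasFDerivAt
          have h2 := h1.sqrt (by simpa using hx)
          simp only [Real.sqrt_sq (norm_nonneg _)] at h2
          convert! h2 using 1
          ext y
          have : ‖x‖ ≠ 0 := by simpa using hx
          simp
          field_simp
        have h5 : HasDerivAt f (‖x‖ * F ‖x‖) ‖x‖ := by
          rw [← hFd]
          exact ((hf.differentiable (by simp)) _).hasDerivAt
        have h6 := h5.comp_hasFDerivAt x hn
        convert! h6 using 1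
        rw [smul_smul]
        congr 1
        have : ‖x‖ ≠ 0 := by simpa using hx
        field_simp
    have : ((n + 1 : ℕ) : WithTop ℕ∞) = (n : WithTop ℕ∞) + 1 := by norm_cast
    rw [this, contDiff_succ_iff_fderiv]
    refine ⟨fun x => (hfd x).differentiableAt, by simp, ?_⟩
    rw [show fderiv ℝ (fun x : E => f ‖x‖) = _ from funext fun x => (hfd x).fderiv]
    exact (ih hF hFe).smul (innerSL ℝ).contDiff

/-! ### Fourier transforms of smooth functions with compact support -/

lemma e_eq_fourierChar (x : ℝ) : e x = (Real.fourierChar x : ℂ) := by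
  rw [e, Real.fourierChar_apply]
  push_cast
  ring_nf

@[simp] lemma norm_e (x : ℝ) : ‖e x‖ = 1 := by
  rw [e_eq_fourierChar]
  exact Circle.norm_coe _

lemma e_add (x y : ℝ) : e (x + y) = e x * e y := by
  rw [e, e, e, ← Complex.exp_add]
  push_cast
  ring_nf

@[simp] lemma e_zero : e 0 = 1 := by simp [e]

@[fun_prop] lemma continuous_e : Continuous e := by
  unfold e
  fun_prop

/-- A common bound for the derivatives up to order `M`. -/
lemma exists_iteratedFDeriv_bound {V : Type*} [NormedAddCommGroup V] [NormedSpace ℝ V]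
    {f : V → ℂ} (hf : ContDiff ℝ ∞ f) (hs : HasCompactSupport f) (M : ℕ) :
    ∃ B : ℝ, 0 ≤ B ∧ ∀ n ≤ M, ∀ x, ‖iteratedFDeriv ℝ n f x‖ ≤ B := by
  have h : ∀ n : ℕ, ∃ B : ℝ, ∀ x, ‖iteratedFDeriv ℝ n f x‖ ≤ B := fun n =>
    (hf.continuous_iteratedFDeriv (by exact_mod_cast le_top)).bounded_above_of_compact_support
      (hs.iteratedFDeriv n)
  choose B hB using h
  refine ⟨∑ n ∈ Finset.range (M + 1), |B n|, by positivity, fun n hn x => ?_⟩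
  exact ((hB n x).trans (le_abs_self _)).trans
    (Finset.single_le_sum (f := fun n => |B n|) (fun _ _ => abs_nonneg _)
      (Finset.mem_range.2 (by omega)))

section Fourier

variable {V : Type*} [NormedAddCommGroup V] [InnerProductSpace ℝ V] [MeasurableSpace V]
  [BorelSpace V] [FiniteDimensional ℝ V]

/-- The Fourier transform `∫ f(x) e(-w · x) dx`, in the notation of the kernels. -/
noncomputable def ft (f : V → ℂ) (w : V) : ℂ := ∫ x, f x * e (-inner ℝ w x)

lemma ft_eq_fourier (f : V → ℂ) : ft f = 𝓕 f := by
  ext w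
  rw [ft, Real.fourier_eq']
  refine integral_congr_ae (Filter.Eventually.of_forall fun x => ?_)
  simp only [smul_eq_mul]
  rw [mul_comm, e, real_inner_comm]
  push_cast
  ring_nf

lemma integrable_ft {f : V → ℂ} (hf : ContDiff ℝ ∞ f) (hs : HasCompactSupport f) :
    Integrable (ft f) := by
  rw [ft_eq_fourier]
  exact (𝓕 (hs.toSchwartzMap hf)).integrable

/-- Fourier inversion. -/
lemma integral_ft_mul_e {f : V → ℂ} (hf : ContDiff ℝ ∞ f) (hs : HasCompactSupport f) (x : V) :
    ∫ w, ft f w * e (inner ℝ w x) = f x := by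
  have h1 : Integrable (𝓕 f) := ft_eq_fourier f ▸ integrable_ft hf hs
  have h2 := congrFun (hf.continuous.fourierInv_fourier_eq
    (hf.continuous.integrable_of_hasCompactSupport hs) h1) x
  rw [Real.fourierInv_eq'] at h2
  rw [← h2, ft_eq_fourier]
  refine integral_congr_ae (Filter.Eventually.of_forall fun w => ?_)
  simp only [smul_eq_mul]
  rw [mul_comm, e]
  push_cast
  ring_nf

lemma one_add_pow_le (M : ℕ) {x : ℝ} (hx : 0 ≤ x) : (1 + x) ^ M ≤ 2 ^ M * (1 + x ^ M) := by
  rcases le_total x 1 with h | h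
  · calc (1 + x) ^ M ≤ 2 ^ M := pow_le_pow_left₀ (by linarith) (by linarith) _
      _ ≤ 2 ^ M * (1 + x ^ M) := le_mul_of_one_le_right (by positivity) (by
        have := pow_nonneg hx M; linarith)
  · calc (1 + x) ^ M ≤ (2 * x) ^ M := pow_le_pow_left₀ (by linarith) (by linarith) _
      _ = 2 ^ M * x ^ M := mul_pow _ _ _
      _ ≤ 2 ^ M * (1 + x ^ M) := by gcongr; linarith

/-- Rapid decay of the Fourier transform, with a constant that only depends on bounds for the
derivatives: this makes it uniform over families of functions. -/
lemma exists_ft_decay (M : ℕ) (R : ℝ) : ∃ C : ℝ, 0 ≤ C ∧ ∀ (f : V → ℂ) (B : ℝ), ContDiff ℝ ∞ f →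
    (∀ x, R < ‖x‖ → f x = 0) → (∀ n ≤ M, ∀ x, ‖iteratedFDeriv ℝ n f x‖ ≤ B) →
      ∀ w, (1 + ‖w‖) ^ M * ‖ft f w‖ ≤ C * B := by
  set v := (volume (Metric.closedBall (0 : V) R)).toReal with hv
  have hv0 : 0 ≤ v := ENNReal.toReal_nonneg
  refine ⟨2 ^ M * (v + 2 ^ M * ((M + 1) * v)), by positivity, fun f B hf hs hB w => ?_⟩
  have hsupp : tsupport f ⊆ Metric.closedBall 0 R := by
    refine closure_minimal (fun x hx => ?_) Metric.isClosed_closedBall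
    by_contra hx'
    exact hx (hs x (by simpa using hx'))
  have hcs : HasCompactSupport f := HasCompactSupport.of_support_subset_isCompact
    (isCompact_closedBall (0 : V) R) ((subset_tsupport f).trans hsupp)
  have hB0 : 0 ≤ B := (norm_nonneg _).trans (hB 0 (Nat.zero_le _) 0)
  have hint : ∀ n : ℕ, Integrable (fun x => ‖iteratedFDeriv ℝ n f x‖) := fun n =>
    ((hf.continuous_iteratedFDeriv (by exact_mod_cast le_top)).integrable_of_hasCompactSupport
      (hcs.iteratedFDeriv n)).norm
  have hbd : ∀ n ≤ M, ∫ x, ‖iteratedFDeriv ℝ n f x‖ ≤ v * B := by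
    intro n hn
    have hz : ∀ x ∉ Metric.closedBall (0 : V) R, ‖iteratedFDeriv ℝ n f x‖ = 0 := by
      intro x hx
      rw [norm_eq_zero]
      by_contra h
      exact hx (hsupp ((support_iteratedFDeriv_subset n) h))
    rw [← setIntegral_eq_integral_of_forall_compl_eq_zero hz]
    refine (setIntegral_mono_on (hint n).integrableOn (integrableOn_const (C := B)
      (isCompact_closedBall (0 : V) R).measure_lt_top.ne) measurableSet_closedBall
      fun x _ => hB n hn x).trans ?_
    simp [Measure.real, hv, mul_comm]
  have h1 : ∀ n ≤ M, ‖w‖ ^ n * ‖ft f w‖ ≤ 2 ^ n * ((n + 1) * (v * B)) := by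
    intro n hn
    have := Real.pow_mul_norm_iteratedFDeriv_fourier_le (f := f) (K := 0) (N := ⊤) hf
      (fun k m hk _ => by
        have : k = 0 := by simpa using hk
        subst this
        simpa using hint m) (k := 0) (n := n) le_rfl le_top w
    rw [norm_iteratedFDeriv_zero, ← ft_eq_fourier] at this
    refine this.trans ?_
    simp only [pow_zero, CharP.cast_eq_zero, mul_zero, zero_add, one_mul]
    gcongr
    refine (Finset.sum_le_card_nsmul _ _ (v * B) ?_).trans (by simp)
    rintro ⟨i, j⟩ hij
    simp only [Finset.mem_product, Finset.mem_range] at hij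
    have hi : i = 0 := by omega
    subst hi
    simpa using hbd j (by omega)
  have h2 := h1 0 (Nat.zero_le _)
  have h3 := h1 M le_rfl
  simp only [pow_zero, one_mul, CharP.cast_eq_zero, zero_add] at h2
  calc (1 + ‖w‖) ^ M * ‖ft f w‖ ≤ 2 ^ M * (1 + ‖w‖ ^ M) * ‖ft f w‖ := by
        gcongr; exact one_add_pow_le M (norm_nonneg _)
    _ = 2 ^ M * (‖ft f w‖ + ‖w‖ ^ M * ‖ft f w‖) := by ring
    _ ≤ 2 ^ M * (v * B + 2 ^ M * ((M + 1) * (v * B))) := by gcongr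
    _ = _ := by ring

lemma exists_ft_decay_of_hasCompactSupport {f : V → ℂ} (hf : ContDiff ℝ ∞ f)
    (hs : HasCompactSupport f) (M : ℕ) :
    ∃ C : ℝ, 0 ≤ C ∧ ∀ w, (1 + ‖w‖) ^ M * ‖ft f w‖ ≤ C := by
  obtain ⟨R, hR⟩ := hs.isCompact.isBounded.subset_closedBall (0 : V)
  obtain ⟨B, hB0, hB⟩ := exists_iteratedFDeriv_bound hf hs M
  obtain ⟨C, hC0, hC⟩ := exists_ft_decay (V := V) M R
  refine ⟨C * B, by positivity, hC f B hf (fun x hx => ?_) hB⟩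
  by_contra h
  have := hR (subset_tsupport f h)
  simp only [Metric.mem_closedBall, dist_zero_right] at this
  linarith

end Fourier

/-! ### Poisson summation with an error term -/

@[fun_prop] lemma contDiff_e {n : WithTop ℕ∞} : ContDiff ℝ n e := by
  unfold e
  have h : ContDiff ℝ n (fun x : ℝ => (x : ℂ)) := Complex.ofRealCLM.contDiff
  exact Complex.contDiff_exp.comp (contDiff_const.mul h)

lemma inner_eq_mul (x y : ℝ) : inner ℝ x y = x * y := by
  simp [inner, mul_comm]

/-- Integration by parts `N` times. -/
lemma norm_ft_mul_pow_le {φ : ℝ → ℂ} (hφ : ContDiff ℝ ∞ φ) (hs : HasCompactSupport φ) (N : ℕ)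
    (ξ : ℝ) : (2 * Real.pi * |ξ|) ^ N * ‖ft φ ξ‖ ≤ ∫ x, ‖iteratedDeriv N φ x‖ := by
  have hint : ∀ n : ℕ, Integrable (iteratedDeriv n φ) := fun n => by
    refine (hφ.continuous_iteratedDeriv n (by exact_mod_cast le_top)).integrable_of_hasCompactSupport
      ?_
    refine (hs.iteratedFDeriv (𝕜 := ℝ) n).mono fun x hx => ?_
    simp only [Function.mem_support, ne_eq] at hx ⊢
    contrapose! hx
    rw [iteratedDeriv_eq_iteratedFDeriv, hx]
    rfl
  have h := congrFun (Real.fourier_iteratedDeriv (N := ⊤) (n := N) hφ (fun n _ => hint n) le_top) ξ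
  rw [← ft_eq_fourier, ← ft_eq_fourier] at h
  have h2 : ‖ft (iteratedDeriv N φ) ξ‖ ≤ ∫ x, ‖iteratedDeriv N φ x‖ := by
    refine (norm_integral_le_integral_norm _).trans (le_of_eq ?_)
    simp
  rw [h] at h2
  simpa [norm_smul, abs_of_pos Real.pi_pos] using h2

/-- A quantitative form of Poisson summation for `φ(x) e(θ x)` sampled at the points `α j + s`:
the frequency `0` gives the integral, and as `|θ| ≤ 1 / (2 α)` the phase does not move the other
frequencies close to the origin. -/
theorem exists_poisson_bound (N : ℕ) (hN : 1 ≤ N) : ∃ C : ℝ, 0 ≤ C ∧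
    ∀ (φ : ℝ → ℂ) (α s θ : ℝ), ContDiff ℝ ∞ φ → HasCompactSupport φ → 0 < α → α * |θ| ≤ 1 / 2 →
      ‖(∑' j : ℤ, φ (α * j + s) * e (θ * (α * j + s))) - (α⁻¹ : ℝ) * ∫ x, φ x * e (θ * x)‖ ≤
        C * α ^ N * ∫ x, ‖iteratedDeriv (N + 1) φ x‖ := by
  have hsum : Summable fun m : ℤ => |1 / (m : ℝ) ^ (N + 1)| :=
    (Real.summable_one_div_int_pow.2 (by omega)).abs
  refine ⟨∑' m : ℤ, |1 / (m : ℝ) ^ (N + 1)|, tsum_nonneg fun _ => abs_nonneg _, ?_⟩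
  intro φ α s θ hφ hs hα hθ
  set I := ∫ x, ‖iteratedDeriv (N + 1) φ x‖ with hI
  have hI0 : 0 ≤ I := integral_nonneg fun _ => norm_nonneg _
  set f : ℝ → ℂ := fun x => φ (α * x + s) * e (θ * (α * x + s)) with hf
  have hfs : ContDiff ℝ ∞ f := by
    rw [hf]
    have : ContDiff ℝ ∞ fun x : ℝ => α * x + s := by fun_prop
    exact (hφ.comp this).mul (contDiff_e.comp (contDiff_const.mul this))
  have hfc : HasCompactSupport f := by
    have h1 : HasCompactSupport fun x => φ (α * x + s) := by
      have h := hs.comp_homeomorph ((Homeomorph.mulLeft₀ α hα.ne').trans (Homeomorph.addRight s))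
      exact h
    exact h1.mul_right
  have hP := (hfc.toSchwartzMap hfs).tsum_eq_tsum_fourier 0
  -- the phase shifts the frequency `m / α` by `θ`
  have hval : ∀ m : ℤ, ft f m = (α⁻¹ : ℝ) * e (m * s / α) * ft φ (m / α - θ) := by
    intro m
    have h1 := Measure.integral_comp_mul_left
      (fun y => φ (y + s) * e (θ * (y + s)) * e (-(m / α * y))) α
    have h2 := integral_add_right_eq_self (μ := volume)
      (fun y => φ y * e (θ * y) * e (-(m / α * (y - s)))) s
    simp only [add_sub_cancel_right] at h2
    rw [h2, abs_of_pos (inv_pos.2 hα)] at h1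
    rw [ft, mul_assoc, ft, ← integral_const_mul]
    have h3 : ∀ x : ℝ, f x * e (-inner ℝ (m : ℝ) x) =
        φ (α * x + s) * e (θ * (α * x + s)) * e (-(m / α * (α * x))) := by
      intro x
      rw [hf]
      simp only [inner_eq_mul]
      congr 2
      field_simp
    simp_rw [h3]
    rw [h1, Complex.real_smul]
    congr 1
    refine integral_congr_ae (Filter.Eventually.of_forall fun y => ?_)
    simp only
    rw [mul_assoc, ← e_add, mul_left_comm, ← e_add]
    congr 2
    simp only [inner_eq_mul]
    ring
  have hsch : ∀ m : ℤ, (𝓕 (hfc.toSchwartzMap hfs) : SchwartzMap ℝ ℂ) (m : ℝ) = ft f m := by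
    intro m
    rw [ft_eq_fourier]
    rfl
  have hbound : ∀ m : ℤ, m ≠ 0 → ‖ft f m‖ ≤ |1 / (m : ℝ) ^ (N + 1)| * (α ^ N * I) := by
    intro m hm
    rw [hval, norm_mul, norm_mul, norm_e, mul_one, Complex.norm_real, Real.norm_eq_abs,
      abs_of_pos (inv_pos.2 hα)]
    have hm1 : (1 : ℝ) ≤ |(m : ℝ)| := by exact_mod_cast Int.one_le_abs hm
    -- `|m / α - θ| ≥ |m| / (2 α)`, and the factor `2 π` absorbs the loss of `2`
    have h1 : |(m : ℝ)| / α ≤ 2 * Real.pi * |m / α - θ| := by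
      have h2 : |(m : ℝ)| / α - |θ| ≤ |m / α - θ| := by
        have := abs_sub_abs_le_abs_sub (m / α : ℝ) θ
        rwa [abs_div, abs_of_pos hα] at this
      have h3 : |θ| ≤ |(m : ℝ)| / α / 2 := by
        rw [div_div, le_div_iff₀ (by positivity)]
        linarith
      have h4 : 3 < Real.pi := Real.pi_gt_three
      have h5 : 0 ≤ |m / α - θ| := abs_nonneg _
      nlinarith
    have h6 := norm_ft_mul_pow_le hφ hs (N + 1) (m / α - θ)
    have h7 : (|(m : ℝ)| / α) ^ (N + 1) * ‖ft φ (m / α - θ)‖ ≤ I := by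
      refine le_trans ?_ h6
      gcongr
    rw [div_pow, div_mul_eq_mul_div, div_le_iff₀ (by positivity)] at h7
    rw [abs_div, abs_one, abs_pow, one_div, inv_mul_le_iff₀ hα, mul_comm α, mul_assoc,
      inv_mul_eq_div, le_div_iff₀ (by positivity)]
    calc _ = |(m : ℝ)| ^ (N + 1) * ‖ft φ (m / α - θ)‖ := mul_comm _ _
      _ ≤ _ := h7
      _ = _ := by ring
  have hzero : ft f (0 : ℤ) = (α⁻¹ : ℝ) * ∫ x, φ x * e (θ * x) := by
    rw [hval]
    simp only [Int.cast_zero, zero_mul, zero_div, e_zero, mul_one, zero_sub, ft]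
    congr 1
    refine integral_congr_ae (Filter.Eventually.of_forall fun y => ?_)
    simp only [inner_eq_mul]
    congr 2
    ring
  have hfsum : Summable fun m : ℤ => ft f m := by
    refine Summable.of_norm_bounded_eventually (hsum.mul_right (α ^ N * I)) ?_
    filter_upwards [(Set.finite_singleton (0 : ℤ)).compl_mem_cofinite] with m hm
    exact hbound m hm
  have hL : ∑' j : ℤ, φ (α * j + s) * e (θ * (α * j + s)) = ∑' m : ℤ, ft f m := by
    simp only [zero_add] at hP
    have h2 : ∀ m : ℤ, (𝓕 (hfc.toSchwartzMap hfs) : SchwartzMap ℝ ℂ) (m : ℝ) *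
        (fourier m) (((0 : ℝ) : AddCircle (1 : ℝ))) = ft f m := by
      intro m
      rw [hsch, AddCircle.coe_zero, fourier_eval_zero, mul_one]
    rw [tsum_congr h2] at hP
    exact hP
  rw [hL, hfsum.tsum_eq_add_tsum_ite 0, hzero, add_sub_cancel_left, mul_assoc, ← tsum_mul_right]
  refine tsum_of_norm_bounded ((hsum.mul_right _).hasSum) fun m => ?_
  split_ifs with h
  · rw [norm_zero]
    positivity
  · exact hbound m h

/-! ### Integration and summation in the plane -/

lemma volume_preserving_plane :
    MeasurePreserving (fun p : ℝ × ℝ => (!₂[p.1, p.2] : Plane)) := by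
  have h1 := (volume_preserving_finTwoArrow ℝ).symm
  have h2 := PiLp.volume_preserving_toLp (Fin 2)
  have h3 := h2.comp h1
  convert! h3 using 1

lemma measurableEmbedding_plane :
    MeasurableEmbedding (fun p : ℝ × ℝ => (!₂[p.1, p.2] : Plane)) := by
  have h1 := (MeasurableEquiv.finTwoArrow (α := ℝ)).symm.measurableEmbedding
  have h2 := (MeasurableEquiv.toLp 2 (Fin 2 → ℝ)).measurableEmbedding
  convert! h2.comp h1 using 1

lemma integrable_plane {F : Plane → ℂ} (hF : Integrable F) :
    Integrable fun p : ℝ × ℝ => F !₂[p.1, p.2] :=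
  (volume_preserving_plane.integrable_comp_emb measurableEmbedding_plane).2 hF

lemma integral_plane_symm {F : Plane → ℂ} (hF : Integrable F) :
    ∫ y, F y = ∫ x₂, ∫ x₁, F !₂[x₁, x₂] := by
  rw [← volume_preserving_plane.integral_comp measurableEmbedding_plane]
  exact integral_prod_symm _ (integrable_plane hF)

lemma norm_iteratedDeriv_comp_line_le {E : Type*} [NormedAddCommGroup E] [NormedSpace ℝ E]
    {G : E → ℂ} (hG : ContDiff ℝ ∞ G) (a v : E) (n : ℕ) (x : ℝ) :
    ‖iteratedDeriv n (fun x : ℝ => G (a + x • v)) x‖ ≤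
      ‖v‖ ^ n * ‖iteratedFDeriv ℝ n G (a + x • v)‖ := by
  rw [← norm_iteratedFDeriv_eq_norm_iteratedDeriv]
  set L : ℝ →L[ℝ] E := ContinuousLinearMap.toSpanSingleton ℝ v with hL
  have hG' : ContDiff ℝ ∞ fun z => G (a + z) := hG.comp (contDiff_const.add contDiff_id)
  have h1 := L.iteratedFDeriv_comp_right hG' x (i := n) (by exact_mod_cast le_top)
  have h2 : (fun x : ℝ => G (a + x • v)) = (fun z => G (a + z)) ∘ L := by
    ext y
    simp [hL]
  rw [h2, h1, iteratedFDeriv_comp_add_left]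
  refine (ContinuousMultilinearMap.norm_compContinuousLinearMap_le _ _).trans (le_of_eq ?_)
  simp [hL, mul_comm]

lemma abs_apply_le_norm (y : Plane) (i : Fin 2) : |y i| ≤ ‖y‖ := PiLp.norm_apply_le y i

lemma norm_plane_sq (a b : ℝ) : ‖(!₂[a, b] : Plane)‖ ^ 2 = a ^ 2 + b ^ 2 := by
  rw [EuclideanSpace.norm_sq_eq]
  simp

lemma plane_eq_fst (a b : ℝ) : (!₂[a, b] : Plane) = !₂[0, b] + a • !₂[1, 0] := by
  ext i
  fin_cases i <;> simp

lemma plane_eq_snd (a b : ℝ) : (!₂[a, b] : Plane) = !₂[a, 0] + b • !₂[0, 1] := by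
  ext i
  fin_cases i <;> simp

lemma section_fst (G : Plane → ℂ) (b : ℝ) :
    (fun a : ℝ => G !₂[a, b]) = fun a : ℝ => G (!₂[0, b] + a • !₂[1, 0]) :=
  funext fun a => by rw [← plane_eq_fst]

lemma section_snd (G : Plane → ℂ) (a : ℝ) :
    (fun b : ℝ => G !₂[a, b]) = fun b : ℝ => G (!₂[a, 0] + b • !₂[0, 1]) :=
  funext fun b => by rw [← plane_eq_snd]

lemma inner_plane (x y : Plane) : inner ℝ x y = x 0 * y 0 + x 1 * y 1 := by
  rw [PiLp.inner_apply, Fin.sum_univ_two, inner_eq_mul, inner_eq_mul]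

@[fun_prop] lemma continuous_plane {X : Type*} [TopologicalSpace X] {f g : X → ℝ}
    (hf : Continuous f) (hg : Continuous g) : Continuous fun x => (!₂[f x, g x] : Plane) := by
  refine (PiLp.continuous_toLp 2 _).comp (continuous_pi fun i => ?_)
  fin_cases i <;> simpa

/-- Integral bound for a function that is bounded and vanishes outside an interval. -/
lemma norm_integral_le_of_support {f : ℝ → ℂ} {B R : ℝ} (hR : 0 ≤ R)
    (hB : ∀ x, |x| ≤ R → ‖f x‖ ≤ B) (hf : ∀ x, R < |x| → f x = 0) : ‖∫ x, f x‖ ≤ 2 * R * B := by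
  have hz : ∀ x ∉ Set.Icc (-R) R, f x = 0 := fun x hx => hf x (by
    rw [Set.mem_Icc, ← abs_le] at hx
    exact not_le.1 hx)
  rw [← setIntegral_eq_integral_of_forall_compl_eq_zero hz]
  refine (norm_setIntegral_le_of_norm_le_const measure_Icc_lt_top fun x hx => hB x (abs_le.2 hx)).trans
    (le_of_eq ?_)
  rw [Real.volume_real_Icc_of_le (by linarith)]
  ring

/-- The integral of a derivative of a function that vanishes for `|x| > R`. -/
lemma integral_norm_iteratedDeriv_le {φ : ℝ → ℂ} {B R : ℝ} (hR : 0 ≤ R) (n : ℕ)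
    (hφ : ∀ x, R < |x| → φ x = 0) (hB : ∀ x, ‖iteratedDeriv n φ x‖ ≤ B) :
    ∫ x, ‖iteratedDeriv n φ x‖ ≤ 2 * R * B := by
  have hz : ∀ x, R < |x| → iteratedDeriv n φ x = 0 := by
    intro x hx
    have h1 : φ =ᶠ[nhds x] fun _ => 0 := by
      filter_upwards [(isOpen_lt continuous_const continuous_abs).mem_nhds hx] with y hy
      exact hφ y hy
    rw [h1.iteratedDeriv_eq]
    simp
  have h2 := norm_integral_le_of_support (f := fun x => ((‖iteratedDeriv n φ x‖ : ℝ) : ℂ)) hR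
    (B := B) (fun x _ => by simpa using hB x) (fun x hx => by simp [hz x hx])
  rw [integral_complex_ofReal, Complex.norm_real, Real.norm_eq_abs] at h2
  exact (le_abs_self _).trans h2

lemma hasCompactSupport_of_abs {E : Type*} [Zero E] {φ : ℝ → E} {R : ℝ}
    (hφ : ∀ x, R < |x| → φ x = 0) :
    HasCompactSupport φ :=
  HasCompactSupport.intro (isCompact_Icc (a := -R) (b := R)) fun x hx => hφ x (by
    rw [Set.mem_Icc, ← abs_le] at hx
    exact not_le.1 hx)

lemma hasCompactSupport_of_norm {E : Type*} [Zero E] {G : Plane → E} {R : ℝ}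
    (hG : ∀ x, R < ‖x‖ → G x = 0) :
    HasCompactSupport G :=
  HasCompactSupport.intro (isCompact_closedBall (0 : Plane) R) fun x hx => hG x (by simpa using hx)

/-- The integers `m` with `|α m + s| ≤ 1`. -/
noncomputable def window (α s : ℝ) : Finset ℤ := Finset.Icc ⌈(-1 - s) / α⌉ ⌊(1 - s) / α⌋

lemma mem_window {α s : ℝ} (hα : 0 < α) (m : ℤ) : m ∈ window α s ↔ |α * m + s| ≤ 1 := by
  rw [window, Finset.mem_Icc, Int.ceil_le, Int.le_floor, div_le_iff₀ hα, le_div_iff₀ hα, abs_le,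
    mul_comm α]
  constructor <;> rintro ⟨h1, h2⟩ <;> constructor <;> linarith

lemma card_window_le {α s : ℝ} (hα : 0 < α) (hα1 : α ≤ 1) : ((window α s).card : ℝ) ≤ 3 / α := by
  rw [window, Int.card_Icc]
  have h1 : (1 : ℝ) ≤ 1 / α := by rw [le_div_iff₀ hα]; linarith
  have h2 : ((⌊(1 - s) / α⌋ + 1 - ⌈(-1 - s) / α⌉ : ℤ) : ℝ) ≤ 3 / α := by
    push_cast
    have h3 := Int.floor_le ((1 - s) / α)
    have h4 := Int.le_ceil ((-1 - s) / α)
    have h5 : 3 / α = (1 - s) / α - (-1 - s) / α + 1 / α := by field_simp; ring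
    linarith
  rcases le_total 0 (⌊(1 - s) / α⌋ + 1 - ⌈(-1 - s) / α⌉) with h | h
  · have : (((⌊(1 - s) / α⌋ + 1 - ⌈(-1 - s) / α⌉).toNat : ℤ) : ℝ) ≤ 3 / α := by
      rwa [Int.toNat_of_nonneg h]
    exact_mod_cast this
  · rw [Int.toNat_of_nonpos h]
    simp
    positivity

/-- Two-dimensional Poisson summation with an error term, by applying the one-dimensional version
to each variable in turn. -/
theorem exists_poisson_bound_plane (N : ℕ) (hN : 1 ≤ N) : ∃ C : ℝ, 0 ≤ C ∧
    ∀ (G : Plane → ℂ) (B α : ℝ) (s θ : Plane), ContDiff ℝ ∞ G → (∀ y, 1 < ‖y‖ → G y = 0) →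
      (∀ n ≤ N + 1, ∀ y, ‖iteratedFDeriv ℝ n G y‖ ≤ B) → 0 < α → α ≤ 1 → α * ‖θ‖ ≤ 1 / 2 →
      ‖(∑' m : Fin 2 → ℤ, G (α • toPlane m + s) * e (inner ℝ θ (α • toPlane m + s))) -
          ((α ^ 2)⁻¹ : ℝ) * ∫ y, G y * e (inner ℝ θ y)‖ ≤ C * B * (α ^ N / α) := by
  obtain ⟨C, hC0, hC⟩ := exists_poisson_bound N hN
  refine ⟨10 * C, by positivity, fun G B α s θ hG hGs hGB hα hα1 hθ => ?_⟩
  have hB0 : 0 ≤ B := (norm_nonneg _).trans (hGB 0 (Nat.zero_le _) 0)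
  have hθi : ∀ i, α * |θ i| ≤ 1 / 2 := fun i =>
    (mul_le_mul_of_nonneg_left (abs_apply_le_norm θ i) hα.le).trans hθ
  have hGc := hG.continuous
  have hz1 : ∀ a b : ℝ, 1 < |a| → G !₂[a, b] = 0 := fun a b h =>
    hGs _ (h.trans_le (by simpa using abs_apply_le_norm !₂[a, b] 0))
  have hz2 : ∀ a b : ℝ, 1 < |b| → G !₂[a, b] = 0 := fun a b h =>
    hGs _ (h.trans_le (by simpa using abs_apply_le_norm !₂[a, b] 1))
  have hunit1 : ‖(!₂[1, 0] : Plane)‖ = 1 := by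
    have := norm_plane_sq 1 0
    have h0 := norm_nonneg (!₂[1, 0] : Plane)
    nlinarith
  have hunit2 : ‖(!₂[0, 1] : Plane)‖ = 1 := by
    have := norm_plane_sq 0 1
    have h0 := norm_nonneg (!₂[0, 1] : Plane)
    nlinarith
  have hs1 : ∀ b, ContDiff ℝ ∞ fun a : ℝ => G !₂[a, b] := by
    intro b
    rw [section_fst]
    exact hG.comp (by fun_prop)
  have hs2 : ∀ a, ContDiff ℝ ∞ fun b : ℝ => G !₂[a, b] := by
    intro a
    rw [section_snd]
    exact hG.comp (by fun_prop)
  have hd1 : ∀ b, ∫ x, ‖iteratedDeriv (N + 1) (fun a : ℝ => G !₂[a, b]) x‖ ≤ 2 * 1 * B := by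
    intro b
    refine integral_norm_iteratedDeriv_le zero_le_one _ (fun a => hz1 a b) fun x => ?_
    rw [section_fst]
    refine (norm_iteratedDeriv_comp_line_le hG _ _ _ _).trans ?_
    rw [hunit1, one_pow, one_mul]
    exact hGB _ le_rfl _
  have hd2 : ∀ a, ∫ x, ‖iteratedDeriv (N + 1) (fun b : ℝ => G !₂[a, b]) x‖ ≤ 2 * 1 * B := by
    intro a
    refine integral_norm_iteratedDeriv_le zero_le_one _ (fun b => hz2 a b) fun x => ?_
    rw [section_snd]
    refine (norm_iteratedDeriv_comp_line_le hG _ _ _ _).trans ?_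
    rw [hunit2, one_pow, one_mul]
    exact hGB _ le_rfl _
  -- the two one-dimensional estimates
  have hP2 : ∀ a, ‖(∑' j : ℤ, G !₂[a, α * j + s 1] * e (θ 1 * (α * j + s 1))) -
      (α⁻¹ : ℝ) * ∫ x, G !₂[a, x] * e (θ 1 * x)‖ ≤ C * α ^ N * (2 * 1 * B) := fun a =>
    (hC (fun b => G !₂[a, b]) α (s 1) (θ 1) (hs2 a) (hasCompactSupport_of_abs (hz2 a)) hα
      (hθi 1)).trans (by gcongr; exact hd2 a)
  have hP1 : ∀ b, ‖(∑' j : ℤ, G !₂[α * j + s 0, b] * e (θ 0 * (α * j + s 0))) -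
      (α⁻¹ : ℝ) * ∫ x, G !₂[x, b] * e (θ 0 * x)‖ ≤ C * α ^ N * (2 * 1 * B) := fun b =>
    (hC (fun a => G !₂[a, b]) α (s 0) (θ 0) (hs1 b) (hasCompactSupport_of_abs fun a => hz1 a b) hα
      (hθi 0)).trans (by gcongr; exact hd1 b)
  -- the `j` for which the line with first coordinate `α j + s 0` meets the unit disc
  set W := window α (s 0) with hW
  set a : ℤ → ℝ := fun j => α * j + s 0 with ha
  have hWz : ∀ j ∉ W, ∀ b, G !₂[a j, b] = 0 := fun j hj b =>
    hz1 _ _ (by rw [hW, mem_window hα] at hj; exact not_le.1 hj)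
  -- the sum as an iterated sum
  have hsum : ∑' m : Fin 2 → ℤ, G (α • toPlane m + s) * e (inner ℝ θ (α • toPlane m + s)) =
      ∑ j ∈ W, e (θ 0 * a j) * ∑' l : ℤ, G !₂[a j, α * l + s 1] * e (θ 1 * (α * l + s 1)) := by
    set H : ℤ × ℤ → ℂ := fun p => e (θ 0 * a p.1) *
      (G !₂[a p.1, α * p.2 + s 1] * e (θ 1 * (α * p.2 + s 1))) with hH
    have h1 : ∀ m : Fin 2 → ℤ, G (α • toPlane m + s) * e (inner ℝ θ (α • toPlane m + s)) =
        H (finTwoArrowEquiv ℤ m) := by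
      intro m
      have h2 : α • toPlane m + s = !₂[a (m 0), α * m 1 + s 1] := by
        ext i
        fin_cases i <;> simp [toPlane, ha]
      rw [h2, inner_plane]
      simp only [hH, e_add, finTwoArrowEquiv_apply]
      simp
      ring
    rw [tsum_congr h1, (finTwoArrowEquiv ℤ).tsum_eq H]
    have hHs : Summable H := by
      refine summable_of_ne_finset_zero (s := W ×ˢ window α (s 1)) fun p hp => ?_
      rw [Finset.mem_product, not_and_or] at hp
      rcases hp with hp | hp
      · simp [hH, hWz _ hp]
      · rw [mem_window hα] at hp
        simp [hH, hz2 _ _ (not_le.1 hp)]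
    rw [hHs.tsum_prod, tsum_eq_sum (s := W)]
    · exact Finset.sum_congr rfl fun j _ => by
        simp only [hH]
        exact tsum_mul_left
    · intro j hj
      simp [hH, hWz _ hj]
  have hint : Integrable fun y => G y * e (inner ℝ θ y) := by
    have h1 : HasCompactSupport fun y => G y * e (inner ℝ θ y) :=
      (hasCompactSupport_of_norm hGs).mul_right
    exact (by fun_prop : Continuous _).integrable_of_hasCompactSupport h1
  have hI : ∫ y, G y * e (inner ℝ θ y) =
      ∫ x, e (θ 1 * x) * ∫ t, G !₂[t, x] * e (θ 0 * t) := by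
    rw [integral_plane_symm hint]
    refine integral_congr_ae (Filter.Eventually.of_forall fun x => ?_)
    simp only
    rw [← integral_const_mul]
    refine integral_congr_ae (Filter.Eventually.of_forall fun t => ?_)
    simp only [inner_plane, e_add]
    simp
    ring
  -- the sum over the first variable alone, as a function of the second variable
  set D : ℝ → ℂ := fun x => ∑ j ∈ W, G !₂[a j, x] * e (θ 0 * a j) with hD
  have hDt : ∀ x, D x = ∑' j : ℤ, G !₂[α * j + s 0, x] * e (θ 0 * (α * j + s 0)) := fun x =>
    (tsum_eq_sum (s := W) fun j hj => by
      have := hWz j hj x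
      simp only [ha] at this
      rw [this, zero_mul]).symm
  have hDc : Continuous D := by rw [hD]; fun_prop
  have hDI : ∑ j ∈ W, e (θ 0 * a j) * ∫ x, G !₂[a j, x] * e (θ 1 * x) =
      ∫ x, e (θ 1 * x) * D x := by
    simp_rw [← integral_const_mul]
    rw [← integral_finsetSum]
    · refine integral_congr_ae (Filter.Eventually.of_forall fun x => ?_)
      simp only [hD, Finset.mul_sum]
      exact Finset.sum_congr rfl fun j _ => by ring
    · intro j _
      refine (by fun_prop : Continuous _).integrable_of_hasCompactSupport ?_
      exact ((hasCompactSupport_of_abs (hz2 (a j))).mul_right).mul_left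
  have hJ : Integrable fun x => e (θ 1 * x) * ∫ t, G !₂[t, x] * e (θ 0 * t) := by
    have h1 := (integrable_plane hint).integral_prod_right
    refine h1.congr (Filter.Eventually.of_forall fun x => ?_)
    simp only
    rw [← integral_const_mul]
    refine integral_congr_ae (Filter.Eventually.of_forall fun t => ?_)
    simp only [inner_plane, e_add]
    simp
    ring
  have hDint : Integrable fun x => e (θ 1 * x) * D x := by
    refine (by fun_prop : Continuous _).integrable_of_hasCompactSupport ?_
    refine HasCompactSupport.mul_left (hasCompactSupport_of_abs (R := 1) fun x hx => ?_)
    rw [hD]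
    exact Finset.sum_eq_zero fun j _ => by rw [hz2 _ _ hx, zero_mul]
  -- Poisson summation in the second variable, on each of the `O(1 / α)` lines
  have hE1 : ‖(∑ j ∈ W, e (θ 0 * a j) * ∑' l : ℤ, G !₂[a j, α * l + s 1] *
      e (θ 1 * (α * l + s 1))) - (α⁻¹ : ℝ) * ∫ x, e (θ 1 * x) * D x‖ ≤
      3 / α * (C * α ^ N * (2 * 1 * B)) := by
    rw [← hDI, Finset.mul_sum, ← Finset.sum_sub_distrib]
    refine (norm_sum_le_of_le (f := fun j => _) W (n := fun _ => C * α ^ N * (2 * 1 * B))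
      fun j _ => ?_).trans ?_
    · rw [mul_left_comm, ← mul_sub, norm_mul, norm_e, one_mul]
      exact hP2 (a j)
    · rw [Finset.sum_const, nsmul_eq_mul]
      gcongr
      exact card_window_le hα hα1
  -- Poisson summation in the first variable, under the integral over the second one
  have hE2 : ‖(∫ x, e (θ 1 * x) * D x) -
      (α⁻¹ : ℝ) * ∫ y, G y * e (inner ℝ θ y)‖ ≤ 2 * 1 * (C * α ^ N * (2 * 1 * B)) := by
    rw [hI, ← integral_const_mul, ← integral_sub hDint (hJ.const_mul _)]
    refine norm_integral_le_of_support zero_le_one (fun x _ => ?_) fun x hx => ?_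
    · rw [mul_left_comm, ← mul_sub, norm_mul, norm_e, one_mul, hDt]
      exact hP1 x
    · simp only [hD, hz2 _ _ hx]
      simp
  rw [hsum]
  have hsplit : ∀ S J K : ℂ, S - ((α ^ 2)⁻¹ : ℝ) * K =
      (S - (α⁻¹ : ℝ) * J) + (α⁻¹ : ℝ) * (J - (α⁻¹ : ℝ) * K) := by
    intro S J K
    push_cast
    ring
  rw [hsplit _ (∫ x, e (θ 1 * x) * D x)]
  refine (norm_add_le _ _).trans ?_
  rw [norm_mul, Complex.norm_real, Real.norm_eq_abs, abs_of_pos (inv_pos.2 hα)]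
  calc _ ≤ 3 / α * (C * α ^ N * (2 * 1 * B)) + α⁻¹ * (2 * 1 * (C * α ^ N * (2 * 1 * B))) := by
        gcongr
    _ = 10 * C * B * (α ^ N / α) := by field_simp; ring

end DeltaSymbol

namespace DeltaSymbol

open scoped FourierTransform

/-! ### The weights and the kernel `p₁` -/

section Weights

variable {ω ω₀ : ℝ → ℝ}

lemma IsWeight.apply_of_le_half (hω : IsWeight ω) {x : ℝ} (hx : x ≤ 1 / 2) : ω x = 0 := by
  by_contra h
  have := (hω.support h).1
  linarith

lemma IsWeight.apply_of_one_le (hω : IsWeight ω) {x : ℝ} (hx : 1 ≤ x) : ω x = 0 := by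
  by_contra h
  have := (hω.support h).2
  linarith

lemma IsCutoff.apply_of_half_le (hω₀ : IsCutoff ω₀) {x : ℝ} (hx : 1 / 2 ≤ |x|) : ω₀ x = 0 := by
  by_contra h
  have h1 := hω₀.support h
  have : |x| < 1 / 2 := abs_lt.2 ⟨by linarith [h1.1], h1.2⟩
  linarith

lemma contDiff_ofReal {E : Type*} [NormedAddCommGroup E] [NormedSpace ℝ E] {f : E → ℝ}
    (hf : ContDiff ℝ (⊤ : ℕ∞) f) : ContDiff ℝ (⊤ : ℕ∞) fun x => (f x : ℂ) :=
  Complex.ofRealCLM.contDiff.comp hf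

lemma IsWeight.abs_eq (hω : IsWeight ω) (x : ℝ) : ω |x| = ω x + ω (-x) := by
  rcases le_total 0 x with h | h
  · rw [abs_of_nonneg h, hω.apply_of_le_half (x := -x) (by linarith), add_zero]
  · rw [abs_of_nonpos h, hω.apply_of_le_half (x := x) (by linarith), zero_add]

lemma IsWeight.contDiff_abs (hω : IsWeight ω) : ContDiff ℝ (⊤ : ℕ∞) fun x => ω |x| := by
  simp_rw [hω.abs_eq]
  exact hω.smooth.add (hω.smooth.comp contDiff_neg)

lemma IsWeight.contDiff_norm (hω : IsWeight ω) : ContDiff ℝ (⊤ : ℕ∞) fun y : Plane => ω ‖y‖ := by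
  have h := contDiff_even_comp_norm (E := Plane) hω.contDiff_abs fun x => by rw [abs_neg]
  simpa using h

lemma IsCutoff.contDiff_norm (hω₀ : IsCutoff ω₀) : ContDiff ℝ (⊤ : ℕ∞) fun y : Plane => ω₀ ‖y‖ :=
  contDiff_even_comp_norm hω₀.smooth hω₀.even

lemma IsCutoff.apply_abs (hω₀ : IsCutoff ω₀) (x : ℝ) : ω₀ |x| = ω₀ x := by
  rcases abs_choice x with h | h <;> rw [h]
  exact hω₀.even x

lemma IsWeight.exists_bound (hω : IsWeight ω) : ∃ B : ℝ, 0 ≤ B ∧ ∀ x, ω x ≤ B := by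
  have hs : HasCompactSupport ω := hasCompactSupport_of_abs (R := 1) fun x hx => by
    rcases lt_abs.1 hx with h | h
    · exact hω.apply_of_one_le h.le
    · exact hω.apply_of_le_half (by linarith)
  obtain ⟨B, hB⟩ := hω.smooth.continuous.bounded_above_of_compact_support hs
  exact ⟨B, (norm_nonneg _).trans (hB 0), fun x => (le_abs_self _).trans (hB x)⟩

/-- The radial function `ω₀(|y|)` on the plane. -/
noncomputable def cutoffPlane (ω₀ : ℝ → ℝ) (y : Plane) : ℂ := (ω₀ ‖y‖ : ℂ)

lemma IsCutoff.contDiff_cutoffPlane (hω₀ : IsCutoff ω₀) : ContDiff ℝ (⊤ : ℕ∞) (cutoffPlane ω₀) :=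
  contDiff_ofReal hω₀.contDiff_norm

lemma IsCutoff.cutoffPlane_eq_zero (hω₀ : IsCutoff ω₀) {y : Plane} (hy : 1 / 2 ≤ ‖y‖) :
    cutoffPlane ω₀ y = 0 := by
  rw [cutoffPlane, hω₀.apply_of_half_le (by rwa [abs_norm]), Complex.ofReal_zero]

lemma IsCutoff.hasCompactSupport_cutoffPlane (hω₀ : IsCutoff ω₀) :
    HasCompactSupport (cutoffPlane ω₀) :=
  hasCompactSupport_of_norm (R := 1 / 2) fun _ hx => hω₀.cutoffPlane_eq_zero hx.le

/-- The family `ω(|y|) ω₀(t |y|)`, `t ∈ ℝ`. -/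
noncomputable def bump (ω₀ ω : ℝ → ℝ) (t : ℝ) (y : Plane) : ℂ := ((ω ‖y‖ * ω₀ (t * ‖y‖) : ℝ) : ℂ)

lemma IsCutoff.bump_eq (hω₀ : IsCutoff ω₀) (ω : ℝ → ℝ) (t : ℝ) (y : Plane) :
    bump ω₀ ω t y = (ω ‖y‖ : ℂ) * cutoffPlane ω₀ (t • y) := by
  rw [bump, cutoffPlane, norm_smul, Real.norm_eq_abs, ← hω₀.apply_abs (t * ‖y‖), abs_mul, abs_norm]
  push_cast
  rfl

lemma contDiff_bump (hω : IsWeight ω) (hω₀ : IsCutoff ω₀) (t : ℝ) :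
    ContDiff ℝ (⊤ : ℕ∞) (bump ω₀ ω t) := by
  rw [show bump ω₀ ω t = _ from funext (hω₀.bump_eq ω t)]
  exact (contDiff_ofReal hω.contDiff_norm).mul (hω₀.contDiff_cutoffPlane.comp (by fun_prop))

lemma bump_eq_zero (hω : IsWeight ω) (t : ℝ) {y : Plane} (hy : 1 ≤ ‖y‖) : bump ω₀ ω t y = 0 := by
  simp [bump, hω.apply_of_one_le hy]

lemma bump_eq_zero_of_one_le (hω : IsWeight ω) (hω₀ : IsCutoff ω₀) {t : ℝ} (ht : 1 ≤ |t|)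
    (y : Plane) : bump ω₀ ω t y = 0 := by
  rw [bump]
  rcases le_total ‖y‖ (1 / 2) with h | h
  · simp [hω.apply_of_le_half h]
  · rw [hω₀.apply_of_half_le (x := t * ‖y‖)]
    · simp
    · rw [abs_mul, abs_norm]
      nlinarith

/-- The derivatives of `ω(|y|) ω₀(t |y|)` are bounded uniformly in `t`: for `|t| ≤ 1` by the chain
rule, and for `|t| ≥ 1` the function vanishes. -/
lemma exists_bump_bound (hω : IsWeight ω) (hω₀ : IsCutoff ω₀) (M : ℕ) :
    ∃ B : ℝ, 0 ≤ B ∧ ∀ t, ∀ n ≤ M, ∀ y, ‖iteratedFDeriv ℝ n (bump ω₀ ω t) y‖ ≤ B := by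
  have hG := contDiff_ofReal hω.contDiff_norm
  have hGs : HasCompactSupport fun y : Plane => (ω ‖y‖ : ℂ) :=
    hasCompactSupport_of_norm (R := 1) fun y hy => by simp [hω.apply_of_one_le hy.le]
  obtain ⟨B₁, h₁, hB₁⟩ := exists_iteratedFDeriv_bound hG hGs M
  obtain ⟨B₀, h₀, hB₀⟩ := exists_iteratedFDeriv_bound hω₀.contDiff_cutoffPlane
    hω₀.hasCompactSupport_cutoffPlane M
  refine ⟨2 ^ M * (B₁ * B₀), by positivity, fun t n hn y => ?_⟩
  rcases le_total 1 |t| with ht | ht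
  · rw [show bump ω₀ ω t = fun _ => 0 from funext (bump_eq_zero_of_one_le hω hω₀ ht)]
    simp
    positivity
  set L : Plane →L[ℝ] Plane := t • ContinuousLinearMap.id ℝ Plane with hL
  have hcomp : ∀ i ≤ M, ‖iteratedFDeriv ℝ i (fun y => cutoffPlane ω₀ (t • y)) y‖ ≤ B₀ := by
    intro i hi
    have h1 := L.iteratedFDeriv_comp_right hω₀.contDiff_cutoffPlane y (i := i)
      (by exact_mod_cast le_top)
    have h2 : (fun y => cutoffPlane ω₀ (t • y)) = cutoffPlane ω₀ ∘ L := by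
      ext z
      simp [hL]
    rw [h2, h1]
    refine (ContinuousMultilinearMap.norm_compContinuousLinearMap_le _ _).trans ?_
    have hL1 : ‖L‖ ≤ 1 := by
      rw [hL, norm_smul]
      exact mul_le_one₀ ht (norm_nonneg _) ContinuousLinearMap.norm_id_le
    rw [Finset.prod_const]
    calc _ ≤ B₀ * 1 := by
          gcongr
          · exact hB₀ i hi _
          · exact pow_le_one₀ (norm_nonneg _) hL1
      _ = B₀ := mul_one _
  rw [show bump ω₀ ω t = _ from funext (hω₀.bump_eq ω t)]
  refine (norm_iteratedFDeriv_mul_le hG (hω₀.contDiff_cutoffPlane.comp (by fun_prop)) y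
    (n := n) (by exact_mod_cast le_top)).trans ?_
  calc _ ≤ ∑ i ∈ Finset.range (n + 1), (n.choose i : ℝ) * B₁ * B₀ := by
        refine Finset.sum_le_sum fun i hi => ?_
        have hi' := Finset.mem_range.1 hi
        gcongr
        · exact hB₁ i (by omega) y
        · exact hcomp (n - i) (by omega)
    _ = 2 ^ n * (B₁ * B₀) := by
        rw [← Finset.sum_mul, ← Finset.sum_mul]
        have := Nat.sum_range_choose n
        rw [mul_assoc]
        congr 1
        exact_mod_cast this
    _ ≤ _ := by gcongr; norm_num

/-- The Fourier transform of `ω(|y|) ω₀(t |y|)`. -/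
noncomputable def bumpFt (ω₀ ω : ℝ → ℝ) (t : ℝ) (u : Plane) : ℂ := ft (bump ω₀ ω t) u

lemma exists_bumpFt_decay (hω : IsWeight ω) (hω₀ : IsCutoff ω₀) (M : ℕ) :
    ∃ C : ℝ, 0 ≤ C ∧ ∀ t u, (1 + ‖u‖) ^ M * ‖bumpFt ω₀ ω t u‖ ≤ C := by
  obtain ⟨B, hB0, hB⟩ := exists_bump_bound hω hω₀ M
  obtain ⟨C, hC0, hC⟩ := exists_ft_decay (V := Plane) M 1
  exact ⟨C * B, by positivity, fun t u => hC _ B (contDiff_bump hω hω₀ t)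
    (fun y hy => bump_eq_zero hω t hy.le) (hB t) u⟩

lemma bumpFt_eq_zero_of_one_le (hω : IsWeight ω) (hω₀ : IsCutoff ω₀) {t : ℝ} (ht : 1 ≤ |t|)
    (u : Plane) : bumpFt ω₀ ω t u = 0 := by
  simp [bumpFt, ft, bump_eq_zero_of_one_le hω hω₀ ht]

lemma tsum_pnat_eq_sum {E : Type*} [AddCommMonoid E] [TopologicalSpace E] [T2Space E]
    (f : ℕ → E) (J : ℕ) (hf : ∀ j, J < j → f j = 0) :
    ∑' j : ℕ+, f j = ∑ j ∈ Finset.Icc 1 J, f j := by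
  rw [tsum_pnat_eq_tsum_succ (f := f), tsum_eq_sum (s := Finset.range J) fun j hj => hf _ (by
    simp at hj; omega)]
  rw [Finset.range_eq_Ico, Finset.sum_Ico_add' f 0 J 1]
  rfl

/-- The powers of `Q` in the kernels, expressed by `X = Q^{1/2}`. -/
lemma sqrt_pow_facts {Q : ℝ} (hQ : 1 ≤ Q) :
    1 ≤ Q ^ (1 / 2 : ℝ) ∧ Q ^ (1 / 2 : ℝ) * Q ^ (1 / 2 : ℝ) = Q ∧
      Q ^ (3 / 2 : ℝ) = Q * Q ^ (1 / 2 : ℝ) := by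
  have h0 : 0 < Q := by linarith
  refine ⟨Real.one_le_rpow hQ (by norm_num), ?_, ?_⟩
  · rw [← Real.rpow_add h0]
    norm_num
  · rw [show (3 / 2 : ℝ) = 1 + 1 / 2 by norm_num, Real.rpow_add h0, Real.rpow_one]

/-- On the support of the cut-off only finitely many terms of the kernel `p₁` are non-zero. -/
lemma cutoff_mul_tsum_eq (hω : IsWeight ω) (hω₀ : IsCutoff ω₀) {Q : ℝ} (hQ : 1 ≤ Q) {q : ℕ}
    (hq : 1 ≤ q) {J : ℕ} (hJ : Q ≤ (J + 1) * q) (x : ℝ) :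
    ω₀ (x / Q ^ (3 / 2 : ℝ)) * (∑' j : ℕ+, (1 / ((q : ℝ) ^ 2 * ((j : ℕ) : ℝ) ^ 2)) *
          ω (x / ((j : ℕ) * q * Q ^ (1 / 2 : ℝ)))) =
      ∑ j ∈ Finset.Icc 1 J, (1 / ((q : ℝ) ^ 2 * (j : ℝ) ^ 2)) *
          (ω (x / (j * q * Q ^ (1 / 2 : ℝ))) * ω₀ (x / Q ^ (3 / 2 : ℝ))) := by
  obtain ⟨hX1, hXX, hX3⟩ := sqrt_pow_facts hQ
  set X := Q ^ (1 / 2 : ℝ) with hX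
  have hq' : (0 : ℝ) < q := by exact_mod_cast hq
  by_cases h0 : ω₀ (x / Q ^ (3 / 2 : ℝ)) = 0
  · simp [h0]
  · have hx2 : x / Q ^ (3 / 2 : ℝ) < 1 / 2 := by
      by_contra h
      refine h0 (hω₀.apply_of_half_le ?_)
      exact (not_lt.1 h).trans (le_abs_self _)
    rw [hX3, div_lt_iff₀ (by positivity)] at hx2
    rw [tsum_pnat_eq_sum (fun j => (1 / ((q : ℝ) ^ 2 * (j : ℝ) ^ 2)) * ω (x / (j * q * X))) J,
      Finset.mul_sum]
    · exact Finset.sum_congr rfl fun j _ => by ring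
    · intro j hj
      have hj1 : (J : ℝ) + 1 ≤ j := by exact_mod_cast hj
      have hj0 : (0 : ℝ) < j := by
        have : (0 : ℝ) ≤ J := Nat.cast_nonneg _
        linarith
      rw [hω.apply_of_le_half, mul_zero]
      rw [div_le_iff₀ (by positivity)]
      have : Q * X ≤ j * q * X := by
        gcongr
        exact hJ.trans (by gcongr)
      nlinarith

lemma integral_comp_smul_plane (F : Plane → ℂ) {s : ℝ} (hs : 0 < s) :
    ∫ x, F x = ((s ^ 2 : ℝ) : ℂ) * ∫ y, F (s • y) := by
  have h := Measure.integral_comp_smul (volume : Measure Plane) F s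
  simp only [finrank_euclideanSpace, Fintype.card_fin] at h
  rw [h, abs_of_pos (by positivity), Complex.real_smul, ← mul_assoc, ← Complex.ofReal_mul,
    mul_inv_cancel₀ (by positivity), Complex.ofReal_one, one_mul]

/-- The substitution `x = j q Q^{1/2} y` in the `j`-th term of `p₁`. -/
theorem p1_eq_sum_bumpFt (hω : IsWeight ω) (hω₀ : IsCutoff ω₀) {Q : ℝ} (hQ : 1 ≤ Q) {q : ℕ}
    (hq : 1 ≤ q) {J : ℕ} (hJ : Q ≤ (J + 1) * q) (w : Plane) :
    p1 ω₀ ω Q q w = ((-(2 * normConst ω) : ℝ) : ℂ) *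
      ∑ j ∈ Finset.Icc 1 J, bumpFt ω₀ ω (j * q / Q) ((j * q * Q ^ (1 / 2 : ℝ)) • w) := by
  obtain ⟨hX1, hXX, hX3⟩ := sqrt_pow_facts hQ
  rw [p1]
  simp_rw [cutoff_mul_tsum_eq hω hω₀ hQ hq hJ]
  set X := Q ^ (1 / 2 : ℝ) with hX
  have hq' : (0 : ℝ) < q := by exact_mod_cast hq
  have hX0 : 0 < X := by linarith
  have hQ0 : 0 < Q := by linarith
  set F : ℕ → Plane → ℂ := fun j x => ((1 / ((q : ℝ) ^ 2 * (j : ℝ) ^ 2) *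
    (ω (‖x‖ / (j * q * X)) * ω₀ (‖x‖ / Q ^ (3 / 2 : ℝ))) : ℝ) : ℂ) * e (-inner ℝ w x) with hF
  have hFs : ∀ j ∈ Finset.Icc 1 J, ∀ y, F j ((j * q * X) • y) =
      ((1 / ((q : ℝ) ^ 2 * (j : ℝ) ^ 2) : ℝ) : ℂ) *
        (bump ω₀ ω (j * q / Q) y * e (-inner ℝ ((j * q * X) • w) y)) := by
    intro j hj y
    have hj0 : (0 : ℝ) < j := by exact_mod_cast (Finset.mem_Icc.1 hj).1
    have hs : 0 < j * q * X := by positivity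
    simp only [hF, bump]
    rw [norm_smul, Real.norm_eq_abs, abs_of_pos hs, inner_smul_right, inner_smul_left]
    rw [mul_div_cancel_left₀ _ hs.ne', hX3,
      show j * q * X * ‖y‖ / (Q * X) = j * q / Q * ‖y‖ by field_simp]
    push_cast
    simp
    ring
  have hFi : ∀ j ∈ Finset.Icc 1 J, Integrable (F j) := by
    intro j hj
    have hj0 : (0 : ℝ) < j := by exact_mod_cast (Finset.mem_Icc.1 hj).1
    have hs : 0 < j * q * X := by positivity
    rw [← integrable_comp_smul_iff volume (F j) hs.ne']
    simp_rw [hFs j hj]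
    refine Continuous.integrable_of_hasCompactSupport ?_ ?_
    · have := (contDiff_bump hω hω₀ (j * q / Q)).continuous
      fun_prop
    · exact HasCompactSupport.mul_left (HasCompactSupport.mul_right
        (hasCompactSupport_of_norm (R := 1) fun y hy => bump_eq_zero hω _ hy.le))
  have h1 : ∀ x, ((∑ j ∈ Finset.Icc 1 J, 1 / ((q : ℝ) ^ 2 * (j : ℝ) ^ 2) *
    (ω (‖x‖ / (j * q * X)) * ω₀ (‖x‖ / Q ^ (3 / 2 : ℝ))) : ℝ) : ℂ) * e (-inner ℝ w x) =
      ∑ j ∈ Finset.Icc 1 J, F j x := by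
    intro x
    rw [Complex.ofReal_sum, Finset.sum_mul]
  simp_rw [h1]
  rw [integral_finsetSum _ hFi, Finset.mul_sum, Finset.mul_sum]
  refine Finset.sum_congr rfl fun j hj => ?_
  have hj0 : (0 : ℝ) < j := by exact_mod_cast (Finset.mem_Icc.1 hj).1
  rw [integral_comp_smul_plane (F j) (s := j * q * X) (by positivity)]
  simp_rw [hFs j hj]
  rw [integral_const_mul, ← mul_assoc, ← mul_assoc, bumpFt, ft, ← Complex.ofReal_mul,
    ← Complex.ofReal_mul]
  congr 2
  rw [mul_pow, sq X, hXX]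
  field_simp

/-- The sum is compared with `∫ (1 + t x)⁻² dt = x⁻¹`, by telescoping. -/
lemma sum_inv_sq_le {x : ℝ} (hx : 0 < x) (J : ℕ) :
    ∑ j ∈ Finset.Icc 1 J, ((1 + j * x) ^ 2)⁻¹ ≤ x⁻¹ := by
  have h : ∑ j ∈ Finset.Icc 1 J, ((1 + j * x) ^ 2)⁻¹ ≤ x⁻¹ * (1 - (1 + J * x)⁻¹) := by
    induction J with
    | zero => simp
    | succ J ih =>
      rw [Finset.sum_Icc_succ_top (by omega)]
      refine (add_le_add_left ih _).trans ?_
      have h0 : (0 : ℝ) ≤ J := Nat.cast_nonneg _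
      have h1 : 0 < 1 + J * x := by positivity
      have h2 : 0 < 1 + (J + 1) * x := by positivity
      push_cast
      rw [← sub_nonneg]
      have : x⁻¹ * (1 - (1 + (J + 1) * x)⁻¹) - (x⁻¹ * (1 - (1 + J * x)⁻¹) +
          ((1 + (J + 1) * x) ^ 2)⁻¹) = x / ((1 + J * x) * (1 + (J + 1) * x) ^ 2) := by
        field_simp
        ring
      rw [this]
      positivity
  refine h.trans (mul_le_of_le_one_right (by positivity) ?_)
  have : 0 ≤ (1 + J * x)⁻¹ := by positivity
  linarith

lemma sum_inv_sq_le_div {x T : ℝ} (hx : 0 ≤ x) (hT : 0 < T) {J : ℕ} (hJ : (J : ℝ) ≤ T) :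
    ∑ j ∈ Finset.Icc 1 J, ((1 + j * x) ^ 2)⁻¹ ≤ 2 * (T / (1 + x * T)) := by
  rcases le_total (x * T) 1 with h | h
  · have h1 : ∑ j ∈ Finset.Icc 1 J, ((1 + (j : ℝ) * x) ^ 2)⁻¹ ≤ (J : ℝ) := by
      refine (Finset.sum_le_card_nsmul _ _ 1 fun j _ => ?_).trans (by simp)
      refine inv_le_one_of_one_le₀ (one_le_pow₀ ?_)
      have : 0 ≤ j * x := by positivity
      linarith
    refine h1.trans (hJ.trans ?_)
    rw [← mul_div_assoc, le_div_iff₀ (by positivity)]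
    nlinarith
  · have hx0 : 0 < x := by
      by_contra hx0
      have : x = 0 := le_antisymm (not_lt.1 hx0) hx
      rw [this] at h
      norm_num at h
    refine (sum_inv_sq_le hx0 J).trans ?_
    rw [← mul_div_assoc, le_div_iff₀ (by positivity), inv_mul_le_iff₀ hx0]
    nlinarith

lemma inv_pow_le_rpow_neg {x N : ℝ} {m : ℕ} (hx : 1 ≤ x) (hm : N ≤ m) : (x ^ m)⁻¹ ≤ x ^ (-N) := by
  rw [← Real.rpow_natCast, ← Real.rpow_neg (by linarith)]
  exact Real.rpow_le_rpow_of_exponent_le hx (by linarith)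

/-- The decay of `p₁`. -/
theorem exists_p1_bound (hω : IsWeight ω) (hω₀ : IsCutoff ω₀) (N : ℝ) :
    ∃ C : ℝ, 0 ≤ C ∧ ∀ Q : ℝ, 1 ≤ Q → ∀ q : ℕ, 1 ≤ q → ∀ w : Plane,
      ‖p1 ω₀ ω Q q w‖ ≤ C * (Q / (q * (1 + ‖w‖ * Q ^ (3 / 2 : ℝ))) *
              (1 + ‖w‖ * q * Q ^ (1 / 2 : ℝ)) ^ (-N)) := by
  set m := ⌈N⌉₊ with hm
  obtain ⟨C, hC0, hC⟩ := exists_bumpFt_decay hω hω₀ (m + 2)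
  refine ⟨|2 * normConst ω| * C * 2, by positivity, fun Q hQ q hq w => ?_⟩
  have hq' : (0 : ℝ) < q := by exact_mod_cast hq
  have hQ0 : 0 < Q := by linarith
  have hJ : Q ≤ (⌊Q / q⌋₊ + 1) * q := by
    have := (Nat.lt_floor_add_one (Q / q)).le
    rwa [div_le_iff₀ hq'] at this
  rw [p1_eq_sum_bumpFt hω hω₀ hQ hq hJ, norm_mul, Complex.norm_real, Real.norm_eq_abs, abs_neg]
  obtain ⟨hX1, hXX, hX3⟩ := sqrt_pow_facts hQ
  set X := Q ^ (1 / 2 : ℝ) with hX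
  have hX0 : 0 < X := by linarith
  set x := ‖w‖ * q * X with hx
  have hx0 : 0 ≤ x := by positivity
  have hterm : ∀ j ∈ Finset.Icc 1 ⌊Q / q⌋₊,
      ‖bumpFt ω₀ ω (j * q / Q) ((j * q * X) • w)‖ ≤
        C * (1 + x) ^ (-N) * ((1 + j * x) ^ 2)⁻¹ := by
    intro j hj
    have hj1 : (1 : ℝ) ≤ j := by exact_mod_cast (Finset.mem_Icc.1 hj).1
    have h1 := hC (j * q / Q) ((j * q * X) • w)
    have hn : ‖(j * q * X) • w‖ = j * x := by
      rw [norm_smul, Real.norm_eq_abs, abs_of_pos (by positivity), hx]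
      ring
    rw [hn, mul_comm, ← le_div_iff₀ (by positivity)] at h1
    refine h1.trans ?_
    rw [pow_add, ← div_div, div_eq_mul_inv, div_eq_mul_inv]
    gcongr
    refine le_trans ?_ (inv_pow_le_rpow_neg (by linarith) (Nat.le_ceil N))
    gcongr
    nlinarith
  have hsum := sum_inv_sq_le_div hx0 (T := Q / q) (by positivity)
    (Nat.floor_le (by positivity : 0 ≤ Q / q))
  calc |2 * normConst ω| * ‖∑ j ∈ Finset.Icc 1 ⌊Q / q⌋₊, bumpFt ω₀ ω (j * q / Q)
        ((j * q * X) • w)‖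
      ≤ |2 * normConst ω| * ∑ j ∈ Finset.Icc 1 ⌊Q / q⌋₊,
        C * (1 + x) ^ (-N) * ((1 + j * x) ^ 2)⁻¹ := by
        gcongr
        exact norm_sum_le_of_le _ hterm
    _ ≤ |2 * normConst ω| * (C * (1 + x) ^ (-N) * (2 * (Q / q / (1 + x * (Q / q))))) := by
        rw [← Finset.mul_sum]
        have : 0 ≤ (1 + x) ^ (-N) := Real.rpow_nonneg (by linarith) _
        gcongr
    _ = _ := by
        have : x * (Q / q) = ‖w‖ * Q ^ (3 / 2 : ℝ) := by
          rw [hx, hX3]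
          field_simp
        rw [this, div_div]
        ring

end Weights

/-! ### The function `h` -/

section KernelH

variable {ω : ℝ → ℝ}

/-- The series for `h` breaks off once `η j ≥ 1` and `η j ≥ 2 |z|`. -/
lemma h_eq_sum (hω : IsWeight ω) {η z : ℝ} {J : ℕ} (hη : 0 < η) (hJ : 1 ≤ η * (J + 1))
    (hz : 2 * |z| ≤ η * (J + 1)) :
    h ω η z = ∑ j ∈ Finset.Icc 1 J, 1 / (η * j) * (ω (η * j) - ω (|z| / (η * j))) := by
  rw [h, tsum_pnat_eq_sum (fun j => 1 / (η * j) * (ω (η * j) - ω (|z| / (η * j)))) J]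
  intro j hj
  have hj1 : (J : ℝ) + 1 ≤ j := by exact_mod_cast hj
  have hjη : η * (J + 1) ≤ η * j := by gcongr
  rw [hω.apply_of_one_le (hJ.trans hjη), hω.apply_of_le_half, sub_zero, mul_zero]
  rw [div_le_iff₀ (by linarith)]
  linarith

lemma h_eq_zero_of_one_le (hω : IsWeight ω) {η z : ℝ} (hη : 1 ≤ η) (hz : 2 * |z| ≤ η) :
    h ω η z = 0 := by
  rw [h_eq_sum hω (J := 0) (by linarith) (by simpa using hη) (by simpa using hz)]
  simp

/-- The mean value `∫ ω(x) dx / x`. -/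
noncomputable def logMean (ω : ℝ → ℝ) : ℝ := ∫ x, ω x / x

lemma IsWeight.contDiff_div (hω : IsWeight ω) : ContDiff ℝ (⊤ : ℕ∞) fun x => ω x / x := by
  refine contDiff_iff_contDiffAt.2 fun x => ?_
  rcases eq_or_ne x 0 with rfl | hx
  · have h1 : (fun x => ω x / x) =ᶠ[nhds 0] fun _ => 0 := by
      filter_upwards [Iio_mem_nhds (show (0 : ℝ) < 1 / 2 by norm_num)] with y hy
      rw [hω.apply_of_le_half (le_of_lt hy), zero_div]
    exact contDiffAt_const.congr_of_eventuallyEq h1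
  · exact hω.smooth.contDiffAt.div contDiffAt_id hx

lemma IsWeight.eq_zero_of_one_lt_abs (hω : IsWeight ω) {x : ℝ} (hx : 1 < |x|) : ω x = 0 := by
  rcases lt_abs.1 hx with h | h
  · exact hω.apply_of_one_le h.le
  · exact hω.apply_of_le_half (by linarith)

lemma IsWeight.continuous (hω : IsWeight ω) : Continuous ω := hω.smooth.continuous

lemma IsWeight.integrable (hω : IsWeight ω) : Integrable ω :=
  hω.continuous.integrable_of_hasCompactSupport
    (hasCompactSupport_of_abs fun _ hx => hω.eq_zero_of_one_lt_abs hx)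

lemma IsWeight.integrable_div (hω : IsWeight ω) : Integrable fun x => ω x / x :=
  hω.contDiff_div.continuous.integrable_of_hasCompactSupport
    (hasCompactSupport_of_abs fun x hx => by rw [hω.eq_zero_of_one_lt_abs hx, zero_div])

lemma sum_Icc_int_eq (f : ℤ → ℂ) (J : ℕ) :
    ∑ j ∈ Finset.Icc (-(J : ℤ)) J, f j = f 0 + ∑ j ∈ Finset.Icc 1 J, (f j + f (-j)) := by
  induction J with
  | zero => simp
  | succ J ih =>
    rw [Finset.sum_Icc_succ_top (by omega), ← add_assoc, ← ih]
    have h1 : Finset.Icc (-((J + 1 : ℕ) : ℤ)) ((J + 1 : ℕ) : ℤ) =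
        insert ((J + 1 : ℕ) : ℤ) (insert (-((J + 1 : ℕ) : ℤ)) (Finset.Icc (-(J : ℤ)) J)) := by
      ext x
      simp only [Finset.mem_insert, Finset.mem_Icc]
      omega
    rw [h1, Finset.sum_insert, Finset.sum_insert]
    · ring
    · simp
    · simp only [Finset.mem_insert, Finset.mem_Icc]
      omega

/-- A sum over `ℤ` with terms supported in `[-J, J]`. -/
lemma tsum_int_eq_sum (f : ℤ → ℂ) (J : ℕ) (hf : ∀ j : ℤ, (J : ℤ) < |j| → f j = 0) :
    ∑' j : ℤ, f j = f 0 + ∑ j ∈ Finset.Icc 1 J, (f j + f (-j)) := by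
  rw [← sum_Icc_int_eq, tsum_eq_sum]
  intro j hj
  refine hf j ?_
  rw [Finset.mem_Icc, ← abs_le] at hj
  exact not_le.1 hj

/-- Summing a smooth function supported on `(0, 1]` over the positive multiples of `η`. -/
lemma exists_sum_multiples_bound (N : ℕ) (hN : 1 ≤ N) {φ : ℝ → ℝ}
    (hφ : ContDiff ℝ (⊤ : ℕ∞) φ) (hφ0 : ∀ x ≤ 0, φ x = 0) (hφ1 : ∀ x, 1 ≤ x → φ x = 0) :
    ∃ C : ℝ, 0 ≤ C ∧ ∀ (η : ℝ) (J : ℕ), 0 < η → 1 ≤ η * (J + 1) →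
      |∑ j ∈ Finset.Icc 1 J, φ (η * j) - (∫ x, φ x) / η| ≤ C * η ^ N := by
  obtain ⟨C, hC0, hC⟩ := exists_poisson_bound N hN
  refine ⟨C * ∫ x, ‖iteratedDeriv (N + 1) (fun x => (φ x : ℂ)) x‖,
    mul_nonneg hC0 (integral_nonneg fun _ => norm_nonneg _), fun η J hη hJ => ?_⟩
  have hs : HasCompactSupport fun x => (φ x : ℂ) := hasCompactSupport_of_abs (R := 1) fun x hx => by
    rcases lt_abs.1 hx with h | h
    · simp [hφ1 x h.le]
    · simp [hφ0 x (by linarith)]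
  have h1 := hC (fun x => (φ x : ℂ)) η 0 0 (contDiff_ofReal hφ) hs hη (by simp)
  simp only [add_zero, zero_mul, e_zero, mul_one] at h1
  rw [tsum_int_eq_sum _ J] at h1
  · rw [integral_complex_ofReal] at h1
    simp only [Int.cast_zero, mul_zero, hφ0 0 le_rfl, Complex.ofReal_zero, zero_add,
      Int.cast_neg, Int.cast_natCast, mul_neg] at h1
    have h2 : ∀ j : ℕ, φ (-(η * j)) = 0 := fun j => hφ0 _ (by
      have : 0 ≤ η * j := by positivity
      linarith)
    simp only [h2, Complex.ofReal_zero, add_zero] at h1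
    rw [← Complex.ofReal_sum, ← Complex.ofReal_mul, ← Complex.ofReal_sub, Complex.norm_real,
      Real.norm_eq_abs] at h1
    rw [div_eq_inv_mul]
    refine h1.trans (le_of_eq ?_)
    ring
  · intro j hj
    rcases lt_abs.1 hj with h | h
    · rw [hφ1, Complex.ofReal_zero]
      have : (J : ℝ) + 1 ≤ j := by exact_mod_cast h
      exact hJ.trans (by gcongr)
    · rw [hφ0, Complex.ofReal_zero]
      have : (j : ℝ) ≤ 0 := by exact_mod_cast (by omega : j ≤ 0)
      exact mul_nonpos_of_nonneg_of_nonpos hη.le this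

/-- The substitution `z = ± λ ζ`. -/
lemma integral_weight_abs_scale (hω : IsWeight ω) {F : ℝ → ℂ} (hF : Continuous F) {lam : ℝ}
    (hlam : 0 < lam) :
    ((1 / lam : ℝ) : ℂ) * ∫ z, F z * (ω (|z| / lam) : ℂ) =
      ∫ ζ, (ω ζ : ℂ) * (F (lam * ζ) + F (-(lam * ζ))) := by
  have hωc := hω.continuous
  have h1 := Measure.integral_comp_mul_left (fun z => F z * (ω (|z| / lam) : ℂ)) lam
  rw [abs_of_pos (inv_pos.2 hlam), Complex.real_smul] at h1
  rw [one_div, ← h1]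
  have h2 : ∀ ζ : ℝ, F (lam * ζ) * (ω (|lam * ζ| / lam) : ℂ) =
      (ω ζ : ℂ) * F (lam * ζ) + (ω (-ζ) : ℂ) * F (lam * ζ) := by
    intro ζ
    rw [abs_mul, abs_of_pos hlam, mul_div_cancel_left₀ _ hlam.ne', hω.abs_eq]
    push_cast
    ring
  have hi : ∀ G : ℝ → ℂ, Continuous G → Integrable fun ζ => (ω ζ : ℂ) * G ζ := fun G hG =>
    (by fun_prop : Continuous _).integrable_of_hasCompactSupport (HasCompactSupport.mul_right
      (hasCompactSupport_of_abs (R := 1) fun x hx => by simp [hω.eq_zero_of_one_lt_abs hx]))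
  have i1 := hi (fun ζ => F (lam * ζ)) (by fun_prop)
  have i2 := hi (fun ζ => F (-(lam * ζ))) (by fun_prop)
  have i2' : Integrable fun ζ => (ω (-ζ) : ℂ) * F (lam * ζ) := by
    have := i2.comp_neg
    simpa using this
  simp_rw [h2]
  rw [integral_add i1 i2']
  simp_rw [mul_add]
  rw [integral_add i1 i2]
  congr 1
  rw [← integral_neg_eq_self]
  simp

/-- `h(η, ·)` is an approximate identity: integrated against a smooth function with a phase of
frequency at most `1 / (2 η)` it gives the value at the origin up to `O(η ^ N)`. -/
theorem exists_integral_mul_h_bound (hω : IsWeight ω) (N : ℕ) (hN : 1 ≤ N) :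
    ∃ C : ℝ, 0 ≤ C ∧ ∀ (φ : ℝ → ℂ) (B η θ : ℝ), ContDiff ℝ (⊤ : ℕ∞) φ →
      (∀ x, 1 < |x| → φ x = 0) → (∀ x, ‖φ x‖ ≤ B) → (∀ x, ‖iteratedDeriv (N + 1) φ x‖ ≤ B) →
        0 < η → η * |θ| ≤ 1 / 2 →
          ‖(∫ z, φ z * e (-(θ * z)) * (h ω η z : ℂ)) - φ 0‖ ≤ C * B * η ^ N := by
  obtain ⟨C₁, hC₁0, hC₁⟩ := exists_poisson_bound N hN
  obtain ⟨C₂, hC₂0, hC₂⟩ := exists_sum_multiples_bound N hN hω.contDiff_div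
    (fun x hx => by rw [hω.apply_of_le_half (by linarith), zero_div])
    (fun x hx => by rw [hω.apply_of_one_le hx, zero_div])
  refine ⟨2 * C₂ + 2 * C₁, by positivity, fun φ B η θ hφ hφs hφB hφd hη hθ => ?_⟩
  have hωc := hω.continuous
  have hφc := hφ.continuous
  have hB0 : 0 ≤ B := (norm_nonneg _).trans (hφB 0)
  have hφcs : HasCompactSupport φ := hasCompactSupport_of_abs hφs
  set F : ℝ → ℂ := fun x => φ x * e (-(θ * x)) with hF
  have hFc : Continuous F := by rw [hF]; fun_prop
  have hFs : ∀ x, 1 < |x| → F x = 0 := fun x hx => by simp only [hF, hφs x hx, zero_mul]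
  have hFcs : HasCompactSupport F := hasCompactSupport_of_abs hFs
  set I := ∫ z, F z with hI
  have hIb : ‖I‖ ≤ 2 * 1 * B := norm_integral_le_of_support zero_le_one
    (fun x _ => by rw [hF, norm_mul, norm_e, mul_one]; exact hφB x) hFs
  set J := ⌈2 / η⌉₊ with hJdef
  have hJ : 2 ≤ η * J := by
    have := Nat.le_ceil (2 / η)
    rwa [div_le_iff₀' hη] at this
  have hJ1 : η * J ≤ η * (J + 1) := by gcongr; linarith
  set S : ℝ := ∑ j ∈ Finset.Icc 1 J, ω (η * j) / (η * j) with hS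
  have hSb : |S - logMean ω / η| ≤ C₂ * η ^ N := hC₂ η J hη (by linarith)
  -- for `|z| ≤ 1` the series for `h` breaks off at `J`; its first part does not depend on `z`
  have hterm : ∀ z, F z * (h ω η z : ℂ) = (S : ℂ) * F z - ∑ j ∈ Finset.Icc 1 J,
      ((1 / (η * j) : ℝ) : ℂ) * (F z * (ω (|z| / (η * j)) : ℂ)) := by
    intro z
    rcases lt_or_ge 1 |z| with hz | hz
    · simp [hFs z hz]
    · rw [h_eq_sum hω hη (J := J) (by linarith) (by linarith), hS]
      push_cast
      rw [Finset.mul_sum, Finset.sum_mul, ← Finset.sum_sub_distrib]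
      exact Finset.sum_congr rfl fun j _ => by ring
  have hint : ∀ j : ℕ, Integrable fun z => ((1 / (η * j) : ℝ) : ℂ) *
      (F z * (ω (|z| / (η * j)) : ℂ)) := fun j =>
    ((by fun_prop : Continuous _).integrable_of_hasCompactSupport hFcs.mul_right).const_mul _
  have hFint : Integrable F := hFc.integrable_of_hasCompactSupport hFcs
  change ‖(∫ z, F z * (h ω η z : ℂ)) - φ 0‖ ≤ _
  simp_rw [hterm]
  rw [integral_sub (hFint.const_mul _) (integrable_finsetSum _ fun j _ => hint j),
    integral_const_mul, integral_finsetSum _ fun j _ => hint j]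
  simp_rw [integral_const_mul]
  have hscale : ∀ j ∈ Finset.Icc 1 J, ((1 / (η * j) : ℝ) : ℂ) *
      ∫ z, F z * (ω (|z| / (η * j)) : ℂ) =
      ∫ ζ, (ω ζ : ℂ) * (F (η * j * ζ) + F (-(η * j * ζ))) := by
    intro j hj
    have hj0 : (0 : ℝ) < j := by exact_mod_cast (Finset.mem_Icc.1 hj).1
    exact integral_weight_abs_scale hω hFc (by positivity)
  rw [Finset.sum_congr rfl hscale, ← integral_finsetSum]
  swap
  · exact fun j _ => (by fun_prop : Continuous _).integrable_of_hasCompactSupport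
      (HasCompactSupport.mul_right
      (hasCompactSupport_of_abs (R := 1) fun x hx => by simp [hω.eq_zero_of_one_lt_abs hx]))
  simp_rw [← Finset.mul_sum]
  set T : ℝ → ℂ := fun ζ => ∑ j ∈ Finset.Icc 1 J, (F (η * j * ζ) + F (-(η * j * ζ))) with hT
  have hTc : Continuous T := by rw [hT]; fun_prop
  -- Poisson summation for each `ζ` in the support of the weight
  have hPois : ∀ ζ, ‖(ω ζ : ℂ) * T ζ - ((ω ζ / ζ : ℝ) * (η⁻¹ * I) - (ω ζ : ℂ) * φ 0)‖ ≤
      ω ζ * (C₁ * η ^ N * (2 * 1 * B)) := by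
    intro ζ
    rcases le_or_gt ζ (1 / 2) with hζ | hζ
    · simp [hω.apply_of_le_half hζ]
    rcases le_or_gt 1 ζ with hζ1 | hζ1
    · simp [hω.apply_of_one_le hζ1]
    have hζ0 : 0 < ζ := by linarith
    have hp := hC₁ φ (η * ζ) 0 (-θ) hφ hφcs (by positivity) (by
      rw [abs_neg]
      nlinarith [mul_nonneg hη.le (abs_nonneg θ)])
    rw [tsum_int_eq_sum _ J] at hp
    · simp only [Int.cast_zero, mul_zero, add_zero, e_zero, mul_one, neg_mul, Int.cast_natCast,
        Int.cast_neg, mul_neg, neg_neg] at hp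
      have h1 : φ 0 + ∑ j ∈ Finset.Icc 1 J, (φ (η * ζ * j) * e (-(θ * (η * ζ * j))) +
          φ (-(η * ζ * j)) * e (θ * (η * ζ * j))) = φ 0 + T ζ := by
        rw [hT]
        congr 1
        refine Finset.sum_congr rfl fun j _ => ?_
        simp only [hF]
        rw [show η * j * ζ = η * ζ * j by ring]
        simp
      rw [h1, ← hI] at hp
      have h2 : (ω ζ : ℂ) * T ζ - ((ω ζ / ζ : ℝ) * (η⁻¹ * I) - (ω ζ : ℂ) * φ 0) =
          (ω ζ : ℂ) * (φ 0 + T ζ - ((η * ζ)⁻¹ : ℝ) * I) := by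
        push_cast
        rw [mul_inv]
        ring
      rw [h2, norm_mul, Complex.norm_real, Real.norm_eq_abs, abs_of_nonneg (hω.nonneg ζ)]
      refine mul_le_mul_of_nonneg_left (hp.trans ?_) (hω.nonneg ζ)
      gcongr
      · nlinarith
      · exact integral_norm_iteratedDeriv_le zero_le_one _ hφs hφd
    · intro j hj
      rw [add_zero, hφs, zero_mul]
      have hj' : (J : ℝ) + 1 ≤ |(j : ℝ)| := by exact_mod_cast hj
      rw [abs_mul, abs_of_pos (by positivity : 0 < η * ζ)]
      have : 2 < η * |(j : ℝ)| := by nlinarith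
      nlinarith
  have hI1 : Integrable fun ζ => (ω ζ : ℂ) * T ζ :=
    (by fun_prop : Continuous _).integrable_of_hasCompactSupport
      (HasCompactSupport.mul_right
      (hasCompactSupport_of_abs (R := 1) fun x hx => by simp [hω.eq_zero_of_one_lt_abs hx]))
  have hI2 : Integrable fun ζ => ((ω ζ / ζ : ℝ) : ℂ) * (η⁻¹ * I) :=
    hω.integrable_div.ofReal.mul_const _
  have hI3 : Integrable fun ζ => (ω ζ : ℂ) * φ 0 := hω.integrable.ofReal.mul_const _
  have hmain : ‖(∫ ζ, (ω ζ : ℂ) * T ζ) - ((logMean ω : ℂ) * (η⁻¹ * I) - φ 0)‖ ≤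
      C₁ * η ^ N * (2 * 1 * B) := by
    have h1 : (logMean ω : ℂ) * (η⁻¹ * I) - φ 0 =
        ∫ ζ, ((ω ζ / ζ : ℝ) * (η⁻¹ * I) - (ω ζ : ℂ) * φ 0) := by
      rw [integral_sub hI2 hI3, integral_mul_const, integral_mul_const, integral_complex_ofReal,
        integral_complex_ofReal, hω.integral_eq_one, logMean]
      simp
    have hI23 : Integrable fun ζ => ((ω ζ / ζ : ℝ) : ℂ) * (η⁻¹ * I) - (ω ζ : ℂ) * φ 0 :=
      hI2.sub hI3
    rw [h1, ← integral_sub hI1 hI23]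
    refine (norm_integral_le_of_norm_le (hω.integrable.mul_const _)
      (Filter.Eventually.of_forall hPois)).trans (le_of_eq ?_)
    rw [integral_mul_const, hω.integral_eq_one, one_mul]
  -- the terms `(logMean ω / η) I` from the two parts of `h` cancel
  have hfin : (S : ℂ) * I - (∫ ζ, (ω ζ : ℂ) * T ζ) - φ 0 =
      ((S - logMean ω / η : ℝ) : ℂ) * I -
        ((∫ ζ, (ω ζ : ℂ) * T ζ) - ((logMean ω : ℂ) * (η⁻¹ * I) - φ 0)) := by
    push_cast
    ring
  rw [hfin]
  refine (norm_sub_le _ _).trans ?_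
  rw [norm_mul, Complex.norm_real, Real.norm_eq_abs]
  calc _ ≤ C₂ * η ^ N * (2 * 1 * B) + C₁ * η ^ N * (2 * 1 * B) := by gcongr
    _ = _ := by ring

end KernelH

/-! ### Rotations of the plane -/

lemma perp_apply_zero (v : Plane) : perp v 0 = v 1 := by simp [perp]

lemma perp_apply_one (v : Plane) : perp v 1 = -v 0 := by simp [perp]

lemma norm_sq_plane (v : Plane) : ‖v‖ ^ 2 = v 0 ^ 2 + v 1 ^ 2 := by
  rw [EuclideanSpace.norm_sq_eq]
  simp

@[simp] lemma norm_perp (v : Plane) : ‖perp v‖ = ‖v‖ := by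
  rw [← sq_eq_sq₀ (norm_nonneg _) (norm_nonneg _), norm_sq_plane, norm_sq_plane, perp_apply_zero,
    perp_apply_one]
  ring

lemma norm_smul_sub_smul_perp_sq (u : Plane) (a b : ℝ) :
    ‖a • u - b • perp u‖ ^ 2 = (a ^ 2 + b ^ 2) * ‖u‖ ^ 2 := by
  simp only [norm_sq_plane, PiLp.sub_apply, PiLp.smul_apply, perp_apply_zero, perp_apply_one,
    smul_eq_mul]
  ring

/-- The rotation that takes `(1, 0)` to the unit vector `u`. -/
noncomputable def rotation (u : Plane) (hu : ‖u‖ = 1) : Plane ≃ₗᵢ[ℝ] Plane :=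
  LinearIsometry.toLinearIsometryEquiv
    { toFun := fun v => v 0 • u - v 1 • perp u
      map_add' := fun v w => by simp only [PiLp.add_apply]; module
      map_smul' := fun c v => by simp only [PiLp.smul_apply, smul_eq_mul, RingHom.id_apply]; module
      norm_map' := fun v => by
        change ‖v 0 • u - v 1 • perp u‖ = ‖v‖
        rw [← sq_eq_sq₀ (norm_nonneg _) (norm_nonneg _), norm_smul_sub_smul_perp_sq, hu,
          norm_sq_plane]
        ring } rfl

lemma rotation_apply (u : Plane) (hu : ‖u‖ = 1) (v : Plane) :
    rotation u hu v = v 0 • u - v 1 • perp u := rfl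

/-- Integration over the plane in the coordinates `(z, t)` with `y = z ρ / |ρ|² - t ρ^⊥`. -/
lemma integral_plane_coords {F : Plane → ℂ} (hF : Integrable F) {ρ : Plane} (hρ : ρ ≠ 0) :
    ∫ y, F y = ∫ t : ℝ, ∫ z : ℝ, F ((z / ‖ρ‖ ^ 2) • ρ - t • perp ρ) := by
  have hn : 0 < ‖ρ‖ := norm_pos_iff.2 hρ
  set u : Plane := ‖ρ‖⁻¹ • ρ with hu
  have hu1 : ‖u‖ = 1 := by
    rw [hu, norm_smul, norm_inv, norm_norm, inv_mul_cancel₀ hn.ne']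
  set R := rotation u hu1
  have hmp := R.measurePreserving
  have hemb : MeasurableEmbedding R := R.toHomeomorph.measurableEmbedding
  rw [← hmp.integral_comp hemb, integral_plane_symm (F := fun y => F (R y))
    ((hmp.integrable_comp_emb hemb).2 hF)]
  have h1 : ∀ a b : ℝ, R !₂[a, b] = (a / ‖ρ‖) • ρ - (b / ‖ρ‖) • perp ρ := by
    intro a b
    rw [rotation_apply]
    ext i
    fin_cases i <;> simp [perp, hu] <;> field_simp
  simp_rw [h1]
  set H : ℝ → ℂ := fun b => ∫ a, F ((a / ‖ρ‖) • ρ - (b / ‖ρ‖) • perp ρ) with hH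
  have h2 := Measure.integral_comp_mul_left H ‖ρ‖
  rw [abs_of_pos (inv_pos.2 hn), Complex.real_smul] at h2
  have h3 : ∀ t, H (‖ρ‖ * t) = ((‖ρ‖⁻¹ : ℝ) : ℂ) *
      ∫ z : ℝ, F ((z / ‖ρ‖ ^ 2) • ρ - t • perp ρ) := by
    intro t
    have h4 := Measure.integral_comp_mul_left
      (fun a => F ((a / ‖ρ‖) • ρ - t • perp ρ)) (‖ρ‖⁻¹)
    rw [inv_inv, abs_of_pos hn, Complex.real_smul] at h4
    have h5 : ∀ z : ℝ, ‖ρ‖⁻¹ * z / ‖ρ‖ = z / ‖ρ‖ ^ 2 := fun z => by field_simp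
    simp_rw [h5] at h4
    rw [h4, ← mul_assoc, ← Complex.ofReal_mul, inv_mul_cancel₀ hn.ne', hH]
    simp only
    rw [mul_div_cancel_left₀ _ hn.ne']
    simp
  simp_rw [h3, integral_const_mul] at h2
  have : ((‖ρ‖⁻¹ : ℝ) : ℂ) ≠ 0 := by
    rw [Ne, Complex.ofReal_eq_zero]
    positivity
  exact (mul_left_cancel₀ this h2).symm

/-! ### The kernel `p₂` -/

section KernelTwo

variable {ω ω₀ : ℝ → ℝ}

/-- The rescaled kernel `ω₀(|y|) h(η, ρ · y)`. -/
noncomputable def kernel (ω₀ ω : ℝ → ℝ) (η : ℝ) (ρ : Plane) (y : Plane) : ℂ :=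
  cutoffPlane ω₀ y * (h ω η (inner ℝ ρ y) : ℂ)

/-- On the support of the cut-off the series for `h` is finite. -/
lemma kernel_eq_sum (hω : IsWeight ω) (hω₀ : IsCutoff ω₀) {η : ℝ} {ρ : Plane} {J : ℕ} (hη : 0 < η)
    (hJ : 1 ≤ η * (J + 1)) (hρ : ‖ρ‖ ≤ η * (J + 1)) (y : Plane) :
    kernel ω₀ ω η ρ y = ((∑ j ∈ Finset.Icc 1 J, ω (η * j) / (η * j) : ℝ) : ℂ) * cutoffPlane ω₀ y -
      ∑ j ∈ Finset.Icc 1 J, ((1 / (η * j) : ℝ) : ℂ) *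
        (cutoffPlane ω₀ y * (ω (|inner ℝ ρ y| / (η * j)) : ℂ)) := by
  rcases le_or_gt (1 / 2) ‖y‖ with hy | hy
  · simp [kernel, hω₀.cutoffPlane_eq_zero hy]
  · have hz : 2 * |inner ℝ ρ y| ≤ η * (J + 1) := by
      have := abs_real_inner_le_norm ρ y
      have h0 := norm_nonneg ρ
      nlinarith
    rw [kernel, h_eq_sum hω hη hJ hz]
    push_cast
    rw [Finset.mul_sum, Finset.sum_mul, ← Finset.sum_sub_distrib]
    exact Finset.sum_congr rfl fun j _ => by ring

lemma contDiff_kernel_term (hω : IsWeight ω) (hω₀ : IsCutoff ω₀) (ρ : Plane) {lam : ℝ}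
    (hlam : 0 < lam) :
    ContDiff ℝ (⊤ : ℕ∞) fun y => cutoffPlane ω₀ y * (ω (|inner ℝ ρ y| / lam) : ℂ) := by
  refine hω₀.contDiff_cutoffPlane.mul (contDiff_ofReal ?_)
  have h1 : (fun y => ω (|inner ℝ ρ y| / lam)) = (fun x => ω |x|) ∘ fun y => inner ℝ ρ y / lam := by
    ext y
    simp [abs_div, abs_of_pos hlam]
  rw [h1]
  exact hω.contDiff_abs.comp ((contDiff_const.inner ℝ contDiff_id).div_const _)

lemma contDiff_kernel (hω : IsWeight ω) (hω₀ : IsCutoff ω₀) {η : ℝ} (hη : 0 < η) (ρ : Plane) :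
    ContDiff ℝ (⊤ : ℕ∞) (kernel ω₀ ω η ρ) := by
  set J := ⌈(1 + ‖ρ‖) / η⌉₊ with hJ
  have hJ1 : 1 + ‖ρ‖ ≤ η * (J + 1) := by
    have h1 := Nat.le_ceil ((1 + ‖ρ‖) / η)
    rw [div_le_iff₀' hη] at h1
    exact h1.trans (by gcongr; linarith)
  have h0 := norm_nonneg ρ
  rw [show kernel ω₀ ω η ρ = _ from
    funext (kernel_eq_sum hω hω₀ hη (J := J) (by linarith) (by linarith))]
  refine (contDiff_const.mul hω₀.contDiff_cutoffPlane).sub (ContDiff.sum fun j hj => ?_)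
  have hj0 : (0 : ℝ) < j := by exact_mod_cast (Finset.mem_Icc.1 hj).1
  exact contDiff_const.mul (contDiff_kernel_term hω hω₀ ρ (by positivity))

lemma hasCompactSupport_kernel (hω₀ : IsCutoff ω₀) (η : ℝ) (ρ : Plane) :
    HasCompactSupport (kernel ω₀ ω η ρ) := hω₀.hasCompactSupport_cutoffPlane.mul_right

/-- The substitution `x = Q^{3/2} y`, with `η = k q / Q` and `ρ = Q^{-1/2} r`. -/
lemma p2_eq_ft_kernel (ω₀ ω : ℝ → ℝ) {Q : ℝ} (hQ : 1 ≤ Q) (r : Fin 2 → ℤ) (k q : ℕ) (w : Plane) :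
    p2 ω₀ ω Q r k q w = (normConst ω : ℂ) *
      ft (kernel ω₀ ω (k * q / Q) ((Q ^ (1 / 2 : ℝ))⁻¹ • toPlane r)) (Q ^ (3 / 2 : ℝ) • w) := by
  obtain ⟨hX1, hXX, hX3⟩ := sqrt_pow_facts hQ
  set X := Q ^ (1 / 2 : ℝ) with hX
  have hX0 : 0 < X := by linarith
  have hQ0 : 0 < Q := by linarith
  have hs : 0 < Q ^ (3 / 2 : ℝ) := by positivity
  rw [p2, integral_comp_smul_plane _ hs, ← mul_assoc, ← Complex.ofReal_mul]
  have h1 : normConst ω / Q ^ 3 * (Q ^ (3 / 2 : ℝ)) ^ 2 = normConst ω := by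
    rw [hX3, mul_pow, sq X, hXX]
    field_simp
  rw [h1, ft]
  congr 1
  refine integral_congr_ae (Filter.Eventually.of_forall fun y => ?_)
  simp only [kernel, cutoffPlane]
  rw [norm_smul, Real.norm_eq_abs, abs_of_pos hs, mul_div_cancel_left₀ _ hs.ne', inner_smul_right,
    inner_smul_right, inner_smul_left, inner_smul_left, hX3]
  have h2 : Q * X * inner ℝ (toPlane r) y / Q ^ 2 = X⁻¹ * inner ℝ (toPlane r) y := by
    field_simp
    rw [sq, hXX]
  rw [h2]
  simp

lemma kernel_eq_zero_of_one_le (hω : IsWeight ω) (hω₀ : IsCutoff ω₀) {η : ℝ} {ρ : Plane}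
    (hη : 1 ≤ η) (hρ : ‖ρ‖ ≤ 1) (y : Plane) : kernel ω₀ ω η ρ y = 0 := by
  rcases le_or_gt (1 / 2) ‖y‖ with hy | hy
  · simp [kernel, hω₀.cutoffPlane_eq_zero hy]
  · rw [kernel, h_eq_zero_of_one_le hω hη, Complex.ofReal_zero, mul_zero]
    have := abs_real_inner_le_norm ρ y
    have h0 := norm_nonneg ρ
    nlinarith

/-- For `η` small against `1 / |v|` the transform of the kernel is close to the integral of
`ω₀(|y|) e(-v · y)` over the line `ρ · y = 0`. -/
theorem exists_ft_kernel_approx (hω : IsWeight ω) (hω₀ : IsCutoff ω₀) (N : ℕ) (hN : 1 ≤ N) :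
    ∃ C : ℝ, 0 ≤ C ∧ ∀ (η : ℝ) (ρ v : Plane), 0 < η → 1 / 2 ≤ ‖ρ‖ → ‖ρ‖ ≤ 1 → η * ‖v‖ ≤ 1 / 4 →
      ‖ft (kernel ω₀ ω η ρ) v - ∫ t : ℝ, (ω₀ (t * ‖ρ‖) : ℂ) * e (t * inner ℝ v (perp ρ))‖ ≤
        C * η ^ N := by
  obtain ⟨C, hC0, hC⟩ := exists_integral_mul_h_bound hω N hN
  obtain ⟨B, hB0, hB⟩ := exists_iteratedFDeriv_bound hω₀.contDiff_cutoffPlane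
    hω₀.hasCompactSupport_cutoffPlane (N + 1)
  refine ⟨2 * 1 * (C * (2 ^ (N + 1) * B)), by positivity, fun η ρ v hη hρ hρ1 hv => ?_⟩
  have hn : 0 < ‖ρ‖ := by linarith
  have hρ0 : ρ ≠ 0 := norm_pos_iff.1 hn
  have hint : Integrable fun y => kernel ω₀ ω η ρ y * e (-inner ℝ v y) := by
    have := (contDiff_kernel hω hω₀ hη ρ).continuous
    exact (by fun_prop : Continuous _).integrable_of_hasCompactSupport
      (hasCompactSupport_kernel hω₀ η ρ).mul_right
  -- the section of the cut-off along a line in the direction `ρ`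
  set φ : ℝ → ℝ → ℂ := fun t z => cutoffPlane ω₀ (!₂[0, t * ‖ρ‖] + z • !₂[‖ρ‖⁻¹, 0]) with hφ
  have hvec : ∀ t z : ℝ, (!₂[0, t * ‖ρ‖] + z • !₂[‖ρ‖⁻¹, 0] : Plane) = !₂[z * ‖ρ‖⁻¹, t * ‖ρ‖] := by
    intro t z
    ext i
    fin_cases i <;> simp
  have hφn : ∀ t z : ℝ, cutoffPlane ω₀ ((z / ‖ρ‖ ^ 2) • ρ - t • perp ρ) = φ t z := by
    intro t z
    simp only [hφ, hvec, cutoffPlane]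
    congr 2
    rw [← sq_eq_sq₀ (norm_nonneg _) (norm_nonneg _), norm_smul_sub_smul_perp_sq, norm_plane_sq]
    field_simp
  have hφ1 : ∀ t z : ℝ, 1 < |z| → φ t z = 0 := by
    intro t z hz
    simp only [hφ, hvec]
    refine hω₀.cutoffPlane_eq_zero ?_
    refine le_trans ?_ (abs_apply_le_norm _ 0)
    simp only [Matrix.cons_val_zero]
    rw [abs_mul, abs_of_pos (inv_pos.2 hn)]
    have : 1 ≤ ‖ρ‖⁻¹ := (one_le_inv₀ hn).2 hρ1
    nlinarith
  have hφt : ∀ t z : ℝ, 1 < |t| → φ t z = 0 := by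
    intro t z ht
    simp only [hφ, hvec]
    refine hω₀.cutoffPlane_eq_zero ?_
    refine le_trans ?_ (abs_apply_le_norm _ 1)
    simp only [Matrix.cons_val_one, Matrix.cons_val_fin_one]
    rw [abs_mul, abs_of_pos hn]
    nlinarith
  have hφ0 : ∀ t : ℝ, φ t 0 = (ω₀ (t * ‖ρ‖) : ℂ) := by
    intro t
    simp only [hφ, hvec, cutoffPlane]
    have : ‖(!₂[0 * ‖ρ‖⁻¹, t * ‖ρ‖] : Plane)‖ = |t * ‖ρ‖| := by
      rw [← sq_eq_sq₀ (norm_nonneg _) (abs_nonneg _), norm_plane_sq, sq_abs]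
      ring
    rw [this, hω₀.apply_abs]
  have hdir : ‖(!₂[‖ρ‖⁻¹, 0] : Plane)‖ ≤ 2 := by
    have h1 : ‖(!₂[‖ρ‖⁻¹, 0] : Plane)‖ = ‖ρ‖⁻¹ := by
      rw [← sq_eq_sq₀ (norm_nonneg _) (by positivity), norm_plane_sq]
      ring
    rw [h1]
    exact inv_le_of_inv_le₀ (by norm_num) (by linarith)
  set θ := inner ℝ v ρ / ‖ρ‖ ^ 2 with hθ
  have hθb : η * |θ| ≤ 1 / 2 := by
    have h1 : |θ| ≤ 2 * ‖v‖ := by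
      rw [hθ, abs_div, abs_of_pos (by positivity : 0 < ‖ρ‖ ^ 2), div_le_iff₀ (by positivity)]
      have h2 := abs_real_inner_le_norm v ρ
      have h3 := norm_nonneg v
      have : ‖v‖ * ‖ρ‖ ≤ 2 * ‖v‖ * ‖ρ‖ ^ 2 := by
        have : 1 * (‖v‖ * ‖ρ‖) ≤ (2 * ‖ρ‖) * (‖v‖ * ‖ρ‖) := by gcongr; linarith
        linarith
      linarith
    nlinarith
  -- in the coordinates `y = z ρ / |ρ|² - t ρ^⊥` the factor `h` only depends on `z = ρ · y`
  have hslice : ft (kernel ω₀ ω η ρ) v = ∫ t : ℝ, e (t * inner ℝ v (perp ρ)) *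
      ∫ z, φ t z * e (-(θ * z)) * (h ω η z : ℂ) := by
    rw [ft, integral_plane_coords hint hρ0]
    refine integral_congr_ae (Filter.Eventually.of_forall fun t => ?_)
    simp only
    rw [← integral_const_mul]
    refine integral_congr_ae (Filter.Eventually.of_forall fun z => ?_)
    simp only [kernel]
    have h1 : inner ℝ ρ ((z / ‖ρ‖ ^ 2) • ρ - t • perp ρ) = z := by
      rw [inner_sub_right, inner_smul_right, inner_smul_right, real_inner_self_eq_norm_sq,
        inner_plane ρ (perp ρ), perp_apply_zero, perp_apply_one]
      field_simp
      ring
    rw [hφn, h1, inner_sub_right, inner_smul_right, inner_smul_right,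
      show -(z / ‖ρ‖ ^ 2 * inner ℝ v ρ - t * inner ℝ v (perp ρ)) =
        t * inner ℝ v (perp ρ) + -(θ * z) by rw [hθ]; ring, e_add]
    ring
  have hinner : ∀ t, ‖(∫ z, φ t z * e (-(θ * z)) * (h ω η z : ℂ)) - φ t 0‖ ≤
      C * (2 ^ (N + 1) * B) * η ^ N := by
    intro t
    have hcd : ContDiff ℝ (⊤ : ℕ∞) (φ t) :=
      hω₀.contDiff_cutoffPlane.comp (contDiff_const.add (contDiff_id.smul contDiff_const))
    refine hC (φ t) (2 ^ (N + 1) * B) η θ hcd (hφ1 t) (fun z => ?_) (fun z => ?_) hη hθb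
    · have h1 := hB 0 (Nat.zero_le _) (!₂[0, t * ‖ρ‖] + z • !₂[‖ρ‖⁻¹, 0])
      rw [norm_iteratedFDeriv_zero] at h1
      refine h1.trans (le_mul_of_one_le_left hB0 (one_le_pow₀ (by norm_num)))
    · refine (norm_iteratedDeriv_comp_line_le hω₀.contDiff_cutoffPlane _ _ _ _).trans ?_
      gcongr
      exact hB _ le_rfl _
  have hI1 : Integrable fun t : ℝ => e (t * inner ℝ v (perp ρ)) *
      ∫ z, φ t z * e (-(θ * z)) * (h ω η z : ℂ) := by
    have hcont : Continuous fun p : ℝ × ℝ => e (p.1 * inner ℝ v (perp ρ)) *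
        (φ p.1 p.2 * e (-(θ * p.2)) * (h ω η p.2 : ℂ)) := by
      have hk := (contDiff_kernel hω hω₀ hη ρ).continuous
      have h2 : Continuous fun p : ℝ × ℝ =>
          kernel ω₀ ω η ρ ((p.2 / ‖ρ‖ ^ 2) • ρ - p.1 • perp ρ) := by fun_prop
      have h3 : ∀ p : ℝ × ℝ, kernel ω₀ ω η ρ ((p.2 / ‖ρ‖ ^ 2) • ρ - p.1 • perp ρ) =
          φ p.1 p.2 * (h ω η p.2 : ℂ) := by
        intro p
        have h1 : inner ℝ ρ ((p.2 / ‖ρ‖ ^ 2) • ρ - p.1 • perp ρ) = p.2 := by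
          rw [inner_sub_right, inner_smul_right, inner_smul_right, real_inner_self_eq_norm_sq,
            inner_plane ρ (perp ρ), perp_apply_zero, perp_apply_one]
          field_simp
          ring
        rw [kernel, hφn, h1]
      simp_rw [h3] at h2
      have h4 : (fun p : ℝ × ℝ => e (p.1 * inner ℝ v (perp ρ)) *
        (φ p.1 p.2 * e (-(θ * p.2)) * (h ω η p.2 : ℂ))) = fun p =>
          e (p.1 * inner ℝ v (perp ρ)) * (e (-(θ * p.2)) * (φ p.1 p.2 * (h ω η p.2 : ℂ))) := by
        ext p
        ring
      rw [h4]
      fun_prop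
    have hcs : HasCompactSupport fun p : ℝ × ℝ => e (p.1 * inner ℝ v (perp ρ)) *
        (φ p.1 p.2 * e (-(θ * p.2)) * (h ω η p.2 : ℂ)) := by
      refine HasCompactSupport.intro ((isCompact_Icc (a := (-1 : ℝ)) (b := 1)).prod
        (isCompact_Icc (a := (-1 : ℝ)) (b := 1))) fun p hp => ?_
      rw [Set.mem_prod, not_and_or, Set.mem_Icc, Set.mem_Icc, ← abs_le, ← abs_le, not_le,
        not_le] at hp
      rcases hp with hp | hp
      · rw [hφt _ _ hp]
        ring
      · rw [hφ1 _ _ hp]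
        ring
    have := (hcont.integrable_of_hasCompactSupport (μ := (volume : Measure ℝ).prod volume)
      hcs).integral_prod_left
    refine this.congr (Filter.Eventually.of_forall fun t => ?_)
    simp only
    rw [integral_const_mul]
  have hI2 : Integrable fun t : ℝ => (ω₀ (t * ‖ρ‖) : ℂ) * e (t * inner ℝ v (perp ρ)) := by
    have := hω₀.smooth.continuous
    refine (by fun_prop : Continuous _).integrable_of_hasCompactSupport
      (HasCompactSupport.mul_right (hasCompactSupport_of_abs (R := 1) fun t ht => ?_))
    rw [← hφ0, hφt t 0 ht]
  rw [hslice, ← integral_sub hI1 hI2]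
  refine (norm_integral_le_of_support (B := C * (2 ^ (N + 1) * B) * η ^ N) zero_le_one
    (fun t _ => ?_) fun t ht => ?_).trans (le_of_eq (by ring))
  · rw [mul_comm (ω₀ (t * ‖ρ‖) : ℂ), ← mul_sub, norm_mul, norm_e, one_mul, ← hφ0]
    exact hinner t
  · rw [← hφ0, hφt t 0 ht]
    simp [hφt t _ ht]

end KernelTwo

/-! ### The decay of `p₂` -/

section KernelTwoDecay

variable {ω ω₀ : ℝ → ℝ}

lemma inv_one_add_sq_comp_le (a : ℝ) {b : ℝ} (hb : 0 < b) :
    Integrable (fun s : ℝ => (1 + (a - s * b) ^ 2)⁻¹) ∧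
      ∫ s : ℝ, (1 + (a - s * b) ^ 2)⁻¹ = Real.pi / b := by
  set g : ℝ → ℝ := fun x => (1 + x ^ 2)⁻¹ with hg
  have h1 : ∀ s : ℝ, (1 + (a - s * b) ^ 2)⁻¹ = (fun x => g (a - x)) (b * s) := fun s => by
    simp [hg, mul_comm]
  constructor
  · simp_rw [h1]
    exact (integrable_comp_mul_left_iff (fun x => g (a - x)) hb.ne').2
      (integrable_inv_one_add_sq.comp_sub_left a)
  · simp_rw [h1]
    rw [Measure.integral_comp_mul_left (fun x => g (a - x)) b, integral_sub_left_eq_self g volume a,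
      hg, integral_univ_inv_one_add_sq, abs_of_pos (inv_pos.2 hb), smul_eq_mul]
    ring

/-- The decay of one term of the transform of the kernel. Fourier inversion in the variable
`ρ · y` writes it as `∫ ŵ(s) W(v - s ρ / λ) ds / λ` with `ŵ` and `W` rapidly decreasing. -/
lemma exists_ft_kernel_term_bound (hω : IsWeight ω) (hω₀ : IsCutoff ω₀) (M : ℕ) :
    ∃ C : ℝ, 0 ≤ C ∧ ∀ (lam : ℝ) (ρ v : Plane), 0 < lam → lam ≤ 1 → 1 / 2 ≤ ‖ρ‖ → ‖ρ‖ ≤ 1 →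
      (1 + ‖v‖ * lam + |inner ℝ v (perp ρ)|) ^ M * ‖((1 / lam : ℝ) : ℂ) *
        ft (fun y => cutoffPlane ω₀ y * (ω (|inner ℝ ρ y| / lam) : ℂ)) v‖ ≤ C := by
  set Ω : ℝ → ℂ := fun x => (ω |x| : ℂ) with hΩ
  have hΩs : ContDiff ℝ (⊤ : ℕ∞) Ω := contDiff_ofReal hω.contDiff_abs
  have hΩc : HasCompactSupport Ω := hasCompactSupport_of_abs (R := 1) fun x hx => by
    simp [hΩ, hω.apply_of_one_le hx.le]
  have hG := hω₀.contDiff_cutoffPlane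
  have hGc := hω₀.hasCompactSupport_cutoffPlane
  obtain ⟨C₁, hC₁0, hC₁⟩ := exists_ft_decay_of_hasCompactSupport hΩs hΩc M
  obtain ⟨C₂, hC₂0, hC₂⟩ := exists_ft_decay_of_hasCompactSupport hG hGc (M + 2)
  refine ⟨2 ^ M * (C₁ * C₂) * (2 * Real.pi), by positivity, fun lam ρ v hl hl1 hρ hρ1 => ?_⟩
  have hn : 0 < ‖ρ‖ := by linarith
  set V := 1 + ‖v‖ * lam + |inner ℝ v (perp ρ)| with hV
  have hV1 : 1 ≤ V := by
    have h1 : 0 ≤ ‖v‖ * lam := by positivity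
    have h2 := abs_nonneg (inner ℝ v (perp ρ))
    linarith
  -- insert Fourier inversion for `ω(|·|)` and exchange the integrals
  have hform : ft (fun y => cutoffPlane ω₀ y * (ω (|inner ℝ ρ y| / lam) : ℂ)) v =
      ∫ s : ℝ, ft Ω s * ft (cutoffPlane ω₀) (v - (s / lam) • ρ) := by
    have hinv : ∀ y, (ω (|inner ℝ ρ y| / lam) : ℂ) =
        ∫ s, ft Ω s * e (inner ℝ s (inner ℝ ρ y / lam)) := by
      intro y
      rw [integral_ft_mul_e hΩs hΩc]
      simp [hΩ, abs_div, abs_of_pos hl]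
    have hint : Integrable (fun p : Plane × ℝ => (cutoffPlane ω₀ p.1 * ft Ω p.2) *
        (e (p.2 * (inner ℝ ρ p.1 / lam)) * e (-inner ℝ v p.1)))
        ((volume : Measure Plane).prod (volume : Measure ℝ)) := by
      have h1 : Integrable (fun p : Plane × ℝ => cutoffPlane ω₀ p.1 * ft Ω p.2)
          ((volume : Measure Plane).prod (volume : Measure ℝ)) :=
        (hG.continuous.integrable_of_hasCompactSupport hGc).mul_prod (integrable_ft hΩs hΩc)
      refine h1.mul_bdd (c := 1) ?_ (Filter.Eventually.of_forall fun p => by simp)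
      exact (by fun_prop : Continuous _).aestronglyMeasurable
    rw [ft]
    calc _ = ∫ y, ∫ s, (cutoffPlane ω₀ y * ft Ω s) *
          (e (s * (inner ℝ ρ y / lam)) * e (-inner ℝ v y)) := by
          refine integral_congr_ae (Filter.Eventually.of_forall fun y => ?_)
          simp only
          rw [hinv, ← integral_const_mul, ← integral_mul_const]
          refine integral_congr_ae (Filter.Eventually.of_forall fun s => ?_)
          simp only [inner_eq_mul]
          ring
      _ = _ := by
          rw [integral_integral_swap hint]
          refine integral_congr_ae (Filter.Eventually.of_forall fun s => ?_)
          simp only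
          rw [show ft (cutoffPlane ω₀) (v - (s / lam) • ρ) = ∫ y, cutoffPlane ω₀ y *
            e (-inner ℝ (v - (s / lam) • ρ) y) from rfl, ← integral_const_mul]
          refine integral_congr_ae (Filter.Eventually.of_forall fun y => ?_)
          simp only
          rw [inner_sub_left, inner_smul_left, ← e_add]
          rw [show -(inner ℝ v y - (starRingEnd ℝ) (s / lam) * inner ℝ ρ y) =
            s * (inner ℝ ρ y / lam) + -inner ℝ v y by simp; ring]
          ring
  set a := inner ℝ v ρ / ‖ρ‖ with ha
  set b := ‖ρ‖ / lam with hb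
  have hb0 : 0 < b := by positivity
  obtain ⟨hgi, hgv⟩ := inv_one_add_sq_comp_le a hb0
  have hpt : ∀ s : ℝ, ‖ft Ω s * ft (cutoffPlane ω₀) (v - (s / lam) • ρ)‖ ≤
      2 ^ M * (C₁ * C₂) * (V ^ M)⁻¹ * (1 + (a - s * b) ^ 2)⁻¹ := by
    intro s
    set x := v - (s / lam) • ρ with hx
    have hx0 := norm_nonneg x
    have hs0 := abs_nonneg s
    have hv : v = x + (s / lam) • ρ := by rw [hx]; abel
    have h1 : ‖v‖ * lam ≤ ‖x‖ + |s| := by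
      have h2 : ‖v‖ ≤ ‖x‖ + |s| / lam * ‖ρ‖ := by
        calc ‖v‖ = ‖x + (s / lam) • ρ‖ := by rw [← hv]
          _ ≤ ‖x‖ + ‖(s / lam) • ρ‖ := norm_add_le _ _
          _ = _ := by rw [norm_smul, Real.norm_eq_abs, abs_div, abs_of_pos hl]
      have h3 : ‖v‖ * lam ≤ ‖x‖ * lam + |s| * ‖ρ‖ := by
        calc ‖v‖ * lam ≤ (‖x‖ + |s| / lam * ‖ρ‖) * lam := by gcongr
          _ = _ := by field_simp
      nlinarith
    have h2 : |inner ℝ v (perp ρ)| ≤ ‖x‖ := by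
      have h3 : inner ℝ v (perp ρ) = inner ℝ x (perp ρ) := by
        rw [hv, inner_add_left, inner_smul_left, inner_plane ρ (perp ρ), perp_apply_zero,
          perp_apply_one]
        ring_nf
      rw [h3]
      refine (abs_real_inner_le_norm _ _).trans ?_
      rw [norm_perp]
      nlinarith
    -- `v = x + (s / λ) ρ` is large only if `x` or `s` is, and `v · ρ^⊥ = x · ρ^⊥`
    have hVle : V ≤ 2 * ((1 + |s|) * (1 + ‖x‖)) := by nlinarith
    -- `a - s b` is the component of `x` along `ρ`; it makes the integral over `s` converge
    have hsq : 1 + (a - s * b) ^ 2 ≤ (1 + ‖x‖) ^ 2 := by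
      have h3 : |a - s * b| ≤ ‖x‖ := by
        have h4 : a - s * b = inner ℝ x ρ / ‖ρ‖ := by
          rw [hx, inner_sub_left, inner_smul_left, real_inner_self_eq_norm_sq, ha, hb]
          simp
          field_simp
        rw [h4, abs_div, abs_norm, div_le_iff₀ hn]
        exact abs_real_inner_le_norm _ _
      have h4 : (a - s * b) ^ 2 ≤ ‖x‖ ^ 2 := sq_le_sq' (by linarith [abs_le.1 h3])
        (abs_le.1 h3).2
      nlinarith
    have e1 : ‖ft Ω s‖ ≤ C₁ * ((1 + |s|) ^ M)⁻¹ := by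
      have := hC₁ s
      rw [Real.norm_eq_abs, mul_comm, ← le_div_iff₀ (by positivity)] at this
      rwa [← div_eq_mul_inv]
    have e2 : ‖ft (cutoffPlane ω₀) x‖ ≤ C₂ * (((1 + ‖x‖) ^ M)⁻¹ * ((1 + ‖x‖) ^ 2)⁻¹) := by
      have := hC₂ x
      rw [mul_comm, ← le_div_iff₀ (by positivity)] at this
      rwa [← mul_inv, ← pow_add, ← div_eq_mul_inv]
    rw [norm_mul]
    calc ‖ft Ω s‖ * ‖ft (cutoffPlane ω₀) x‖ ≤ (C₁ * ((1 + |s|) ^ M)⁻¹) *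
          (C₂ * (((1 + ‖x‖) ^ M)⁻¹ * ((1 + ‖x‖) ^ 2)⁻¹)) := by gcongr
      _ = 2 ^ M * (C₁ * C₂) * ((2 * ((1 + |s|) * (1 + ‖x‖))) ^ M)⁻¹ * ((1 + ‖x‖) ^ 2)⁻¹ := by
          rw [mul_pow, mul_pow]
          field_simp
      _ ≤ _ := by gcongr
  rw [hform, norm_mul, Complex.norm_real, Real.norm_eq_abs, abs_of_pos (by positivity)]
  have hmain := norm_integral_le_of_norm_le (hgi.const_mul (2 ^ M * (C₁ * C₂) * (V ^ M)⁻¹))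
    (Filter.Eventually.of_forall hpt)
  rw [integral_const_mul, hgv] at hmain
  calc V ^ M * (1 / lam * _) ≤ V ^ M * (1 / lam * (2 ^ M * (C₁ * C₂) * (V ^ M)⁻¹ *
        (Real.pi / b))) := by gcongr
    _ = 2 ^ M * (C₁ * C₂) * (Real.pi / ‖ρ‖) := by
        rw [hb]
        field_simp
    _ ≤ _ := by
        gcongr
        rw [div_le_iff₀ hn]
        nlinarith [Real.pi_pos]

/-- The transform of the cut-off on a line decays rapidly. -/
lemma integral_cutoff_line (hω₀ : IsCutoff ω₀) (M : ℕ) :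
    ∃ C : ℝ, 0 ≤ C ∧ ∀ (n x : ℝ), 1 / 2 ≤ n → n ≤ 1 →
      (1 + |x|) ^ M * ‖∫ t : ℝ, (ω₀ (t * n) : ℂ) * e (t * x)‖ ≤ C := by
  have hs : ContDiff ℝ (⊤ : ℕ∞) fun x => (ω₀ x : ℂ) := contDiff_ofReal hω₀.smooth
  have hc : HasCompactSupport fun x => (ω₀ x : ℂ) := hasCompactSupport_of_abs (R := 1 / 2)
    fun x hx => by simp [hω₀.apply_of_half_le hx.le]
  obtain ⟨C, hC0, hC⟩ := exists_ft_decay_of_hasCompactSupport hs hc M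
  refine ⟨2 * C, by positivity, fun n x hn hn1 => ?_⟩
  have hn0 : 0 < n := by linarith
  have h1 := Measure.integral_comp_mul_left
    (fun y => (ω₀ y : ℂ) * e (-inner ℝ (-(x / n)) y)) n
  have h2 : ∀ t : ℝ, (ω₀ (n * t) : ℂ) * e (-inner ℝ (-(x / n)) (n * t)) =
      (ω₀ (t * n) : ℂ) * e (t * x) := by
    intro t
    rw [inner_eq_mul, mul_comm n t]
    congr 2
    field_simp
  simp_rw [h2] at h1
  rw [h1, norm_smul, Real.norm_eq_abs, abs_abs, abs_of_pos (inv_pos.2 hn0)]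
  have h3 := hC (-(x / n))
  have h4 : |x| ≤ ‖-(x / n)‖ := by
    rw [norm_neg, Real.norm_eq_abs, abs_div, abs_of_pos hn0, le_div_iff₀ hn0]
    nlinarith [abs_nonneg x]
  have h5 : n⁻¹ ≤ 2 := inv_le_of_inv_le₀ (by norm_num) (by linarith)
  rw [ft] at h3
  calc _ = n⁻¹ * ((1 + |x|) ^ M * ‖∫ y, (ω₀ y : ℂ) * e (-inner ℝ (-(x / n)) y)‖) := by ring
    _ ≤ 2 * ((1 + ‖-(x / n)‖) ^ M * ‖∫ y, (ω₀ y : ℂ) * e (-inner ℝ (-(x / n)) y)‖) := by gcongr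
    _ ≤ 2 * C := by gcongr

/-- The decay of the transform of the kernel for `η |v| > 1 / 4`. Each term of the series for `h` is
bounded separately. The part `∑ ω(η j) / (η j)`, of size `1 / η < 4 |v|`, is absorbed by the decay
of the transform of the cut-off. -/
lemma exists_ft_kernel_bound_of_large (hω : IsWeight ω) (hω₀ : IsCutoff ω₀) (m : ℕ) :
    ∃ C : ℝ, 0 ≤ C ∧ ∀ (η : ℝ) (ρ v : Plane), 0 < η → η < 1 → 1 / 2 ≤ ‖ρ‖ → ‖ρ‖ ≤ 1 →
      1 / 4 < η * ‖v‖ →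
      (1 + ‖v‖ * η + |inner ℝ v (perp ρ)|) ^ m * ‖ft (kernel ω₀ ω η ρ) v‖ ≤ C := by
  obtain ⟨C₃, hC₃0, hC₃⟩ := exists_ft_kernel_term_bound hω hω₀ (m + 2)
  obtain ⟨C₄, hC₄0, hC₄⟩ := exists_ft_decay_of_hasCompactSupport hω₀.contDiff_cutoffPlane
    hω₀.hasCompactSupport_cutoffPlane (m + 1)
  obtain ⟨B, hB0, hB⟩ := hω.exists_bound
  refine ⟨2 ^ m * (8 * B * C₄) + 4 * C₃, by positivity, fun η ρ v hη hη1 hρ hρ1 hηv => ?_⟩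
  set y := |inner ℝ v (perp ρ)| with hy
  have hy0 : 0 ≤ y := abs_nonneg _
  have hv0 := norm_nonneg v
  have hyv : y ≤ ‖v‖ := by
    refine (abs_real_inner_le_norm _ _).trans ?_
    rw [norm_perp]
    nlinarith
  set V := 1 + ‖v‖ * η + y with hV
  have hV1 : 1 ≤ V := by
    have : 0 ≤ ‖v‖ * η := by positivity
    linarith
  have hvpos : 0 < ‖v‖ := by
    by_contra h
    have : ‖v‖ = 0 := le_antisymm (not_lt.1 h) hv0
    rw [this] at hηv
    norm_num at hηv
  set J := ⌊1 / η⌋₊ with hJ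
  have hJ1 : 1 ≤ η * (J + 1) := by
    have := (Nat.lt_floor_add_one (1 / η)).le
    rwa [div_le_iff₀' hη] at this
  have hJ2 : (J : ℝ) * η ≤ 1 := by
    have := Nat.floor_le (by positivity : 0 ≤ 1 / η)
    rwa [le_div_iff₀ hη] at this
  set S : ℝ := ∑ j ∈ Finset.Icc 1 J, ω (η * j) / (η * j) with hS
  have hS1 : |S| ≤ 8 * B * ‖v‖ := by
    have h1 : ∀ j ∈ Finset.Icc 1 J, |ω (η * j) / (η * j)| ≤ 2 * B := by
      intro j hj
      have hj0 : (0 : ℝ) < j := by exact_mod_cast (Finset.mem_Icc.1 hj).1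
      rcases le_or_gt (η * j) (1 / 2) with h | h
      · rw [hω.apply_of_le_half h]
        simp [hB0]
      · rw [abs_of_nonneg (div_nonneg (hω.nonneg _) (by linarith)), div_le_iff₀ (by linarith)]
        nlinarith [hB (η * j)]
    have h2 : |S| ≤ J * (2 * B) := by
      refine (Finset.abs_sum_le_sum_abs _ _).trans ((Finset.sum_le_card_nsmul _ _ _ h1).trans ?_)
      simp
    have h3 : (J : ℝ) ≤ 4 * ‖v‖ := by
      by_contra h
      nlinarith
    nlinarith
  set Tm : ℕ → ℂ := fun j => ((1 / (η * j) : ℝ) : ℂ) *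
      ft (fun y => cutoffPlane ω₀ y * (ω (|inner ℝ ρ y| / (η * j)) : ℂ)) v with hTm
  have hdecomp : ft (kernel ω₀ ω η ρ) v = (S : ℂ) * ft (cutoffPlane ω₀) v -
      ∑ j ∈ Finset.Icc 1 J, Tm j := by
    have hi0 : Integrable fun y => cutoffPlane ω₀ y * e (-inner ℝ v y) := by
      have := hω₀.contDiff_cutoffPlane.continuous
      exact (by fun_prop : Continuous _).integrable_of_hasCompactSupport
        hω₀.hasCompactSupport_cutoffPlane.mul_right
    have hij : ∀ j ∈ Finset.Icc 1 J, Integrable fun y =>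
        (cutoffPlane ω₀ y * (ω (|inner ℝ ρ y| / (η * j)) : ℂ)) * e (-inner ℝ v y) := by
      intro j hj
      have hj0 : (0 : ℝ) < j := by exact_mod_cast (Finset.mem_Icc.1 hj).1
      have := (contDiff_kernel_term hω hω₀ ρ (lam := η * j) (by positivity)).continuous
      refine Continuous.integrable_of_hasCompactSupport ?_
        hω₀.hasCompactSupport_cutoffPlane.mul_right.mul_right
      fun_prop
    have h1 : ∀ y, kernel ω₀ ω η ρ y * e (-inner ℝ v y) =
        (S : ℂ) * (cutoffPlane ω₀ y * e (-inner ℝ v y)) - ∑ j ∈ Finset.Icc 1 J,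
          ((1 / (η * j) : ℝ) : ℂ) *
          ((cutoffPlane ω₀ y * (ω (|inner ℝ ρ y| / (η * j)) : ℂ)) * e (-inner ℝ v y)) := by
      intro y
      rw [kernel_eq_sum hω hω₀ hη hJ1 (hρ1.trans hJ1), sub_mul, Finset.sum_mul, mul_assoc]
      congr 1
      exact Finset.sum_congr rfl fun j _ => by ring
    rw [ft]
    simp_rw [h1]
    rw [integral_sub (hi0.const_mul _) (integrable_finsetSum _ fun j hj => (hij j hj).const_mul _),
      integral_const_mul, integral_finsetSum _ fun j hj => (hij j hj).const_mul _]
    simp_rw [integral_const_mul]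
    rfl
  have hfirst : V ^ m * ‖(S : ℂ) * ft (cutoffPlane ω₀) v‖ ≤ 2 ^ m * (8 * B * C₄) := by
    have h1 := hC₄ v
    have h2 : V ≤ 2 * (1 + ‖v‖) := by nlinarith
    rw [norm_mul, Complex.norm_real, Real.norm_eq_abs]
    calc V ^ m * (|S| * ‖ft (cutoffPlane ω₀) v‖)
        ≤ (2 * (1 + ‖v‖)) ^ m * ((8 * B * (1 + ‖v‖)) * ‖ft (cutoffPlane ω₀) v‖) := by
          gcongr
          exact hS1.trans (by gcongr; linarith)
      _ = 2 ^ m * (8 * B * ((1 + ‖v‖) ^ (m + 1) * ‖ft (cutoffPlane ω₀) v‖)) := by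
          rw [mul_pow]
          ring
      _ ≤ _ := by gcongr
  have hsecond : V ^ m * ‖∑ j ∈ Finset.Icc 1 J, Tm j‖ ≤ 4 * C₃ := by
    have h1 : ∀ j ∈ Finset.Icc 1 J, ‖Tm j‖ ≤ C₃ * (V ^ m)⁻¹ *
        ((1 + j * (‖v‖ * η)) ^ 2)⁻¹ := by
      intro j hj
      have hj1 : (1 : ℝ) ≤ j := by exact_mod_cast (Finset.mem_Icc.1 hj).1
      have hjJ : (j : ℝ) ≤ J := by exact_mod_cast (Finset.mem_Icc.1 hj).2
      have hl : 0 < η * j := by positivity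
      have h2 := hC₃ (η * j) ρ v hl (by nlinarith) hρ hρ1
      have hvη : 0 ≤ ‖v‖ * η := by positivity
      set Vj := 1 + ‖v‖ * (η * j) + |inner ℝ v (perp ρ)| with hVj
      have hVj1 : V ≤ Vj := by
        rw [hV, hVj]
        nlinarith
      have hVj2 : 1 + j * (‖v‖ * η) ≤ Vj := by
        rw [hVj]
        nlinarith
      rw [mul_comm, ← le_div_iff₀ (by positivity)] at h2
      refine h2.trans ?_
      rw [div_eq_mul_inv, pow_add, mul_inv, mul_assoc]
      gcongr
    calc V ^ m * ‖∑ j ∈ Finset.Icc 1 J, Tm j‖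
        ≤ V ^ m * (C₃ * (V ^ m)⁻¹ * (‖v‖ * η)⁻¹) := by
          gcongr
          refine (norm_sum_le_of_le _ h1).trans ?_
          rw [← Finset.mul_sum]
          gcongr
          exact sum_inv_sq_le (by positivity) J
      _ = C₃ * (‖v‖ * η)⁻¹ := by field_simp
      _ ≤ C₃ * 4 := by
          gcongr
          refine inv_le_of_inv_le₀ (by norm_num) ?_
          linarith [mul_comm η ‖v‖]
      _ = _ := by ring
  rw [hdecomp]
  calc _ ≤ V ^ m * (‖(S : ℂ) * ft (cutoffPlane ω₀) v‖ + ‖∑ j ∈ Finset.Icc 1 J, Tm j‖) :=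
        mul_le_mul_of_nonneg_left (norm_sub_le _ _) (pow_nonneg (by linarith) _)
    _ ≤ 2 ^ m * (8 * B * C₄) + 4 * C₃ := by
        rw [mul_add]
        exact add_le_add hfirst hsecond

/-- The decay of the transform of the kernel. -/
theorem exists_ft_kernel_bound (hω : IsWeight ω) (hω₀ : IsCutoff ω₀) (m : ℕ) (hm : 1 ≤ m) :
    ∃ C : ℝ, 0 ≤ C ∧ ∀ (η : ℝ) (ρ v : Plane), 0 < η → 1 / 2 ≤ ‖ρ‖ → ‖ρ‖ ≤ 1 →
      (1 + ‖v‖ * η + |inner ℝ v (perp ρ)|) ^ m * ‖ft (kernel ω₀ ω η ρ) v‖ ≤ C := by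
  obtain ⟨C₁, hC₁0, hC₁⟩ := exists_ft_kernel_approx hω hω₀ m hm
  obtain ⟨C₂, hC₂0, hC₂⟩ := integral_cutoff_line hω₀ m
  obtain ⟨C₃, hC₃0, hC₃⟩ := exists_ft_kernel_bound_of_large hω hω₀ m
  set K := 2 ^ m * C₂ + 2 ^ m * C₁ + C₃ with hK
  refine ⟨K, by positivity, fun η ρ v hη hρ hρ1 => ?_⟩
  set y := |inner ℝ v (perp ρ)| with hy
  have hy0 : 0 ≤ y := abs_nonneg _
  have hv0 := norm_nonneg v
  have hyv : y ≤ ‖v‖ := by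
    refine (abs_real_inner_le_norm _ _).trans ?_
    rw [norm_perp]
    nlinarith
  set V := 1 + ‖v‖ * η + y with hV
  have hV1 : 1 ≤ V := by
    have : 0 ≤ ‖v‖ * η := by positivity
    linarith
  -- for `η ≥ 1` the kernel vanishes
  rcases le_or_gt 1 η with hη1 | hη1
  · have : ft (kernel ω₀ ω η ρ) v = 0 := by
      simp [ft, kernel_eq_zero_of_one_le hω hω₀ hη1 hρ1]
    rw [this, norm_zero, mul_zero]
    positivity
  -- for small `η |v|` compare with the line integral; the error `η ^ m` suffices as `V η ≤ 2`
  rcases le_or_gt (η * ‖v‖) (1 / 4) with hηv | hηv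
  · have h1 := hC₁ η ρ v hη hρ hρ1 hηv
    have h2 := hC₂ ‖ρ‖ (inner ℝ v (perp ρ)) hρ hρ1
    rw [← hy] at h2
    set L := ∫ t : ℝ, (ω₀ (t * ‖ρ‖) : ℂ) * e (t * inner ℝ v (perp ρ)) with hL
    have h3 : ‖ft (kernel ω₀ ω η ρ) v‖ ≤ ‖L‖ + C₁ * η ^ m := by
      have := norm_add_le (ft (kernel ω₀ ω η ρ) v - L) L
      rw [sub_add_cancel] at this
      linarith
    have h4 : V ≤ 2 * (1 + y) := by linarith [mul_comm η ‖v‖]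
    have h5 : V * η ≤ 2 := by nlinarith
    calc V ^ m * ‖ft (kernel ω₀ ω η ρ) v‖ ≤ V ^ m * (‖L‖ + C₁ * η ^ m) := by gcongr
      _ = V ^ m * ‖L‖ + C₁ * (V * η) ^ m := by rw [mul_pow]; ring
      _ ≤ (2 * (1 + y)) ^ m * ‖L‖ + C₁ * 2 ^ m := by gcongr
      _ = 2 ^ m * ((1 + y) ^ m * ‖L‖) + C₁ * 2 ^ m := by rw [mul_pow]; ring
      _ ≤ 2 ^ m * C₂ + C₁ * 2 ^ m := by gcongr
      _ ≤ K := by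
        rw [hK]
        linarith
  · refine (hC₃ η ρ v hη hη1 hρ hρ1 hηv).trans ?_
    have : 0 ≤ 2 ^ m * C₂ + 2 ^ m * C₁ := by positivity
    rw [hK]
    linarith

/-- The decay of `p₂`. -/
theorem exists_p2_bound (hω : IsWeight ω) (hω₀ : IsCutoff ω₀) (N : ℝ) :
    ∃ C : ℝ, 0 ≤ C ∧ ∀ Q : ℝ, 1 ≤ Q → ∀ (r : Fin 2 → ℤ) (k q : ℕ), 1 ≤ k → 1 ≤ q →
      Q ^ (1 / 2 : ℝ) / 2 ≤ ‖toPlane r‖ → ‖toPlane r‖ ≤ Q ^ (1 / 2 : ℝ) → ∀ w : Plane,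
        ‖p2 ω₀ ω Q r k q w‖ ≤ C * (1 + ‖w‖ * k * q * Q ^ (1 / 2 : ℝ) +
          |inner ℝ w (perp (toPlane r))| * Q) ^ (-N) := by
  set m := ⌈N⌉₊ + 1 with hm
  obtain ⟨C, hC0, hC⟩ := exists_ft_kernel_bound hω hω₀ m (by omega)
  refine ⟨|normConst ω| * C, by positivity, fun Q hQ r k q hk hq hr hr1 w => ?_⟩
  rw [p2_eq_ft_kernel ω₀ ω hQ, norm_mul, Complex.norm_real, Real.norm_eq_abs, mul_assoc |normConst ω|]
  obtain ⟨hX1, hXX, hX3⟩ := sqrt_pow_facts hQ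
  set X := Q ^ (1 / 2 : ℝ) with hX
  have hX0 : 0 < X := by linarith
  have hQ0 : 0 < Q := by linarith
  have hk' : (0 : ℝ) < k := by exact_mod_cast hk
  have hq' : (0 : ℝ) < q := by exact_mod_cast hq
  have hρ : ‖X⁻¹ • toPlane r‖ = ‖toPlane r‖ / X := by
    rw [norm_smul, norm_inv, Real.norm_eq_abs, abs_of_pos hX0, inv_mul_eq_div]
  have h1 := hC (k * q / Q) (X⁻¹ • toPlane r) (Q ^ (3 / 2 : ℝ) • w) (by positivity)
    (by rw [hρ, le_div_iff₀ hX0]; linarith) (by rw [hρ, div_le_one hX0]; exact hr1)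
  have hV : 1 + ‖Q ^ (3 / 2 : ℝ) • w‖ * (k * q / Q) +
      |inner ℝ (Q ^ (3 / 2 : ℝ) • w) (perp (X⁻¹ • toPlane r))| =
      1 + ‖w‖ * k * q * X + |inner ℝ w (perp (toPlane r))| * Q := by
    have hp : perp (X⁻¹ • toPlane r) = X⁻¹ • perp (toPlane r) := by
      ext i
      fin_cases i <;> simp [perp]
    rw [hp, norm_smul, inner_smul_left, inner_smul_right, Real.norm_eq_abs,
      abs_of_pos (by positivity), hX3]
    simp only [conj_trivial]
    rw [show Q * X * (X⁻¹ * inner ℝ w (perp (toPlane r))) = Q * inner ℝ w (perp (toPlane r)) by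
      field_simp, abs_mul, abs_of_pos hQ0]
    field_simp
  rw [hV] at h1
  set V := 1 + ‖w‖ * k * q * X + |inner ℝ w (perp (toPlane r))| * Q with hVdef
  have hV1 : 1 ≤ V := by
    have h2 : 0 ≤ ‖w‖ * k * q * X := by positivity
    have h3 : 0 ≤ |inner ℝ w (perp (toPlane r))| * Q := by positivity
    linarith
  refine mul_le_mul_of_nonneg_left ?_ (abs_nonneg _)
  rw [mul_comm, ← le_div_iff₀ (by positivity), div_eq_mul_inv] at h1
  refine h1.trans (mul_le_mul_of_nonneg_left (inv_pow_le_rpow_neg hV1 ?_) hC0)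
  rw [hm]
  push_cast
  linarith [Nat.le_ceil N]

end KernelTwoDecay

/-! ### Integrability and Fourier inversion for the kernels -/

section Inversion

variable {ω ω₀ : ℝ → ℝ}

/-- The scalar product of two integer vectors. -/
def intDot (a n : Fin 2 → ℤ) : ℤ := a 0 * n 0 + a 1 * n 1

lemma toPlane_apply (n : Fin 2 → ℤ) (i : Fin 2) : toPlane n i = n i := by
  fin_cases i <;> simp [toPlane]

lemma inner_toPlane (a n : Fin 2 → ℤ) : inner ℝ (toPlane a) (toPlane n) = (intDot a n : ℝ) := by
  rw [inner_plane, intDot]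
  simp [toPlane_apply]

lemma arcChar_eq (a : Fin 2 → ℤ) (q : ℕ) (w : Plane) (n : Fin 2 → ℤ) :
    arcChar a q w n = e (intDot a n / q) * e (inner ℝ w (toPlane n)) := by
  rw [arcChar, inner_add_left, inner_smul_left, inner_toPlane, e_add]
  simp [div_eq_inv_mul]

/-- The function on the plane whose Fourier transform is `p₁`. -/
noncomputable def density1 (ω₀ ω : ℝ → ℝ) (Q : ℝ) (q : ℕ) (x : Plane) : ℂ :=
  ((-(2 * normConst ω / Q) : ℝ) : ℂ) *
      ((ω₀ (‖x‖ / Q ^ (3 / 2 : ℝ)) *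
        (∑' j : ℕ+, (1 / ((q : ℝ) ^ 2 * ((j : ℕ) : ℝ) ^ 2)) *
          ω (‖x‖ / ((j : ℕ) * q * Q ^ (1 / 2 : ℝ)))) : ℝ) : ℂ)

/-- The function on the plane whose Fourier transform is `p₂`. -/
noncomputable def density2 (ω₀ ω : ℝ → ℝ) (Q : ℝ) (r : Fin 2 → ℤ) (k q : ℕ) (x : Plane) : ℂ :=
  ((normConst ω / Q ^ 3 : ℝ) : ℂ) *
      ((ω₀ (‖x‖ / Q ^ (3 / 2 : ℝ)) *
        h ω ((k : ℝ) * q / Q) (inner ℝ (toPlane r) x / Q ^ 2) : ℝ) : ℂ)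

lemma p1_eq_ft (ω₀ ω : ℝ → ℝ) (Q : ℝ) (q : ℕ) : p1 ω₀ ω Q q = ft (density1 ω₀ ω Q q) := by
  ext w
  rw [p1, ft, ← integral_const_mul]
  simp_rw [density1, mul_assoc]

lemma p2_eq_ft (ω₀ ω : ℝ → ℝ) (Q : ℝ) (r : Fin 2 → ℤ) (k q : ℕ) :
    p2 ω₀ ω Q r k q = ft (density2 ω₀ ω Q r k q) := by
  ext w
  rw [p2, ft, ← integral_const_mul]
  simp_rw [density2, mul_assoc]

lemma contDiff_norm_div {f : ℝ → ℝ} (hf : ContDiff ℝ (⊤ : ℕ∞) fun y : Plane => f ‖y‖) {s : ℝ}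
    (hs : 0 < s) : ContDiff ℝ (⊤ : ℕ∞) fun y : Plane => f (‖y‖ / s) := by
  have h1 : (fun y : Plane => f (‖y‖ / s)) = (fun y : Plane => f ‖y‖) ∘ fun y => s⁻¹ • y := by
    ext y
    simp only [Function.comp_apply]
    rw [norm_smul, norm_inv, Real.norm_eq_abs, abs_of_pos hs, inv_mul_eq_div]
  rw [h1]
  exact hf.comp (contDiff_const_smul _)

lemma IsCutoff.apply_norm_div_eq_zero (hω₀ : IsCutoff ω₀) {s : ℝ} (hs : 0 < s) {x : Plane}
    (hx : s < ‖x‖) : ω₀ (‖x‖ / s) = 0 := by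
  refine hω₀.apply_of_half_le ?_
  rw [abs_of_nonneg (by positivity)]
  have : 1 ≤ ‖x‖ / s := (one_le_div hs).2 hx.le
  linarith

lemma contDiff_density1 (hω : IsWeight ω) (hω₀ : IsCutoff ω₀) {Q : ℝ} (hQ : 1 ≤ Q) {q : ℕ}
    (hq : 1 ≤ q) : ContDiff ℝ (⊤ : ℕ∞) (density1 ω₀ ω Q q) := by
  have hq' : (1 : ℝ) ≤ q := by exact_mod_cast hq
  have hJ : Q ≤ (⌊Q⌋₊ + 1) * q := by
    have := (Nat.lt_floor_add_one Q).le
    nlinarith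
  unfold density1
  simp_rw [cutoff_mul_tsum_eq hω hω₀ hQ hq hJ]
  refine contDiff_const.mul (contDiff_ofReal (ContDiff.sum fun j hj => ?_))
  have hj0 : (0 : ℝ) < j := by exact_mod_cast (Finset.mem_Icc.1 hj).1
  exact contDiff_const.mul ((contDiff_norm_div hω.contDiff_norm (by positivity)).mul
    (contDiff_norm_div hω₀.contDiff_norm (by positivity)))

lemma hasCompactSupport_density1 (hω₀ : IsCutoff ω₀) {Q : ℝ} (hQ : 1 ≤ Q) (q : ℕ) :
    HasCompactSupport (density1 ω₀ ω Q q) :=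
  hasCompactSupport_of_norm (R := Q ^ (3 / 2 : ℝ)) fun x hx => by
    rw [density1, hω₀.apply_norm_div_eq_zero (by positivity) hx]
    simp

lemma contDiff_density2 (hω : IsWeight ω) (hω₀ : IsCutoff ω₀) {Q : ℝ} (hQ : 1 ≤ Q)
    (r : Fin 2 → ℤ) {k q : ℕ} (hk : 1 ≤ k) (hq : 1 ≤ q) :
    ContDiff ℝ (⊤ : ℕ∞) (density2 ω₀ ω Q r k q) := by
  have hk' : (0 : ℝ) < k := by exact_mod_cast hk
  have hq' : (0 : ℝ) < q := by exact_mod_cast hq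
  have hs : 0 < Q ^ (3 / 2 : ℝ) := by positivity
  have h1 : density2 ω₀ ω Q r k q = fun x => ((normConst ω / Q ^ 3 : ℝ) : ℂ) *
      kernel ω₀ ω (k * q / Q) ((Q ^ (3 / 2 : ℝ) / Q ^ 2) • toPlane r)
        ((Q ^ (3 / 2 : ℝ))⁻¹ • x) := by
    ext x
    rw [density2, kernel, cutoffPlane, norm_smul, norm_inv, Real.norm_eq_abs, abs_of_pos hs,
      inv_mul_eq_div, inner_smul_left, inner_smul_right]
    simp only [conj_trivial]
    rw [show Q ^ (3 / 2 : ℝ) / Q ^ 2 * ((Q ^ (3 / 2 : ℝ))⁻¹ * inner ℝ (toPlane r) x) =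
      inner ℝ (toPlane r) x / Q ^ 2 by field_simp]
    push_cast
    ring
  rw [h1]
  exact contDiff_const.mul ((contDiff_kernel hω hω₀ (by positivity) _).comp
    (contDiff_const_smul _))

lemma hasCompactSupport_density2 (hω₀ : IsCutoff ω₀) {Q : ℝ} (hQ : 1 ≤ Q) (r : Fin 2 → ℤ)
    (k q : ℕ) : HasCompactSupport (density2 ω₀ ω Q r k q) :=
  hasCompactSupport_of_norm (R := Q ^ (3 / 2 : ℝ)) fun x hx => by
    rw [density2, hω₀.apply_norm_div_eq_zero (by positivity) hx]
    simp

theorem integrable_p1 (hω : IsWeight ω) (hω₀ : IsCutoff ω₀) {Q : ℝ} (hQ : 1 ≤ Q) {q : ℕ}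
    (hq : 1 ≤ q) : Integrable (p1 ω₀ ω Q q) := by
  rw [p1_eq_ft]
  exact integrable_ft (contDiff_density1 hω hω₀ hQ hq) (hasCompactSupport_density1 hω₀ hQ q)

theorem integrable_p2 (hω : IsWeight ω) (hω₀ : IsCutoff ω₀) {Q : ℝ} (hQ : 1 ≤ Q)
    (r : Fin 2 → ℤ) {k q : ℕ} (hk : 1 ≤ k) (hq : 1 ≤ q) : Integrable (p2 ω₀ ω Q r k q) := by
  rw [p2_eq_ft]
  exact integrable_ft (contDiff_density2 hω hω₀ hQ r hk hq) (hasCompactSupport_density2 hω₀ hQ r k q)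

@[fun_prop] lemma continuous_arcChar (a : Fin 2 → ℤ) (q : ℕ) (n : Fin 2 → ℤ) :
    Continuous fun w => arcChar a q w n := by
  unfold arcChar
  fun_prop

@[simp] lemma norm_arcChar (a : Fin 2 → ℤ) (q : ℕ) (w : Plane) (n : Fin 2 → ℤ) :
    ‖arcChar a q w n‖ = 1 := norm_e _

lemma integrable_mul_arcChar {f : Plane → ℂ} (hf : Integrable f) (a : Fin 2 → ℤ) (q : ℕ)
    (n : Fin 2 → ℤ) : Integrable fun w => f w * arcChar a q w n :=
  hf.mul_bdd (c := 1) (continuous_arcChar a q n).aestronglyMeasurable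
    (Filter.Eventually.of_forall fun w => by simp)

/-- Fourier inversion for `p₁`. -/
lemma integral_p1_mul_arcChar (hω : IsWeight ω) (hω₀ : IsCutoff ω₀) {Q : ℝ} (hQ : 1 ≤ Q) {q : ℕ}
    (hq : 1 ≤ q) (a n : Fin 2 → ℤ) :
    ∫ w, p1 ω₀ ω Q q w * arcChar a q w n =
      e (intDot a n / q) * density1 ω₀ ω Q q (toPlane n) := by
  rw [p1_eq_ft, ← integral_ft_mul_e (contDiff_density1 hω hω₀ hQ hq)
    (hasCompactSupport_density1 hω₀ hQ q), ← integral_const_mul]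
  simp_rw [arcChar_eq]
  exact integral_congr_ae (Filter.Eventually.of_forall fun w => by ring)

/-- Fourier inversion for `p₂`. -/
lemma integral_p2_mul_arcChar (hω : IsWeight ω) (hω₀ : IsCutoff ω₀) {Q : ℝ} (hQ : 1 ≤ Q)
    (r : Fin 2 → ℤ) {k q : ℕ} (hk : 1 ≤ k) (hq : 1 ≤ q) (a n : Fin 2 → ℤ) :
    ∫ w, p2 ω₀ ω Q r k q w * arcChar a q w n =
      e (intDot a n / q) * density2 ω₀ ω Q r k q (toPlane n) := by
  rw [p2_eq_ft, ← integral_ft_mul_e (contDiff_density2 hω hω₀ hQ r hk hq)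
    (hasCompactSupport_density2 hω₀ hQ r k q), ← integral_const_mul]
  simp_rw [arcChar_eq]
  exact integral_congr_ae (Filter.Eventually.of_forall fun w => by ring)

lemma norm_inv_smul_toPlane {Q : ℝ} (hQ : 1 ≤ Q) (r : Fin 2 → ℤ) :
    ‖(Q ^ (1 / 2 : ℝ))⁻¹ • toPlane r‖ = ‖toPlane r‖ / Q ^ (1 / 2 : ℝ) := by
  rw [norm_smul, norm_inv, Real.norm_eq_abs, abs_of_pos (by positivity), inv_mul_eq_div]

/-- For `k q ≥ Q` the function `h(k q / Q, ·)` vanishes on the support of the cut-off. -/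
lemma p2_eq_zero (hω : IsWeight ω) (hω₀ : IsCutoff ω₀) {Q : ℝ} (hQ : 1 ≤ Q) {r : Fin 2 → ℤ}
    (hr : ‖toPlane r‖ ≤ Q ^ (1 / 2 : ℝ)) {k q : ℕ} (hkq : Q ≤ k * q) (w : Plane) :
    p2 ω₀ ω Q r k q w = 0 := by
  rw [p2_eq_ft_kernel ω₀ ω hQ, ft]
  have h1 : 1 ≤ (k : ℝ) * q / Q := by rwa [one_le_div (by linarith)]
  have h2 : ‖(Q ^ (1 / 2 : ℝ))⁻¹ • toPlane r‖ ≤ 1 := by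
    rw [norm_inv_smul_toPlane hQ, div_le_one (by positivity)]
    exact hr
  simp only [kernel_eq_zero_of_one_le hω hω₀ h1 h2, zero_mul, integral_zero, mul_zero]

end Inversion

/-! ### The lattices `Λ(a, q)` -/

section Lattice

variable {ω ω₀ : ℝ → ℝ}

lemma exists_bezout {a : Fin 2 → ℤ} {q : ℕ} (h : gcdWith a q = 1) :
    ∃ x y z : ℤ, x * a 0 + y * a 1 + z * q = 1 := by
  have h1 : Int.gcd (Int.gcd (a 0) (a 1)) q = 1 := by
    rw [gcdWith, vecGcd] at h
    simpa [Int.gcd] using h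
  have h2 := Int.gcd_eq_gcd_ab (Int.gcd (a 0) (a 1)) q
  have h3 := Int.gcd_eq_gcd_ab (a 0) (a 1)
  rw [h1, h3] at h2
  set A := Int.gcdA (a 0) (a 1)
  set B := Int.gcdB (a 0) (a 1)
  set D := a 0 * A + a 1 * B
  refine ⟨A * D.gcdA q, B * D.gcdA q, D.gcdB q, ?_⟩
  push_cast at h2
  linear_combination -h2

/-- For `gcd(a, q) = 1` the lattice `Λ(a, q)` is cut out by one congruence. -/
lemma mem_lattice_iff {a : Fin 2 → ℤ} {q : ℕ} (h : gcdWith a q = 1) (r : Fin 2 → ℤ) :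
    r ∈ lattice a q ↔ (q : ℤ) ∣ dotPerp r a := by
  constructor
  · rintro ⟨k, y, rfl⟩
    refine ⟨y 0 * a 1 - y 1 * a 0, ?_⟩
    simp only [dotPerp, Pi.add_apply, Pi.smul_apply, smul_eq_mul]
    ring
  · rintro ⟨m, hm⟩
    obtain ⟨x, y, z, hxyz⟩ := exists_bezout h
    rw [dotPerp] at hm
    refine ⟨x * r 0 + y * r 1, ![z * r 0 + y * m, z * r 1 - x * m], ?_⟩
    ext i
    fin_cases i
    · simp only [Fin.zero_eta, Fin.isValue, Pi.add_apply, Pi.smul_apply, smul_eq_mul,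
        Matrix.cons_val_zero]
      linear_combination (-(r 0)) * hxyz + y * hm
    · simp only [Fin.mk_one, Fin.isValue, Pi.add_apply, Pi.smul_apply, smul_eq_mul,
        Matrix.cons_val_one, Matrix.cons_val_fin_one]
      linear_combination (-(r 1)) * hxyz - x * hm

/-- The lattice determines the modulus: the ideal of `ℤ` generated by the determinants of pairs of
vectors of `Λ(a, q)` is generated by `q`. -/
lemma dvd_of_lattice_eq {a a' : Fin 2 → ℤ} {q q' : ℕ} (h : gcdWith a q = 1)
    (hΛ : lattice a q = lattice a' q') : q' ∣ q := by
  -- all determinants of pairs of vectors of the lattice are divisible by `q'`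
  have hdet : ∀ u v : Fin 2 → ℤ, u ∈ lattice a q → v ∈ lattice a q →
      (q' : ℤ) ∣ u 0 * v 1 - u 1 * v 0 := by
    intro u v hu hv
    rw [hΛ] at hu hv
    obtain ⟨k, y, rfl⟩ := hu
    obtain ⟨l, z, rfl⟩ := hv
    refine ⟨k * (a' 0 * z 1 - a' 1 * z 0) + l * (y 0 * a' 1 - y 1 * a' 0) +
      q' * (y 0 * z 1 - y 1 * z 0), ?_⟩
    simp only [Pi.add_apply, Pi.smul_apply, smul_eq_mul]
    ring
  have ha : a ∈ lattice a q := ⟨1, 0, by simp⟩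
  have hy : ∀ y : Fin 2 → ℤ, (q : ℤ) • y ∈ lattice a q := fun y => ⟨0, y, by simp⟩
  have h1 : (q' : ℤ) ∣ a 0 * q := by simpa using hdet a _ ha (hy ![0, 1])
  have h2 : (q' : ℤ) ∣ a 1 * q := by simpa using hdet a _ ha (hy ![1, 0])
  have h3 : (q' : ℤ) ∣ q * q := by simpa using hdet _ _ (hy ![1, 0]) (hy ![0, 1])
  obtain ⟨x, y, z, hxyz⟩ := exists_bezout h
  have h4 : (q' : ℤ) ∣ q := by
    have h5 := ((h1.mul_left x).add (h2.mul_left y)).add (h3.mul_left z)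
    rwa [show x * (a 0 * q) + y * (a 1 * q) + z * (q * q) = (q : ℤ) by
      linear_combination (q : ℤ) * hxyz] at h5
  exact_mod_cast h4

lemma eq_of_lattice_eq {a a' : Fin 2 → ℤ} {q q' : ℕ} (h : gcdWith a q = 1)
    (h' : gcdWith a' q' = 1) (hΛ : lattice a q = lattice a' q') : q = q' :=
  Nat.dvd_antisymm (dvd_of_lattice_eq h' hΛ.symm) (dvd_of_lattice_eq h hΛ)

open Classical in
/-- The modulus `q` of a lattice of the form `Λ(a, q)` with `gcd(a, q) = 1`, and `0` for any other
lattice. -/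
noncomputable def latticeModulus (Λ : AddSubgroup (Fin 2 → ℤ)) : ℕ :=
  if H : ∃ q : ℕ, ∃ a : Fin 2 → ℤ, gcdWith a q = 1 ∧ Λ = lattice a q then H.choose else 0

lemma latticeModulus_lattice {a : Fin 2 → ℤ} {q : ℕ} (h : gcdWith a q = 1) :
    latticeModulus (lattice a q) = q := by
  have H : ∃ q' : ℕ, ∃ a' : Fin 2 → ℤ, gcdWith a' q' = 1 ∧ lattice a q = lattice a' q' :=
    ⟨q, a, h, rfl⟩
  rw [latticeModulus, dif_pos H]
  obtain ⟨a', h', hΛ⟩ := H.choose_spec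
  exact (eq_of_lattice_eq h h' hΛ).symm

/-- The kernel `p_Λ` attached to a lattice. -/
noncomputable def latticeKernel (ω₀ ω : ℝ → ℝ) (Q : ℝ) (Λ : AddSubgroup (Fin 2 → ℤ)) (w : Plane) :
    ℂ :=
  p1 ω₀ ω Q (latticeModulus Λ) w + ∑' r : Λ, vecWeight ω Q r *
    p2 ω₀ ω Q r (vecGcd r / gcdWith r (latticeModulus Λ)) (latticeModulus Λ) w

lemma latticeKernel_lattice (ω₀ ω : ℝ → ℝ) (Q : ℝ) {a : Fin 2 → ℤ} {q : ℕ} (h : gcdWith a q = 1)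
    (w : Plane) :
    latticeKernel ω₀ ω Q (lattice a q) w = p1 ω₀ ω Q q w +
      ∑' r : lattice a q, vecWeight ω Q r * p2 ω₀ ω Q r (vecGcd r / gcdWith r q) q w := by
  rw [latticeKernel, latticeModulus_lattice h]

/-- The integer vectors with entries in `[-M, M]`. -/
noncomputable def box (M : ℕ) : Finset (Fin 2 → ℤ) := Fintype.piFinset fun _ => Finset.Icc (-(M : ℤ)) M

lemma card_box (M : ℕ) : (box M).card = (2 * M + 1) ^ 2 := by
  simp [box]
  omega

lemma vecWeight_bounds (hω : IsWeight ω) {Q : ℝ} (hQ : 1 ≤ Q) {r : Fin 2 → ℤ}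
    (hr : vecWeight ω Q r ≠ 0) :
    Q ^ (1 / 2 : ℝ) / 2 < ‖toPlane r‖ ∧ ‖toPlane r‖ < Q ^ (1 / 2 : ℝ) := by
  have hX : 0 < Q ^ (1 / 2 : ℝ) := by positivity
  rw [vecWeight, Complex.ofReal_ne_zero] at hr
  have := hω.support hr
  rw [Set.mem_Ioo, lt_div_iff₀ hX, div_lt_iff₀ hX] at this
  constructor <;> linarith

lemma sqrt_le_self {Q : ℝ} (hQ : 1 ≤ Q) : Q ^ (1 / 2 : ℝ) ≤ Q := by
  obtain ⟨h1, h2, _⟩ := sqrt_pow_facts hQ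
  nlinarith

lemma vecWeight_eq_zero_of_notMem (hω : IsWeight ω) {Q : ℝ} (hQ : 1 ≤ Q) {r : Fin 2 → ℤ}
    (hr : r ∉ box ⌊Q⌋₊) : vecWeight ω Q r = 0 := by
  by_contra h
  obtain ⟨_, h2⟩ := vecWeight_bounds hω hQ h
  refine hr ?_
  rw [box, Fintype.mem_piFinset]
  intro i
  rw [Finset.mem_Icc, ← abs_le]
  have h3 := abs_apply_le_norm (toPlane r) i
  rw [toPlane_apply] at h3
  have h4 : |(r i : ℝ)| ≤ Q := h3.trans (h2.le.trans (sqrt_le_self hQ))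
  have h5 : ((|r i|.toNat : ℕ) : ℝ) ≤ Q := by
    have : ((|r i|.toNat : ℤ) : ℝ) ≤ Q := by
      rw [Int.toNat_of_nonneg (abs_nonneg _)]
      exact_mod_cast h4
    exact_mod_cast this
  have h6 := Nat.le_floor h5
  omega

lemma vecGcd_pos_of_vecWeight (hω : IsWeight ω) {Q : ℝ} (hQ : 1 ≤ Q) {r : Fin 2 → ℤ}
    (hr : vecWeight ω Q r ≠ 0) : 0 < vecGcd r := by
  have h1 := (vecWeight_bounds hω hQ hr).1
  refine Nat.pos_of_ne_zero fun h => ?_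
  rw [vecGcd, Int.gcd_eq_zero_iff] at h
  have : ‖toPlane r‖ ^ 2 = 0 := by
    rw [norm_sq_plane, toPlane_apply, toPlane_apply, h.1, h.2]
    simp
  have h2 : 0 < Q ^ (1 / 2 : ℝ) := by positivity
  nlinarith

open Classical in
/-- The weight restricts the sum over the lattice to a finite box. -/
lemma tsum_lattice_eq_sum (hω : IsWeight ω) {Q : ℝ} (hQ : 1 ≤ Q) {a : Fin 2 → ℤ} {q : ℕ}
    (h : gcdWith a q = 1) (f : (Fin 2 → ℤ) → ℂ) :
    ∑' r : lattice a q, vecWeight ω Q r * f r =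
      ∑ r ∈ (box ⌊Q⌋₊).filter (fun r => (q : ℤ) ∣ dotPerp r a), vecWeight ω Q r * f r := by
  have h1 := tsum_subtype (lattice a q : Set (Fin 2 → ℤ)) fun r => vecWeight ω Q r * f r
  refine h1.trans ?_
  rw [tsum_eq_sum (s := box ⌊Q⌋₊), Finset.sum_filter]
  · refine Finset.sum_congr rfl fun r _ => ?_
    rw [Set.indicator_apply]
    refine if_congr ?_ rfl rfl
    exact mem_lattice_iff h r
  · intro r hr
    rw [Set.indicator_apply, vecWeight_eq_zero_of_notMem hω hQ hr]
    simp

lemma div_gcdWith_pos {r : Fin 2 → ℤ} (hr : 0 < vecGcd r) (q : ℕ) :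
    1 ≤ vecGcd r / gcdWith r q :=
  Nat.div_pos (Nat.le_of_dvd hr (Nat.gcd_dvd_left _ _)) (Nat.gcd_pos_of_pos_left _ hr)

lemma vecWeight_mul_p2_integrable (hω : IsWeight ω) (hω₀ : IsCutoff ω₀) {Q : ℝ} (hQ : 1 ≤ Q)
    {q : ℕ} (hq : 1 ≤ q) (r : Fin 2 → ℤ) :
    Integrable fun w => vecWeight ω Q r * p2 ω₀ ω Q r (vecGcd r / gcdWith r q) q w := by
  by_cases hr : vecWeight ω Q r = 0
  · simp [hr]
  · exact (integrable_p2 hω hω₀ hQ r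
      (div_gcdWith_pos (vecGcd_pos_of_vecWeight hω hQ hr) q) hq).const_mul _

lemma latticeKernel_eq_sum (hω : IsWeight ω) {Q : ℝ} (hQ : 1 ≤ Q) {a : Fin 2 → ℤ} {q : ℕ}
    (h : gcdWith a q = 1) (w : Plane) :
    latticeKernel ω₀ ω Q (lattice a q) w = p1 ω₀ ω Q q w +
      ∑ r ∈ (box ⌊Q⌋₊).filter (fun r => (q : ℤ) ∣ dotPerp r a),
        vecWeight ω Q r * p2 ω₀ ω Q r (vecGcd r / gcdWith r q) q w := by
  rw [latticeKernel_lattice ω₀ ω Q h]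
  congr 1
  exact tsum_lattice_eq_sum hω hQ h fun r => p2 ω₀ ω Q r (vecGcd r / gcdWith r q) q w

theorem integrable_latticeKernel (hω : IsWeight ω) (hω₀ : IsCutoff ω₀) {Q : ℝ} (hQ : 1 ≤ Q)
    {a : Fin 2 → ℤ} {q : ℕ} (hq : 1 ≤ q) (h : gcdWith a q = 1) :
    Integrable (latticeKernel ω₀ ω Q (lattice a q)) := by
  rw [show latticeKernel ω₀ ω Q (lattice a q) = _ from funext (latticeKernel_eq_sum hω hQ h)]
  exact (integrable_p1 hω hω₀ hQ hq).add
    (integrable_finsetSum _ fun r _ => vecWeight_mul_p2_integrable hω hω₀ hQ hq r)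

end Lattice

/-! ### Sums over divisors and additive characters -/

lemma sum_multiples_eq {E : Type*} [AddCommMonoid E] {M m : ℕ} (hm : 1 ≤ m) {F : ℕ → E}
    (hF : ∀ L, M < L → F L = 0) :
    ∑ j ∈ Finset.Icc 1 M, F (m * j) = ∑ L ∈ (Finset.Icc 1 M).filter (m ∣ ·), F L := by
  symm
  refine Finset.sum_bij_ne_zero (fun L _ _ => L / m) ?_ ?_ ?_ ?_
  · intro L hL _
    rw [Finset.mem_filter, Finset.mem_Icc] at hL
    rw [Finset.mem_Icc]
    exact ⟨Nat.div_pos (Nat.le_of_dvd (by omega) hL.2) hm, (Nat.div_le_self _ _).trans hL.1.2⟩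
  · intro L hL _ L' hL' _ h
    rw [Finset.mem_filter] at hL hL'
    rw [← Nat.div_mul_cancel hL.2, h, Nat.div_mul_cancel hL'.2]
  · intro j hj h
    rw [Finset.mem_Icc] at hj
    refine ⟨m * j, ?_, h, Nat.mul_div_cancel_left _ hm⟩
    rw [Finset.mem_filter, Finset.mem_Icc]
    refine ⟨⟨Nat.mul_pos hm hj.1, ?_⟩, dvd_mul_right _ _⟩
    by_contra h1
    exact h (hF _ (not_le.1 h1))
  · intro L hL _
    rw [Finset.mem_filter] at hL
    rw [Nat.mul_div_cancel' hL.2]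

/-- The rearrangement `∑_q R(q) ∑_j F(lcm(G, q) j) = ∑_{L ≡ 0 mod G} F(L) ∑_{q ∣ L} R(q)`. -/
lemma sum_mul_sum_lcm_eq {G M : ℕ} (hG : 1 ≤ G) {F R : ℕ → ℂ} (hF : ∀ L, M < L → F L = 0) :
    ∑ q ∈ Finset.Icc 1 M, R q * ∑ j ∈ Finset.Icc 1 M, F (Nat.lcm G q * j) =
      ∑ l ∈ Finset.Icc 1 M, F (G * l) * ∑ q ∈ (G * l).divisors, R q := by
  have h1 : ∀ q ∈ Finset.Icc 1 M, R q * ∑ j ∈ Finset.Icc 1 M, F (Nat.lcm G q * j) =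
      ∑ L ∈ Finset.Icc 1 M, if G ∣ L ∧ q ∣ L then F L * R q else 0 := by
    intro q hq
    rw [Finset.mem_Icc] at hq
    rw [sum_multiples_eq (Nat.lcm_pos hG hq.1) hF, Finset.mul_sum, Finset.sum_filter]
    refine Finset.sum_congr rfl fun L _ => ?_
    rw [mul_comm]
    exact if_congr (Nat.lcm_dvd_iff) rfl rfl
  rw [Finset.sum_congr rfl h1, Finset.sum_comm,
    sum_multiples_eq (F := fun L => F L * ∑ q ∈ L.divisors, R q) hG
      (fun L hL => by rw [hF L hL, zero_mul]), Finset.sum_filter]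
  refine Finset.sum_congr rfl fun L hL => ?_
  rw [Finset.mem_Icc] at hL
  split_ifs with h
  · simp only [h, true_and]
    rw [← Finset.sum_filter, Finset.mul_sum]
    refine Finset.sum_congr ?_ fun _ _ => rfl
    ext q
    rw [Finset.mem_filter, Finset.mem_Icc, Nat.mem_divisors]
    constructor
    · rintro ⟨_, h2⟩
      exact ⟨h2, by omega⟩
    · rintro ⟨h2, _⟩
      have := Nat.le_of_dvd (by omega) h2
      exact ⟨⟨Nat.pos_of_dvd_of_pos h2 (by omega), by omega⟩, h2⟩
  · simp [h]

/-- The terms `l` and `m / l` of a sum over the divisors of `m` cancel. -/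
lemma sum_divisors_sub_eq_zero (m : ℕ) (f : ℝ → ℝ) (Y : ℝ) :
    ∑ l ∈ m.divisors, (f (l / Y) - f (m / (l * Y))) = 0 := by
  rw [Finset.sum_sub_distrib, ← Nat.sum_div_divisors m (fun l => f (l / Y)), sub_eq_zero]
  refine Finset.sum_congr rfl fun l hl => ?_
  have h1 := Nat.dvd_of_mem_divisors hl
  have h2 : (l : ℝ) ≠ 0 := by
    have := Nat.pos_of_mem_divisors hl
    positivity
  rw [Nat.cast_div h1 h2, div_div]

/-- The vectors with entries in `{0, …, L - 1}`. -/
noncomputable def residues (L : ℕ) : Finset (Fin 2 → ℤ) :=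
  Fintype.piFinset fun _ : Fin 2 => Finset.Ico (0 : ℤ) (L : ℤ)

lemma mem_residues {L : ℕ} {b : Fin 2 → ℤ} : b ∈ residues L ↔ ∀ i, 0 ≤ b i ∧ b i < L := by
  simp [residues]

lemma reducedResidues_eq (q : ℕ) :
    reducedResidues q = (residues q).filter fun a => gcdWith a q = 1 := rfl

lemma gcdWith_smul (d q : ℕ) (a : Fin 2 → ℤ) : gcdWith ((d : ℤ) • a) (d * q) = d * gcdWith a q := by
  rw [gcdWith, gcdWith, vecGcd, vecGcd, Pi.smul_apply, Pi.smul_apply, smul_eq_mul, smul_eq_mul,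
    Int.gcd_mul_left, Int.natAbs_natCast, Nat.gcd_mul_left]

lemma vecGcd_dvd (r : Fin 2 → ℤ) (i : Fin 2) : (vecGcd r : ℤ) ∣ r i := by
  fin_cases i
  · exact Int.gcd_dvd_left ..
  · exact Int.gcd_dvd_right ..

lemma gcdWith_dvd (b : Fin 2 → ℤ) (L : ℕ) (i : Fin 2) : (gcdWith b L : ℤ) ∣ b i :=
  (Int.natCast_dvd_natCast.2 (Nat.gcd_dvd_left _ _)).trans (vecGcd_dvd b i)

lemma exists_eq_smul_of_dvd {d : ℤ} {b : Fin 2 → ℤ} (h : ∀ i, d ∣ b i) : ∃ a, b = d • a := by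
  choose a ha using h
  exact ⟨a, funext fun i => by simp [ha]⟩

/-- The classes mod `L` are the fractions `a / q` in lowest terms with `q ∣ L`. -/
lemma sum_residues_eq (f : (Fin 2 → ℤ) → ℂ) {L : ℕ} (hL : 1 ≤ L) :
    ∑ b ∈ residues L, f b =
      ∑ q ∈ L.divisors, ∑ a ∈ reducedResidues q, f (((L / q : ℕ) : ℤ) • a) := by
  have h1 : ∀ b ∈ residues L, gcdWith b L ∈ L.divisors := fun b _ =>
    Nat.mem_divisors.2 ⟨Nat.gcd_dvd_right _ _, by omega⟩
  rw [← Finset.sum_fiberwise_of_maps_to h1,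
    ← Nat.sum_div_divisors L fun q => ∑ a ∈ reducedResidues q, f (((L / q : ℕ) : ℤ) • a)]
  refine Finset.sum_congr rfl fun d hd => ?_
  obtain ⟨q, rfl⟩ := Nat.dvd_of_mem_divisors hd
  have hd0 := Nat.pos_of_mem_divisors hd
  have hq0 : 0 < q := Nat.pos_of_ne_zero fun h => by simp [h] at hL
  have hd1 : (0 : ℤ) < d := by exact_mod_cast hd0
  rw [Nat.mul_div_cancel_left _ hd0, Nat.mul_div_cancel _ hq0]
  symm
  refine Finset.sum_bij (fun a _ => (d : ℤ) • a) ?_ ?_ ?_ fun _ _ => rfl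
  · intro a ha
    rw [reducedResidues_eq, Finset.mem_filter, mem_residues] at ha
    rw [Finset.mem_filter, mem_residues, gcdWith_smul, ha.2, mul_one]
    refine ⟨fun i => ?_, rfl⟩
    obtain ⟨h2, h3⟩ := ha.1 i
    rw [Pi.smul_apply, smul_eq_mul, Nat.cast_mul]
    exact ⟨by positivity, by nlinarith⟩
  · intro a _ a' _ h
    exact smul_right_injective _ hd1.ne' h
  · intro b hb
    rw [Finset.mem_filter, mem_residues] at hb
    obtain ⟨a, rfl⟩ := exists_eq_smul_of_dvd (d := (d : ℤ)) (b := b) fun i => by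
      have := gcdWith_dvd b (d * q) i
      rwa [hb.2] at this
    refine ⟨a, ?_, rfl⟩
    rw [reducedResidues_eq, Finset.mem_filter, mem_residues]
    refine ⟨fun i => ?_, ?_⟩
    · obtain ⟨h2, h3⟩ := hb.1 i
      rw [Pi.smul_apply, smul_eq_mul] at h2 h3
      rw [Nat.cast_mul] at h3
      exact ⟨nonneg_of_mul_nonneg_right h2 hd1, lt_of_mul_lt_mul_left h3 hd1.le⟩
    · have := hb.2
      rw [gcdWith_smul] at this
      exact Nat.eq_of_mul_eq_mul_left hd0 (by rw [this, mul_one])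

lemma e_eq_one_iff (x : ℝ) : e x = 1 ↔ ∃ n : ℤ, x = n := by
  rw [e, Complex.exp_eq_one_iff]
  have h : (2 * (Real.pi : ℂ) * Complex.I) ≠ 0 := Complex.two_pi_I_ne_zero
  refine exists_congr fun n => ?_
  rw [mul_comm (n : ℂ), mul_right_inj' h]
  norm_cast

/-- Orthogonality of the additive characters modulo `L`. -/
lemma sum_Ico_e {L : ℕ} (hL : 1 ≤ L) (m : ℤ) :
    ∑ b ∈ Finset.Ico (0 : ℤ) L, e (b * m / L) = if (L : ℤ) ∣ m then (L : ℂ) else 0 := by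
  have hL0 : (L : ℝ) ≠ 0 := by positivity
  have h1 : ∀ b : ℕ, e (b * m / L) = e (m / L) ^ b := fun b => by
    rw [e, e, ← Complex.exp_nat_mul]
    congr 1
    push_cast
    ring
  have h2 : ∑ b ∈ Finset.Ico (0 : ℤ) L, e (b * m / L) = ∑ b ∈ Finset.range L, e (m / L) ^ b := by
    simp_rw [← h1]
    symm
    refine Finset.sum_bij (fun b _ => (b : ℤ)) ?_ ?_ ?_ ?_
    · intro b hb
      rw [Finset.mem_range] at hb
      rw [Finset.mem_Ico]
      omega
    · intro a _ b _ h
      exact_mod_cast h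
    · intro b hb
      rw [Finset.mem_Ico] at hb
      exact ⟨b.toNat, by rw [Finset.mem_range]; omega, by omega⟩
    · intro b _
      simp
  have h3 : e (m / L) = 1 ↔ (L : ℤ) ∣ m := by
    rw [e_eq_one_iff]
    refine exists_congr fun n => ?_
    rw [div_eq_iff hL0, mul_comm]
    norm_cast
  rw [h2]
  split_ifs with h
  · rw [h3.2 h]
    simp
  · have h4 : e (m / L) ≠ 1 := fun h5 => h (h3.1 h5)
    rw [geom_sum_eq h4]
    have h5 : e (m / L) ^ L = 1 := by
      rw [← h1, mul_div_cancel_left₀ _ hL0]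
      exact (e_eq_one_iff _).2 ⟨m, rfl⟩
    rw [h5, sub_self, zero_div]

lemma sum_residues (f : ℤ → ℤ → ℂ) (L : ℕ) :
    ∑ b ∈ residues L, f (b 0) (b 1) =
      ∑ x ∈ Finset.Ico (0 : ℤ) L, ∑ y ∈ Finset.Ico (0 : ℤ) L, f x y := by
  rw [← Finset.sum_product']
  refine Finset.sum_bij' (fun b _ => (b 0, b 1)) (fun p _ => ![p.1, p.2]) ?_ ?_ ?_ ?_ ?_
  · intro b hb
    rw [mem_residues] at hb
    simp [hb]
  · intro p hp
    rw [Finset.mem_product, Finset.mem_Ico, Finset.mem_Ico] at hp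
    rw [mem_residues, Fin.forall_fin_two]
    simpa using hp
  · intro b _
    ext i
    fin_cases i <;> rfl
  · intro p _
    rfl
  · intro b _
    rfl

/-- Detecting the congruence `r · b^⊥ ≡ 0 mod L` by additive characters. -/
lemma sum_residues_dvd {L : ℕ} (hL : 1 ≤ L) (r n : Fin 2 → ℤ) :
    ∑ b ∈ (residues L).filter (fun b => (L : ℤ) ∣ dotPerp r b), e (intDot b n / L) =
      L * (((Finset.Ico (0 : ℤ) L).filter fun s =>
        (L : ℤ) ∣ n 0 - s * r 1 ∧ (L : ℤ) ∣ n 1 + s * r 0).card : ℂ) := by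
  have hL0 : (L : ℂ) ≠ 0 := by
    have : L ≠ 0 := by omega
    exact_mod_cast this
  have h1 : ∀ b : Fin 2 → ℤ, (if (L : ℤ) ∣ dotPerp r b then e (intDot b n / L) else 0) =
      (L : ℂ)⁻¹ * ∑ s ∈ Finset.Ico (0 : ℤ) L,
        e (b 0 * (n 0 - s * r 1 : ℤ) / L) * e (b 1 * (n 1 + s * r 0 : ℤ) / L) := by
    intro b
    have h2 : ∀ s : ℤ, e (b 0 * (n 0 - s * r 1 : ℤ) / L) * e (b 1 * (n 1 + s * r 0 : ℤ) / L) =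
        e (intDot b n / L) * e (s * dotPerp r b / L) := fun s => by
      rw [← e_add, ← e_add, intDot, dotPerp]
      congr 1
      push_cast
      ring
    simp_rw [h2]
    rw [← Finset.mul_sum, sum_Ico_e hL]
    split_ifs
    · rw [mul_comm (e _), inv_mul_cancel_left₀ hL0]
    · simp
  rw [Finset.sum_filter]
  simp_rw [h1]
  rw [← Finset.mul_sum, Finset.sum_comm]
  have h3 : ∀ s : ℤ, ∑ b ∈ residues L,
      e (b 0 * (n 0 - s * r 1 : ℤ) / L) * e (b 1 * (n 1 + s * r 0 : ℤ) / L) =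
      if (L : ℤ) ∣ n 0 - s * r 1 ∧ (L : ℤ) ∣ n 1 + s * r 0 then (L : ℂ) * L else 0 := by
    intro s
    rw [sum_residues fun x y => e (x * (n 0 - s * r 1 : ℤ) / L) * e (y * (n 1 + s * r 0 : ℤ) / L)]
    simp_rw [← Finset.mul_sum, ← Finset.sum_mul]
    rw [sum_Ico_e hL, sum_Ico_e hL]
    by_cases ha : (L : ℤ) ∣ n 0 - s * r 1 <;> by_cases hb : (L : ℤ) ∣ n 1 + s * r 0 <;>
      simp only [ha, hb, if_true, if_false, and_true, and_false, mul_zero, zero_mul]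
  simp_rw [h3]
  rw [← Finset.sum_filter, Finset.sum_const, nsmul_eq_mul]
  field_simp

lemma card_filter_Ico_dvd_sub {G m : ℕ} (hm : 1 ≤ m) (v : ℤ) :
    ((Finset.Ico (0 : ℤ) (G * m : ℕ)).filter fun s => (m : ℤ) ∣ s - v).card = G := by
  have hm0 : (0 : ℤ) < m := by exact_mod_cast hm
  have h1 := Int.Ico_filter_modEq_card (a := 0) (b := ((G * m : ℕ) : ℤ)) hm0 v
  have h2 : ((Finset.Ico (0 : ℤ) (G * m : ℕ)).filter fun s => (m : ℤ) ∣ s - v) =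
      (Finset.Ico (0 : ℤ) (G * m : ℕ)).filter fun s => s ≡ v [ZMOD m] := by
    refine Finset.filter_congr fun s _ => ?_
    rw [Int.modEq_comm, Int.modEq_iff_dvd]
  rw [h2]
  have hm1 : (m : ℚ) ≠ 0 := by positivity
  have h3 : (((G * m : ℕ) : ℤ) - v : ℚ) / ((m : ℤ) : ℚ) = ((0 : ℤ) - v : ℚ) / ((m : ℤ) : ℚ) + G := by
    push_cast
    field_simp
    ring
  rw [h3, Int.ceil_add_natCast, add_sub_cancel_left, max_eq_left (by positivity)] at h1
  exact_mod_cast h1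

/-- The character sum over the classes `b mod G l` with `r · b^⊥ ≡ 0`, where `G = gcd(r)`. -/
lemma sum_residues_dvd_eq {r : Fin 2 → ℤ} (hr : 0 < vecGcd r) (n : Fin 2 → ℤ) {l : ℕ} (hl : 1 ≤ l) :
    ∑ b ∈ (residues (vecGcd r * l)).filter (fun b => ((vecGcd r * l : ℕ) : ℤ) ∣ dotPerp r b),
        e (intDot b n / (vecGcd r * l : ℕ)) =
      if vecGcd r ∣ vecGcd n ∧ ((vecGcd r ^ 2 * l : ℕ) : ℤ) ∣ intDot r n then
        ((vecGcd r * l : ℕ) : ℂ) * vecGcd r else 0 := by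
  set G := vecGcd r with hG
  have hG0 : (0 : ℤ) < G := by exact_mod_cast hr
  have hl0 : (0 : ℤ) < l := by exact_mod_cast hl
  rw [sum_residues_dvd (Nat.mul_pos hr hl)]
  obtain ⟨c, hc⟩ := exists_eq_smul_of_dvd (d := (G : ℤ)) (b := r) fun i => vecGcd_dvd r i
  have hc0 : r 0 = G * c 0 := by rw [hc]; rfl
  have hc1 : r 1 = G * c 1 := by rw [hc]; rfl
  obtain ⟨x, y, hxy⟩ : ∃ x y : ℤ, c 0 * x + c 1 * y = 1 := by
    have h1 := Int.gcd_eq_gcd_ab (r 0) (r 1)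
    refine ⟨Int.gcdA (r 0) (r 1), Int.gcdB (r 0) (r 1), ?_⟩
    have h2 : (G : ℤ) * (c 0 * Int.gcdA (r 0) (r 1) + c 1 * Int.gcdB (r 0) (r 1)) = G * 1 := by
      have h3 : (G : ℤ) = r 0 * Int.gcdA (r 0) (r 1) + r 1 * Int.gcdB (r 0) (r 1) := h1
      linear_combination (-Int.gcdA (r 0) (r 1)) * hc0 - Int.gcdB (r 0) (r 1) * hc1 - h3
    exact mul_left_cancel₀ hG0.ne' h2
  split_ifs with h
  · obtain ⟨h1, h2⟩ := h
    obtain ⟨m, hm⟩ := exists_eq_smul_of_dvd (d := (G : ℤ)) (b := n) fun i =>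
      (Int.natCast_dvd_natCast.2 h1).trans (vecGcd_dvd n i)
    have hm0 : n 0 = G * m 0 := by rw [hm]; rfl
    have hm1 : n 1 = G * m 1 := by rw [hm]; rfl
    obtain ⟨t, ht⟩ := h2
    have ht' : c 0 * m 0 + c 1 * m 1 = l * t := by
      have : (G : ℤ) ^ 2 * (c 0 * m 0 + c 1 * m 1) = G ^ 2 * (l * t) := by
        rw [intDot, hc0, hc1, hm0, hm1] at ht
        push_cast at ht
        linear_combination ht
      exact mul_left_cancel₀ (pow_ne_zero 2 hG0.ne') this
    -- the two congruences for `s` amount to `s ≡ y m 0 - x m 1` modulo `l`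
    congr 1
    refine congrArg Nat.cast (.trans ?_ (card_filter_Ico_dvd_sub (G := G) hl (y * m 0 - x * m 1)))
    refine congrArg Finset.card (Finset.filter_congr fun s _ => ?_)
    have e0 : n 0 - s * r 1 = G * (m 0 - s * c 1) := by rw [hm0, hc1]; ring
    have e1 : n 1 + s * r 0 = G * (m 1 + s * c 0) := by rw [hm1, hc0]; ring
    rw [e0, e1, Nat.cast_mul, mul_dvd_mul_iff_left hG0.ne', mul_dvd_mul_iff_left hG0.ne']
    constructor
    · rintro ⟨⟨u, hu⟩, ⟨v, hv⟩⟩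
      refine ⟨x * v - y * u, ?_⟩
      linear_combination (-s) * hxy + x * hv - y * hu
    · rintro ⟨u, hu⟩
      refine ⟨⟨x * t - c 1 * u, ?_⟩, ⟨y * t + c 0 * u, ?_⟩⟩
      · linear_combination (-(m 0)) * hxy + x * ht' - c 1 * hu
      · linear_combination (-(m 1)) * hxy + y * ht' + c 0 * hu
  · rw [mul_eq_zero]
    right
    rw [Nat.cast_eq_zero, Finset.card_eq_zero, Finset.filter_eq_empty_iff]
    rintro s - ⟨⟨u, hu⟩, ⟨v, hv⟩⟩
    rw [Nat.cast_mul] at hu hv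
    refine h ⟨Int.natCast_dvd_natCast.1 (Int.dvd_coe_gcd ⟨s * c 1 + l * u, ?_⟩
      ⟨l * v - s * c 0, ?_⟩), ⟨c 0 * u + c 1 * v, ?_⟩⟩
    · linear_combination hu + s * hc1
    · linear_combination hv - s * hc0
    · rw [intDot]
      push_cast
      linear_combination r 0 * hu + r 1 * hv + (G : ℤ) * l * u * hc0 + (G : ℤ) * l * v * hc1

/-- The sum over all reduced fractions with denominator dividing `G l`, where `G = gcd(r)`. -/
lemma sum_divisors_reducedResidues_dvd_eq {r : Fin 2 → ℤ} (hr : 0 < vecGcd r) (n : Fin 2 → ℤ) {l : ℕ}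
    (hl : 1 ≤ l) :
    ∑ q ∈ (vecGcd r * l).divisors,
        ∑ a ∈ (reducedResidues q).filter (fun a => (q : ℤ) ∣ dotPerp r a), e (intDot a n / q) =
      if vecGcd r ∣ vecGcd n ∧ ((vecGcd r ^ 2 * l : ℕ) : ℤ) ∣ intDot r n then
        ((vecGcd r * l : ℕ) : ℂ) * vecGcd r else 0 := by
  have hL := Nat.mul_pos hr hl
  rw [← sum_residues_dvd_eq hr n hl, Finset.sum_filter, sum_residues_eq _ hL]
  refine Finset.sum_congr rfl fun q hq => ?_
  rw [Finset.sum_filter]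
  refine Finset.sum_congr rfl fun a _ => ?_
  obtain ⟨d, hd⟩ := Nat.dvd_of_mem_divisors hq
  have hq0 := Nat.pos_of_mem_divisors hq
  have hd0 : 0 < d := Nat.pos_of_ne_zero fun h => by rw [h] at hd; omega
  rw [hd, Nat.mul_div_cancel_left _ hq0]
  have h1 : dotPerp r ((d : ℤ) • a) = dotPerp r a * d := by
    simp only [dotPerp, Pi.smul_apply, smul_eq_mul]
    ring
  have h2 : intDot ((d : ℤ) • a) n = intDot a n * d := by
    simp only [intDot, Pi.smul_apply, smul_eq_mul]
    ring
  have hd1 : (d : ℝ) ≠ 0 := by positivity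
  rw [h1, h2]
  refine if_congr ?_ ?_ rfl
  · rw [Nat.cast_mul, mul_dvd_mul_iff_right (by exact_mod_cast hd0.ne')]
  · push_cast
    rw [mul_div_mul_right _ _ hd1]

/-- The sum over all reduced fractions with denominator dividing `l`. -/
lemma sum_divisors_reducedResidues_eq (n : Fin 2 → ℤ) {l : ℕ} (hl : 1 ≤ l) :
    ∑ q ∈ l.divisors, ∑ a ∈ reducedResidues q, e (intDot a n / q) =
      if l ∣ vecGcd n then (l : ℂ) ^ 2 else 0 := by
  have h1 : ∑ b ∈ residues l, e (intDot b n / l) = if l ∣ vecGcd n then (l : ℂ) ^ 2 else 0 := by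
    have h2 := sum_residues_dvd hl 0 n
    simp only [dotPerp, Pi.zero_apply, zero_mul, sub_zero, dvd_zero, Finset.filter_true, mul_zero,
      add_zero] at h2
    rw [h2]
    have h3 : ((l : ℤ) ∣ n 0 ∧ (l : ℤ) ∣ n 1) ↔ l ∣ vecGcd n := by
      rw [vecGcd, ← Int.natCast_dvd_natCast, Int.dvd_coe_gcd_iff]
    simp only [h3]
    by_cases h : l ∣ vecGcd n
    · simp only [h, Finset.filter_true, if_true, Int.card_Ico, sub_zero, Int.toNat_natCast, sq]
    · simp only [h, Finset.filter_false, if_false, Finset.card_empty, Nat.cast_zero, mul_zero]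
  rw [← h1, sum_residues_eq _ hl]
  refine Finset.sum_congr rfl fun q hq => Finset.sum_congr rfl fun a _ => ?_
  obtain ⟨d, rfl⟩ := Nat.dvd_of_mem_divisors hq
  have hq0 := Nat.pos_of_mem_divisors hq
  have hd0 : 0 < d := Nat.pos_of_ne_zero fun h => by simp [h] at hl
  rw [Nat.mul_div_cancel_left _ hq0]
  have h2 : intDot ((d : ℤ) • a) n = intDot a n * d := by
    simp only [intDot, Pi.smul_apply, smul_eq_mul]
    ring
  have hd1 : (d : ℝ) ≠ 0 := by positivity
  rw [h2]
  push_cast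
  rw [mul_div_mul_right _ _ hd1]

/-! ### Evaluation of the delta sum in physical space -/

section Evaluation

variable {ω ω₀ : ℝ → ℝ}

lemma normConst_pos (hω : IsWeight ω) : 0 < normConst ω := by
  rw [normConst, inv_pos]
  have hc : Continuous fun x : Plane => ω ‖x‖ := hω.continuous.comp continuous_norm
  have hs : HasCompactSupport fun x : Plane => ω ‖x‖ := by
    refine HasCompactSupport.intro (isCompact_closedBall (0 : Plane) 1) fun x hx => ?_
    rw [mem_closedBall_zero_iff, not_le] at hx
    exact hω.apply_of_one_le hx.le
  obtain ⟨t, ht⟩ : ∃ t, ω t ≠ 0 := by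
    by_contra! h
    have := hω.integral_eq_one
    simp [h] at this
  have ht0 : 0 ≤ t := by
    have := (hω.support ht).1
    linarith
  refine hc.integral_pos_of_hasCompactSupport_nonneg_nonzero hs (fun x => hω.nonneg _)
    (x := EuclideanSpace.single (0 : Fin 2) t) ?_
  rwa [PiLp.norm_single, Real.norm_eq_abs, abs_of_nonneg ht0]

/-- On the support of the cut-off the weights with `L ≥ Q` vanish. -/
lemma weight_mul_cutoff_eq_zero (hω : IsWeight ω) (hω₀ : IsCutoff ω₀) {Q : ℝ} (hQ : 1 ≤ Q) {x L : ℝ}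
    (hx : 0 ≤ x) (hL : Q ≤ L) :
    ω (x / (L * Q ^ (1 / 2 : ℝ))) * ω₀ (x / Q ^ (3 / 2 : ℝ)) = 0 := by
  obtain ⟨hX1, hXX, hX3⟩ := sqrt_pow_facts hQ
  rw [hX3]
  set X := Q ^ (1 / 2 : ℝ)
  have hQX : 0 < Q * X := by positivity
  rcases le_total (1 / 2) (x / (Q * X)) with h | h
  · rw [hω₀.apply_of_half_le (by rwa [abs_of_nonneg (by positivity)]), mul_zero]
  · rw [hω.apply_of_le_half, zero_mul]
    refine le_trans ?_ h
    gcongr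

/-- The contribution of `p₁` to the delta sum. -/
lemma sum_density1_eq (hω : IsWeight ω) (hω₀ : IsCutoff ω₀) {Q : ℝ} (hQ : 1 ≤ Q) (n : Fin 2 → ℤ) :
    ∑ q ∈ Finset.Icc 1 ⌊Q⌋₊, (∑ a ∈ reducedResidues q, e (intDot a n / q)) *
        density1 ω₀ ω Q q (toPlane n) =
      ((-(2 * normConst ω / Q) * ω₀ (‖toPlane n‖ / Q ^ (3 / 2 : ℝ)) *
        ∑ l ∈ (Finset.Icc 1 ⌊Q⌋₊).filter (· ∣ vecGcd n),
          ω (‖toPlane n‖ / (l * Q ^ (1 / 2 : ℝ))) : ℝ) : ℂ) := by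
  set M := ⌊Q⌋₊ with hM
  set x := ‖toPlane n‖ with hx
  have hx0 : 0 ≤ x := norm_nonneg _
  have hMQ : Q < M + 1 := Nat.lt_floor_add_one Q
  set F : ℕ → ℂ := fun L => ((-(2 * normConst ω / Q) * (1 / (L : ℝ) ^ 2 *
    (ω (x / (L * Q ^ (1 / 2 : ℝ))) * ω₀ (x / Q ^ (3 / 2 : ℝ)))) : ℝ) : ℂ) with hF
  have hF0 : ∀ L, M < L → F L = 0 := fun L hL => by
    have : (M : ℝ) + 1 ≤ L := by exact_mod_cast hL
    simp only [hF]
    rw [weight_mul_cutoff_eq_zero hω hω₀ hQ hx0 (by linarith)]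
    simp
  have h1 : ∀ q ∈ Finset.Icc 1 M, (∑ a ∈ reducedResidues q, e (intDot a n / q)) *
      density1 ω₀ ω Q q (toPlane n) = (∑ a ∈ reducedResidues q, e (intDot a n / q)) *
        ∑ j ∈ Finset.Icc 1 M, F (Nat.lcm 1 q * j) := by
    intro q hq
    have hq1 := (Finset.mem_Icc.1 hq).1
    have hq' : (1 : ℝ) ≤ q := by exact_mod_cast hq1
    congr 1
    rw [density1, cutoff_mul_tsum_eq hω hω₀ hQ hq1 (J := M) (by nlinarith), ← Complex.ofReal_mul,
      Finset.mul_sum, Complex.ofReal_sum]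
    refine Finset.sum_congr rfl fun j _ => ?_
    simp only [hF, Nat.lcm_one_left]
    congr 1
    push_cast
    rw [mul_pow, mul_comm (j : ℝ) q]
  rw [Finset.sum_congr rfl h1, sum_mul_sum_lcm_eq le_rfl hF0, Finset.sum_filter, Finset.mul_sum,
    Complex.ofReal_sum]
  refine Finset.sum_congr rfl fun l hl => ?_
  have hl1 := (Finset.mem_Icc.1 hl).1
  have hl0 : (l : ℝ) ≠ 0 := by positivity
  rw [one_mul, sum_divisors_reducedResidues_eq n hl1]
  split_ifs
  · simp only [hF]
    rw [← Complex.ofReal_natCast, ← Complex.ofReal_pow, ← Complex.ofReal_mul]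
    congr 1
    field_simp
  · simp

/-- For given `r` and `n` the density of `p₂` only depends on `k q`, and its series stops at `Q`. -/
lemma density2_eq_sum (hω : IsWeight ω) (hω₀ : IsCutoff ω₀) {Q : ℝ} (hQ : 1 ≤ Q) {r : Fin 2 → ℤ}
    (hr : ‖toPlane r‖ ≤ Q ^ (1 / 2 : ℝ)) (n : Fin 2 → ℤ) {k q : ℕ} (hkq : 1 ≤ k * q) :
    density2 ω₀ ω Q r k q (toPlane n) = ∑ j ∈ Finset.Icc 1 ⌊Q⌋₊,
      ((normConst ω / Q ^ 3 * (ω₀ (‖toPlane n‖ / Q ^ (3 / 2 : ℝ)) *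
        (1 / ((k * q * j : ℕ) / Q) * (ω ((k * q * j : ℕ) / Q) -
          ω (|(intDot r n : ℝ) / Q ^ 2| / ((k * q * j : ℕ) / Q))))) : ℝ) : ℂ) := by
  have hQ0 : 0 < Q := by linarith
  have hkq' : (1 : ℝ) ≤ k * q := by exact_mod_cast hkq
  have hMQ : Q < ⌊Q⌋₊ + 1 := Nat.lt_floor_add_one Q
  rw [density2, inner_toPlane, ← Complex.ofReal_mul, ← Complex.ofReal_sum]
  congr 1
  rcases le_or_gt (1 / 2) (‖toPlane n‖ / Q ^ (3 / 2 : ℝ)) with h | h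
  · rw [hω₀.apply_of_half_le (by rwa [abs_of_nonneg (by positivity)])]
    simp
  · have h1 : 1 ≤ (k : ℝ) * q / Q * (⌊Q⌋₊ + 1) := by
      rw [div_mul_eq_mul_div, one_le_div hQ0]
      nlinarith
    have h2 : 2 * |(intDot r n : ℝ) / Q ^ 2| ≤ 1 := by
      obtain ⟨hX1, hXX, hX3⟩ := sqrt_pow_facts hQ
      rw [hX3, div_lt_iff₀ (by positivity)] at h
      have h3 := abs_real_inner_le_norm (toPlane r) (toPlane n)
      rw [inner_toPlane] at h3
      rw [abs_div, abs_of_pos (by positivity : 0 < Q ^ 2), ← mul_div_assoc, div_le_one (by positivity)]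
      have h4 : ‖toPlane r‖ * ‖toPlane n‖ ≤
          Q ^ (1 / 2 : ℝ) * (1 / 2 * (Q * Q ^ (1 / 2 : ℝ))) := by gcongr
      nlinarith
    rw [h_eq_sum hω (J := ⌊Q⌋₊) (by positivity) h1 (h2.trans h1), Finset.mul_sum, Finset.mul_sum]
    refine Finset.sum_congr rfl fun j _ => ?_
    push_cast
    rw [show (k : ℝ) * q / Q * j = k * q * j / Q by ring]

/-- The contribution of `p₂` for one vector `r` to the delta sum: the inner sum over the divisors of
`r · n / gcd(r)²` vanishes unless `r · n = 0`. -/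
lemma sum_density2_eq (hω : IsWeight ω) (hω₀ : IsCutoff ω₀) {Q : ℝ} (hQ : 1 ≤ Q) {r : Fin 2 → ℤ}
    (hr : ‖toPlane r‖ ≤ Q ^ (1 / 2 : ℝ)) (hr0 : 0 < vecGcd r) (n : Fin 2 → ℤ) :
    ∑ q ∈ Finset.Icc 1 ⌊Q⌋₊,
        (∑ a ∈ (reducedResidues q).filter (fun a => (q : ℤ) ∣ dotPerp r a), e (intDot a n / q)) *
          density2 ω₀ ω Q r (vecGcd r / gcdWith r q) q (toPlane n) =
      if intDot r n = 0 ∧ vecGcd r ∣ vecGcd n then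
        ((normConst ω / Q ^ 2 * ω₀ (‖toPlane n‖ / Q ^ (3 / 2 : ℝ)) *
          (vecGcd r * ∑ l ∈ Finset.Icc 1 ⌊Q⌋₊, ω (vecGcd r / Q * l)) : ℝ) : ℂ) else 0 := by
  set M := ⌊Q⌋₊ with hM
  set G := vecGcd r with hG
  have hQ0 : 0 < Q := by linarith
  have hMQ : Q < M + 1 := Nat.lt_floor_add_one Q
  set x := ‖toPlane n‖ with hx
  set F : ℕ → ℂ := fun L => ((normConst ω / Q ^ 3 * (ω₀ (x / Q ^ (3 / 2 : ℝ)) *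
        (1 / (L / Q) * (ω (L / Q) - ω (|(intDot r n : ℝ) / Q ^ 2| / (L / Q))))) : ℝ) : ℂ) with hF
  have hF0 : ∀ L, M < L → F L = 0 := fun L hL => by
    have h1 : (M : ℝ) + 1 ≤ L := by exact_mod_cast hL
    simp only [hF]
    rw [Complex.ofReal_eq_zero]
    rcases le_or_gt (1 / 2) (x / Q ^ (3 / 2 : ℝ)) with h | h
    · rw [hω₀.apply_of_half_le (by rwa [abs_of_nonneg (by positivity)])]
      simp
    · have h2 : |(intDot r n : ℝ) / Q ^ 2| ≤ 1 / 2 := by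
        obtain ⟨hX1, hXX, hX3⟩ := sqrt_pow_facts hQ
        rw [hX3, div_lt_iff₀ (by positivity)] at h
        have h3 := abs_real_inner_le_norm (toPlane r) (toPlane n)
        rw [inner_toPlane] at h3
        rw [abs_div, abs_of_pos (by positivity : 0 < Q ^ 2), div_le_iff₀ (by positivity)]
        have h4 : ‖toPlane r‖ * ‖toPlane n‖ ≤
            Q ^ (1 / 2 : ℝ) * (1 / 2 * (Q * Q ^ (1 / 2 : ℝ))) := by gcongr
        nlinarith
      have h3 : 1 ≤ (L : ℝ) / Q := by rw [one_le_div hQ0]; linarith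
      rw [hω.apply_of_one_le h3, hω.apply_of_le_half]
      · simp
      · rw [div_le_iff₀ (by linarith)]
        linarith
  have h1 : ∀ q ∈ Finset.Icc 1 M,
      (∑ a ∈ (reducedResidues q).filter (fun a => (q : ℤ) ∣ dotPerp r a), e (intDot a n / q)) *
          density2 ω₀ ω Q r (G / gcdWith r q) q (toPlane n) =
      (∑ a ∈ (reducedResidues q).filter (fun a => (q : ℤ) ∣ dotPerp r a), e (intDot a n / q)) *
        ∑ j ∈ Finset.Icc 1 M, F (Nat.lcm G q * j) := by
    intro q hq
    have hq1 := (Finset.mem_Icc.1 hq).1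
    -- `k q` is the least common multiple of `gcd(r)` and `q`
    have h2 : G / gcdWith r q * q = Nat.lcm G q := by
      rw [gcdWith, Nat.lcm, Nat.div_mul_right_comm (Nat.gcd_dvd_left _ _)]
    rw [density2_eq_sum hω hω₀ hQ hr n (by rw [h2]; exact Nat.lcm_pos hr0 hq1), h2]
  rw [Finset.sum_congr rfl h1, sum_mul_sum_lcm_eq hr0 hF0]
  have h2 : ∀ l ∈ Finset.Icc 1 M, F (G * l) * ∑ q ∈ (G * l).divisors,
      ∑ a ∈ (reducedResidues q).filter (fun a => (q : ℤ) ∣ dotPerp r a), e (intDot a n / q) =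
      if G ∣ vecGcd n ∧ ((G ^ 2 * l : ℕ) : ℤ) ∣ intDot r n then
        F (G * l) * (((G * l : ℕ) : ℂ) * G) else 0 := by
    intro l hl
    rw [sum_divisors_reducedResidues_dvd_eq hr0 n (Finset.mem_Icc.1 hl).1, mul_ite, mul_zero]
  rw [Finset.sum_congr rfl h2]
  by_cases hGn : G ∣ vecGcd n
  swap
  · simp [hGn]
  have hG0 : (0 : ℝ) < G := by exact_mod_cast hr0
  have hG1 : (0 : ℤ) < G := by exact_mod_cast hr0
  -- `r · n` is divisible by `gcd(r)²`
  obtain ⟨m, hm⟩ : ∃ m : ℤ, intDot r n = G ^ 2 * m := by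
    obtain ⟨c, hc⟩ := exists_eq_smul_of_dvd (d := (G : ℤ)) (b := r) fun i => vecGcd_dvd r i
    obtain ⟨c', hc'⟩ := exists_eq_smul_of_dvd (d := (G : ℤ)) (b := n) fun i =>
      (Int.natCast_dvd_natCast.2 hGn).trans (vecGcd_dvd n i)
    have e1 : ∀ i, r i = G * c i := congrFun hc
    have e2 : ∀ i, n i = G * c' i := congrFun hc'
    refine ⟨c 0 * c' 0 + c 1 * c' 1, ?_⟩
    rw [intDot, e1, e1, e2, e2]
    ring
  have hdvd : ∀ l : ℕ, ((G ^ 2 * l : ℕ) : ℤ) ∣ intDot r n ↔ l ∣ m.natAbs := fun l => by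
    rw [hm]
    push_cast
    rw [mul_dvd_mul_iff_left (pow_ne_zero 2 hG1.ne'), Int.natCast_dvd]
  -- the term for `L = G l` in a form symmetric in `l ↔ m / l`, with `Y = Q / G`
  have hT : ∀ l : ℕ, 1 ≤ l → F (G * l) * (((G * l : ℕ) : ℂ) * G) =
      ((normConst ω / Q ^ 2 * ω₀ (x / Q ^ (3 / 2 : ℝ)) * G *
        (ω (l / (Q / G)) - ω (m.natAbs / (l * (Q / G)))) : ℝ) : ℂ) := by
    intro l hl
    have hl0 : (0 : ℝ) < l := by exact_mod_cast hl
    simp only [hF]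
    rw [← Complex.ofReal_natCast, ← Complex.ofReal_natCast, ← Complex.ofReal_mul,
      ← Complex.ofReal_mul]
    congr 1
    have e1 : ((G * l : ℕ) : ℝ) / Q = l / (Q / G) := by
      push_cast
      field_simp
    have e2 : |(intDot r n : ℝ) / Q ^ 2| / (((G * l : ℕ) : ℝ) / Q) = m.natAbs / (l * (Q / G)) := by
      rw [hm, Nat.cast_natAbs, abs_div, abs_of_pos (by positivity : 0 < Q ^ 2)]
      push_cast
      rw [abs_mul, abs_of_pos (by positivity : 0 < (G : ℝ) ^ 2)]
      field_simp
    rw [e2, e1]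
    push_cast
    field_simp
  simp only [hGn, true_and, and_true, hdvd]
  by_cases hm0 : m = 0
  · rw [if_pos (by rw [hm, hm0, mul_zero])]
    simp only [hm0, Int.natAbs_zero, dvd_zero, if_true]
    rw [Finset.mul_sum, Finset.mul_sum, Complex.ofReal_sum]
    refine Finset.sum_congr rfl fun l hl => ?_
    rw [hT l (Finset.mem_Icc.1 hl).1, hm0]
    congr 1
    rw [Int.natAbs_zero, Nat.cast_zero, zero_div, hω.apply_of_le_half (x := 0) (by norm_num), sub_zero,
      show (l : ℝ) / (Q / G) = G / Q * l by field_simp]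
    ring
  · rw [if_neg (by rw [hm]; exact mul_ne_zero (pow_ne_zero 2 hG1.ne') hm0), ← Finset.sum_filter]
    have h3 : ∑ l ∈ (Finset.Icc 1 M).filter (· ∣ m.natAbs), F (G * l) * (((G * l : ℕ) : ℂ) * G) =
        ∑ l ∈ m.natAbs.divisors, F (G * l) * (((G * l : ℕ) : ℂ) * G) := by
      refine Finset.sum_subset ?_ ?_
      · intro l hl
        rw [Finset.mem_filter] at hl
        exact Nat.mem_divisors.2 ⟨hl.2, by omega⟩
      · intro l hl hl'
        rw [Finset.mem_filter, Finset.mem_Icc] at hl'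
        have h4 := Nat.pos_of_mem_divisors hl
        have h5 := Nat.dvd_of_mem_divisors hl
        rw [hF0 _ (lt_of_lt_of_le (a := M) (b := l) (by
          by_contra h6
          exact hl' ⟨⟨h4, by omega⟩, h5⟩) (Nat.le_mul_of_pos_left _ hr0)), zero_mul]
    rw [h3, Finset.sum_congr rfl fun l hl => hT l (Nat.pos_of_mem_divisors hl), ← Complex.ofReal_sum,
      ← Finset.mul_sum, sum_divisors_sub_eq_zero, mul_zero, Complex.ofReal_zero]

end Evaluation

/-! ### The delta symbol -/

section DeltaSum

variable {ω ω₀ : ℝ → ℝ}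

/-- The sum that represents the delta symbol, with the integrals against `p₂` grouped by `r`. -/
noncomputable def deltaSum (ω₀ ω : ℝ → ℝ) (Q : ℝ) (n : Fin 2 → ℤ) : ℂ :=
  (∑ q ∈ Finset.Icc 1 ⌊Q⌋₊, ∑ a ∈ reducedResidues q,
      ∫ w : Plane, p1 ω₀ ω Q q w * arcChar a q w n) +
    ∑ r ∈ box ⌊Q⌋₊, vecWeight ω Q r * ∑ q ∈ Finset.Icc 1 ⌊Q⌋₊,
      ∑ a ∈ (reducedResidues q).filter (fun a => (q : ℤ) ∣ dotPerp r a),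
        ∫ w : Plane, p2 ω₀ ω Q r (vecGcd r / gcdWith r q) q w * arcChar a q w n

/-- In physical space only the vectors `r` orthogonal to `n` contribute to the sum. -/
lemma deltaSum_eq (hω : IsWeight ω) (hω₀ : IsCutoff ω₀) {Q : ℝ} (hQ : 1 ≤ Q) (n : Fin 2 → ℤ) :
    deltaSum ω₀ ω Q n =
      ((-(2 * normConst ω / Q) * ω₀ (‖toPlane n‖ / Q ^ (3 / 2 : ℝ)) *
        ∑ l ∈ (Finset.Icc 1 ⌊Q⌋₊).filter (· ∣ vecGcd n),
          ω (‖toPlane n‖ / (l * Q ^ (1 / 2 : ℝ))) : ℝ) : ℂ) +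
      ∑ r ∈ (box ⌊Q⌋₊).filter (fun r => intDot r n = 0 ∧ vecGcd r ∣ vecGcd n), vecWeight ω Q r *
        ((normConst ω / Q ^ 2 * ω₀ (‖toPlane n‖ / Q ^ (3 / 2 : ℝ)) *
          (vecGcd r * ∑ l ∈ Finset.Icc 1 ⌊Q⌋₊, ω (vecGcd r / Q * l)) : ℝ) : ℂ) := by
  rw [deltaSum, ← sum_density1_eq hω hω₀ hQ n, Finset.sum_filter]
  congr 1
  · refine Finset.sum_congr rfl fun q hq => ?_
    rw [Finset.sum_mul]
    exact Finset.sum_congr rfl fun a _ =>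
      integral_p1_mul_arcChar hω hω₀ hQ (Finset.mem_Icc.1 hq).1 a n
  · refine Finset.sum_congr rfl fun r _ => ?_
    by_cases hr : vecWeight ω Q r = 0
    · simp [hr]
    · have hr0 := vecGcd_pos_of_vecWeight hω hQ hr
      rw [← mul_zero (vecWeight ω Q r), ← mul_ite,
        ← sum_density2_eq hω hω₀ hQ (vecWeight_bounds hω hQ hr).2.le hr0 n]
      congr 1
      refine Finset.sum_congr rfl fun q hq => ?_
      rw [Finset.sum_mul]
      exact Finset.sum_congr rfl fun a _ =>
        integral_p2_mul_arcChar hω hω₀ hQ r (div_gcdWith_pos hr0 q) (Finset.mem_Icc.1 hq).1 a n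

lemma vecGcd_smul (t : ℤ) (v : Fin 2 → ℤ) : vecGcd (t • v) = t.natAbs * vecGcd v := by
  rw [vecGcd, Pi.smul_apply, Pi.smul_apply, smul_eq_mul, smul_eq_mul, Int.gcd_mul_left, vecGcd]

lemma toPlane_smul (t : ℤ) (v : Fin 2 → ℤ) : toPlane (t • v) = (t : ℝ) • toPlane v := by
  ext i
  simp [toPlane_apply]

/-- The vectors `r ≠ 0` orthogonal to `n ≠ 0` with `gcd(r) ∣ gcd(n)` are `± n^⊥ / l`, where
`l ∣ gcd(n)`. -/
lemma sum_vecWeight_orthogonal (hω : IsWeight ω) {Q : ℝ} (hQ : 1 ≤ Q) {n : Fin 2 → ℤ} (hn : n ≠ 0) :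
    ∑ r ∈ (box ⌊Q⌋₊).filter (fun r => intDot r n = 0 ∧ vecGcd r ∣ vecGcd n), vecWeight ω Q r =
      ((2 * ∑ l ∈ (vecGcd n).divisors, ω (‖toPlane n‖ / (l * Q ^ (1 / 2 : ℝ))) : ℝ) : ℂ) := by
  set g := vecGcd n with hg
  have hg0 : 0 < g := by
    refine Nat.pos_of_ne_zero fun h => hn ?_
    rw [hg, vecGcd, Int.gcd_eq_zero_iff] at h
    ext i
    fin_cases i
    · exact h.1
    · exact h.2
  obtain ⟨ν, hν⟩ := exists_eq_smul_of_dvd (d := (g : ℤ)) (b := n) fun i => vecGcd_dvd n i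
  have hν1 : vecGcd ν = 1 := by
    have h1 : g = g * vecGcd ν := by
      conv_lhs => rw [hg, hν, vecGcd_smul, Int.natAbs_natCast]
    exact Nat.eq_of_mul_eq_mul_left hg0 (by rw [mul_one]; exact h1.symm)
  obtain ⟨x, y, z, hxyz⟩ := exists_bezout (a := ν) (q := 0) (by rw [gcdWith, hν1]; rfl)
  have hxy : x * ν 0 + y * ν 1 = 1 := by simpa using hxyz
  -- the primitive vector orthogonal to `n`
  set μ : Fin 2 → ℤ := ![ν 1, -ν 0] with hμ
  have hμ0 : μ 0 = ν 1 := rfl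
  have hμ1 : μ 1 = -ν 0 := rfl
  have hμg : vecGcd μ = 1 := by
    rw [← hν1, vecGcd, vecGcd, hμ0, hμ1, Int.gcd_neg, Int.gcd_comm]
  have hn0 : n 0 = g * ν 0 := congrFun hν 0
  have hn1 : n 1 = g * ν 1 := congrFun hν 1
  have hg1 : (0 : ℤ) < g := by exact_mod_cast hg0
  have hnorm : ∀ t : ℤ, ‖toPlane (t • μ)‖ = |(t : ℝ)| * ‖toPlane ν‖ := fun t => by
    rw [toPlane_smul, norm_smul, Real.norm_eq_abs]
    congr 1
    rw [← sq_eq_sq₀ (norm_nonneg _) (norm_nonneg _), norm_sq_plane, norm_sq_plane]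
    simp only [toPlane_apply, hμ0, hμ1]
    push_cast
    ring
  have hnn : ‖toPlane n‖ = g * ‖toPlane ν‖ := by
    rw [hν, toPlane_smul, norm_smul, Real.norm_eq_abs]
    simp
  have h1 : ∑ r ∈ (box ⌊Q⌋₊).filter (fun r => intDot r n = 0 ∧ vecGcd r ∣ g), vecWeight ω Q r =
      ∑ t ∈ (Finset.Icc (-(g : ℤ)) g).filter (fun t : ℤ => t ≠ 0 ∧ t ∣ (g : ℤ)), vecWeight ω Q (t • μ) := by
    symm
    refine Finset.sum_bij_ne_zero (fun t _ _ => t • μ) ?_ ?_ ?_ fun _ _ _ => rfl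
    · intro t ht h
      rw [Finset.mem_filter] at ht ⊢
      refine ⟨?_, ?_, ?_⟩
      · by_contra h2
        exact h (vecWeight_eq_zero_of_notMem hω hQ h2)
      · rw [intDot, Pi.smul_apply, Pi.smul_apply, smul_eq_mul, smul_eq_mul, hμ0, hμ1, hn0, hn1]
        ring
      · rw [vecGcd_smul, hμg, mul_one]
        exact Int.natAbs_dvd_natAbs.2 ht.2.2
    · intro t _ _ t' _ _ h
      have e0 : t * ν 1 = t' * ν 1 := congrFun h 0
      have e1 : t * -ν 0 = t' * -ν 0 := congrFun h 1
      linear_combination (t' - t) * hxy + y * e0 - x * e1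
    · intro r hr h
      rw [Finset.mem_filter] at hr
      obtain ⟨_, h2, h3⟩ := hr
      have h4 : r 0 * ν 0 + r 1 * ν 1 = 0 := by
        rw [intDot, hn0, hn1] at h2
        have : (g : ℤ) * (r 0 * ν 0 + r 1 * ν 1) = 0 := by linear_combination h2
        exact (mul_eq_zero.1 this).resolve_left hg1.ne'
      have h5 : r = (y * r 0 - x * r 1) • μ := by
        ext i
        fin_cases i
        · change r 0 = (y * r 0 - x * r 1) * ν 1
          linear_combination (-(r 0)) * hxy + x * h4
        · change r 1 = (y * r 0 - x * r 1) * -ν 0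
          linear_combination (-(r 1)) * hxy + y * h4
      set t := y * r 0 - x * r 1 with ht
      have h6 : vecGcd r = t.natAbs := by rw [h5, vecGcd_smul, hμg, mul_one]
      have h7 := vecGcd_pos_of_vecWeight hω hQ h
      rw [h6] at h3 h7
      have h8 := Nat.le_of_dvd hg0 h3
      refine ⟨t, ?_, by rwa [← h5], h5.symm⟩
      rw [Finset.mem_filter, Finset.mem_Icc]
      exact ⟨by omega, by omega, Int.natAbs_dvd_natAbs.1 (by simpa using h3)⟩
  -- the vectors `± j μ` have norm `|n| / (g / j)`
  have h2 : ∀ j ∈ Finset.Icc 1 g, ((if (j : ℤ) ≠ 0 ∧ (j : ℤ) ∣ g then vecWeight ω Q ((j : ℤ) • μ) else 0) +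
      if (-j : ℤ) ≠ 0 ∧ (-j : ℤ) ∣ g then vecWeight ω Q ((-j : ℤ) • μ) else 0) =
      if j ∣ g then ((2 * ω (‖toPlane n‖ / ((g / j : ℕ) * Q ^ (1 / 2 : ℝ))) : ℝ) : ℂ) else 0 := by
    intro j hj
    have hj1 := (Finset.mem_Icc.1 hj).1
    have hj0 : (j : ℤ) ≠ 0 := by omega
    have hj2 : (j : ℝ) ≠ 0 := by positivity
    simp only [neg_dvd, ne_eq, neg_eq_zero, hj0, not_false_eq_true, true_and, Int.natCast_dvd_natCast]
    split_ifs with h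
    · rw [vecWeight, vecWeight, hnorm, hnorm, hnn, Nat.cast_div h hj2, ← Complex.ofReal_add]
      have h3 : (g : ℝ) ≠ 0 := by positivity
      rw [show (g : ℝ) * ‖toPlane ν‖ / (g / j * Q ^ (1 / 2 : ℝ)) =
        j * ‖toPlane ν‖ / Q ^ (1 / 2 : ℝ) by field_simp]
      push_cast
      rw [abs_neg, Nat.abs_cast]
      ring
    · simp
  rw [h1, Finset.sum_filter, sum_Icc_int_eq, Finset.sum_congr rfl h2, ← Finset.sum_filter,
    ← Nat.sum_div_divisors g fun l => ω (‖toPlane n‖ / (l * Q ^ (1 / 2 : ℝ))), Finset.mul_sum,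
    Complex.ofReal_sum]
  simp only [ne_eq, not_true_eq_false, false_and, if_false, zero_add]
  refine Finset.sum_congr ?_ fun _ _ => rfl
  ext l
  rw [Finset.mem_filter, Finset.mem_Icc, Nat.mem_divisors]
  constructor
  · rintro ⟨_, h⟩
    exact ⟨h, hg0.ne'⟩
  · rintro ⟨h, _⟩
    exact ⟨⟨Nat.pos_of_dvd_of_pos h hg0, Nat.le_of_dvd hg0 h⟩, h⟩

/-- The number of integer points weighted by `ω(|r| / Q^{1/2})`. -/
lemma exists_sum_vecWeight_bound (hω : IsWeight ω) (hω₀ : IsCutoff ω₀) (N : ℕ) :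
    ∃ C : ℝ, 0 ≤ C ∧ ∀ Q : ℝ, 1 ≤ Q →
      ‖∑ r ∈ box ⌊Q⌋₊, vecWeight ω Q r - ((Q / normConst ω : ℝ) : ℂ)‖ ≤ C * (Q ^ N)⁻¹ := by
  obtain ⟨C, hC0, hC⟩ := exists_poisson_bound_plane (2 * N + 1) (by omega)
  obtain ⟨B, hB0, hB⟩ := exists_bump_bound hω hω₀ (2 * N + 1 + 1)
  refine ⟨C * B, by positivity, fun Q hQ => ?_⟩
  obtain ⟨hX1, hXX, hX3⟩ := sqrt_pow_facts hQ
  set X := Q ^ (1 / 2 : ℝ) with hX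
  have hX0 : 0 < X := by linarith
  have h1 := hC (bump ω₀ ω 0) B X⁻¹ 0 0 (contDiff_bump hω hω₀ 0)
    (fun y hy => bump_eq_zero hω 0 hy.le) (fun n hn y => hB 0 n hn y) (by positivity)
    (inv_le_one_of_one_le₀ hX1) (by simp)
  -- the weight is `bump` at `t = 0`, as `ω₀(0) = 1`
  have h2 : ∀ y, bump ω₀ ω 0 y = (ω ‖y‖ : ℂ) := fun y => by
    simp [bump, hω₀.apply_zero]
  have h3 : ∀ m : Fin 2 → ℤ, bump ω₀ ω 0 (X⁻¹ • toPlane m + 0) * e (inner ℝ 0 (X⁻¹ • toPlane m + 0)) =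
      vecWeight ω Q m := fun m => by
    rw [h2, inner_zero_left, e_zero, mul_one, add_zero, norm_inv_smul_toPlane hQ, vecWeight]
  simp_rw [h3] at h1
  rw [tsum_eq_sum (s := box ⌊Q⌋₊) fun r hr => vecWeight_eq_zero_of_notMem hω hQ hr] at h1
  simp only [inner_zero_left, e_zero, mul_one, h2] at h1
  rw [show ∫ y : Plane, (ω ‖y‖ : ℂ) = ((∫ y : Plane, ω ‖y‖ : ℝ) : ℂ) from integral_ofReal] at h1
  have h4 : (((X⁻¹ ^ 2)⁻¹ : ℝ) : ℂ) * ((∫ y : Plane, ω ‖y‖ : ℝ) : ℂ) = ((Q / normConst ω : ℝ) : ℂ) := by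
    rw [← Complex.ofReal_mul, normConst, inv_pow, inv_inv, sq, hXX, div_inv_eq_mul]
  have h5 : X⁻¹ ^ (2 * N + 1) / X⁻¹ = (Q ^ N)⁻¹ := by
    rw [pow_succ, mul_div_assoc, div_self (by positivity), mul_one, inv_pow, pow_mul, sq, hXX]
  rw [← h4, ← h5]
  convert h1 using 3

/-- A Riemann sum of `ω` of step `G / Q ≤ Q^{-1/2}`. -/
lemma exists_gcd_mul_sum_bound (hω : IsWeight ω) (N : ℕ) :
    ∃ C : ℝ, 0 ≤ C ∧ ∀ (Q : ℝ) (G : ℕ), 1 ≤ Q → 1 ≤ G → (G : ℝ) ≤ Q ^ (1 / 2 : ℝ) →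
      |G * (∑ l ∈ Finset.Icc 1 ⌊Q⌋₊, ω (G / Q * l)) - Q| ≤ C * (Q ^ N)⁻¹ := by
  obtain ⟨C, hC0, hC⟩ := exists_sum_multiples_bound (2 * N + 1) (by omega) hω.smooth
    (fun x hx => hω.apply_of_le_half (by linarith)) (fun x hx => hω.apply_of_one_le hx)
  refine ⟨C, hC0, fun Q G hQ hG hGX => ?_⟩
  obtain ⟨hX1, hXX, hX3⟩ := sqrt_pow_facts hQ
  set X := Q ^ (1 / 2 : ℝ) with hX
  have hX0 : 0 < X := by linarith
  have hQ0 : 0 < Q := by linarith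
  have hG1 : (1 : ℝ) ≤ G := by exact_mod_cast hG
  have hM : Q < ⌊Q⌋₊ + 1 := Nat.lt_floor_add_one Q
  have h1 := hC (G / Q) ⌊Q⌋₊ (by positivity) (by
    rw [div_mul_eq_mul_div, one_le_div hQ0]
    nlinarith)
  rw [hω.integral_eq_one, one_div_div] at h1
  have h2 : (G : ℝ) / Q ≤ X⁻¹ := by
    rw [div_le_iff₀ hQ0, ← hXX]
    field_simp
    exact hGX
  calc |G * (∑ l ∈ Finset.Icc 1 ⌊Q⌋₊, ω (G / Q * l)) - Q|
      = G * |(∑ l ∈ Finset.Icc 1 ⌊Q⌋₊, ω (G / Q * l)) - Q / G| := by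
        rw [← abs_of_pos (by linarith : (0 : ℝ) < G), ← abs_mul, abs_of_pos (by linarith : (0 : ℝ) < G)]
        congr 1
        field_simp
    _ ≤ X * (C * X⁻¹ ^ (2 * N + 1)) := by
        refine mul_le_mul hGX (h1.trans ?_) (abs_nonneg _) hX0.le
        gcongr
    _ = C * (Q ^ N)⁻¹ := by
        rw [pow_succ, inv_pow, pow_mul, sq, hXX]
        field_simp

/-- The main terms of `p₁` and `p₂` cancel for `n ≠ 0`, and for `n = 0` they give `1`. -/
lemma exists_delta_sub_main_bound (hω : IsWeight ω) (hω₀ : IsCutoff ω₀) (N : ℕ) :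
    ∃ C : ℝ, 0 ≤ C ∧ ∀ Q : ℝ, 1 ≤ Q → ∀ n : Fin 2 → ℤ,
      ‖delta n - (((-(2 * normConst ω / Q) * ω₀ (‖toPlane n‖ / Q ^ (3 / 2 : ℝ)) *
        ∑ l ∈ (Finset.Icc 1 ⌊Q⌋₊).filter (· ∣ vecGcd n),
          ω (‖toPlane n‖ / (l * Q ^ (1 / 2 : ℝ))) : ℝ) : ℂ) +
      ((normConst ω / Q * ω₀ (‖toPlane n‖ / Q ^ (3 / 2 : ℝ)) : ℝ) : ℂ) *
        ∑ r ∈ (box ⌊Q⌋₊).filter (fun r => intDot r n = 0 ∧ vecGcd r ∣ vecGcd n), vecWeight ω Q r)‖ ≤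
      C * (Q ^ N)⁻¹ := by
  obtain ⟨C, hC0, hC⟩ := exists_sum_vecWeight_bound hω hω₀ N
  have hc := normConst_pos hω
  refine ⟨normConst ω * C, by positivity, fun Q hQ n => ?_⟩
  have hQ0 : 0 < Q := by linarith
  -- for `n = 0` the weights in the term from `p₁` vanish
  by_cases hn : n = 0
  · have h1 : ∀ r : Fin 2 → ℤ, intDot r 0 = 0 ∧ vecGcd r ∣ vecGcd 0 := fun r => by
      simp [intDot, vecGcd]
    have h2 : toPlane 0 = 0 := by ext i; simp [toPlane_apply]
    rw [hn]
    simp only [h1, h2, and_self, Finset.filter_true, norm_zero, zero_div,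
      hω.apply_of_le_half (x := 0) (by norm_num), Finset.sum_const_zero, mul_zero, hω₀.apply_zero,
      mul_one, delta, if_true, Complex.ofReal_zero, zero_add]
    have h3 : (1 : ℂ) - ((normConst ω / Q : ℝ) : ℂ) * ∑ r ∈ box ⌊Q⌋₊, vecWeight ω Q r =
        -(((normConst ω / Q : ℝ) : ℂ) *
          (∑ r ∈ box ⌊Q⌋₊, vecWeight ω Q r - ((Q / normConst ω : ℝ) : ℂ))) := by
      rw [mul_sub, ← Complex.ofReal_mul, show normConst ω / Q * (Q / normConst ω) = 1 by field_simp]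
      push_cast
      ring
    rw [h3, norm_neg, norm_mul, Complex.norm_real, Real.norm_eq_abs, abs_of_pos (by positivity),
      mul_assoc]
    refine mul_le_mul ?_ (hC Q hQ) (norm_nonneg _) hc.le
    exact div_le_self hc.le hQ
  · set x := ‖toPlane n‖ with hx
    -- the divisors `l > Q` do not contribute
    have h1 : ω₀ (x / Q ^ (3 / 2 : ℝ)) * ∑ l ∈ (vecGcd n).divisors, ω (x / (l * Q ^ (1 / 2 : ℝ))) =
        ω₀ (x / Q ^ (3 / 2 : ℝ)) * ∑ l ∈ (Finset.Icc 1 ⌊Q⌋₊).filter (· ∣ vecGcd n),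
          ω (x / (l * Q ^ (1 / 2 : ℝ))) := by
      rw [Finset.mul_sum, Finset.mul_sum]
      symm
      have h0 : vecGcd n ≠ 0 := fun h => hn (by
        rw [vecGcd, Int.gcd_eq_zero_iff] at h
        ext i
        fin_cases i
        · exact h.1
        · exact h.2)
      refine Finset.sum_subset ?_ ?_
      · intro l hl
        exact Nat.mem_divisors.2 ⟨(Finset.mem_filter.1 hl).2, h0⟩
      · intro l hl hl'
        rw [Finset.mem_filter, Finset.mem_Icc] at hl'
        have h2 := Nat.pos_of_mem_divisors hl
        have h3 : ⌊Q⌋₊ < l := by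
          by_contra h4
          exact hl' ⟨⟨h2, by omega⟩, Nat.dvd_of_mem_divisors hl⟩
        rw [mul_comm]
        exact weight_mul_cutoff_eq_zero hω hω₀ hQ (norm_nonneg _) ((Nat.floor_lt hQ0.le).1 h3).le
    rw [sum_vecWeight_orthogonal hω hQ hn, delta, if_neg hn, ← Complex.ofReal_mul,
      ← Complex.ofReal_add, mul_assoc _ (ω₀ _), ← h1,
      show -(2 * normConst ω / Q) * (ω₀ (x / Q ^ (3 / 2 : ℝ)) *
        ∑ l ∈ (vecGcd n).divisors, ω (x / (l * Q ^ (1 / 2 : ℝ)))) +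
        normConst ω / Q * ω₀ (x / Q ^ (3 / 2 : ℝ)) *
          (2 * ∑ l ∈ (vecGcd n).divisors, ω (x / (l * Q ^ (1 / 2 : ℝ)))) = 0 by ring,
      Complex.ofReal_zero, sub_zero, norm_zero]
    positivity

lemma inv_pow_ceil_le {Q : ℝ} (hQ : 1 ≤ Q) (N : ℝ) : (Q ^ ⌈N⌉₊)⁻¹ ≤ Q ^ (-N) :=
  inv_pow_le_rpow_neg hQ (Nat.le_ceil N)

lemma IsCutoff.exists_bound (hω₀ : IsCutoff ω₀) : ∃ B : ℝ, 0 ≤ B ∧ ∀ x, |ω₀ x| ≤ B := by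
  have hs : HasCompactSupport ω₀ := hasCompactSupport_of_abs (R := 1 / 2) fun x hx =>
    hω₀.apply_of_half_le hx.le
  obtain ⟨B, hB⟩ := hω₀.smooth.continuous.bounded_above_of_compact_support hs
  exact ⟨B, (norm_nonneg _).trans (hB 0), hB⟩

lemma card_box_le {Q : ℝ} (hQ : 1 ≤ Q) : ((box ⌊Q⌋₊).card : ℝ) ≤ 9 * Q ^ 2 := by
  have h := Nat.floor_le (show 0 ≤ Q by linarith)
  rw [card_box]
  push_cast
  have : (2 * (⌊Q⌋₊ : ℝ) + 1) ≤ 3 * Q := by linarith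
  calc (2 * (⌊Q⌋₊ : ℝ) + 1) ^ 2 ≤ (3 * Q) ^ 2 := by gcongr
    _ = 9 * Q ^ 2 := by ring

lemma norm_vecWeight_le (hω : IsWeight ω) {B : ℝ} (hB : ∀ x, ω x ≤ B) (Q : ℝ) (r : Fin 2 → ℤ) :
    ‖vecWeight ω Q r‖ ≤ B := by
  rw [vecWeight, Complex.norm_real, Real.norm_eq_abs, abs_of_nonneg (hω.nonneg _)]
  exact hB _

/-- A non-zero integral vector is at least as long as its content. -/
lemma vecGcd_le_norm {r : Fin 2 → ℤ} (hr : 0 < vecGcd r) : (vecGcd r : ℝ) ≤ ‖toPlane r‖ := by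
  obtain ⟨c, hc⟩ := exists_eq_smul_of_dvd (d := (vecGcd r : ℤ)) (b := r) fun i => vecGcd_dvd r i
  have h1 : ∃ i, c i ≠ 0 := by
    by_contra! h
    have : r = 0 := by rw [hc, show c = 0 from funext h, smul_zero]
    rw [this] at hr
    simp [vecGcd] at hr
  obtain ⟨i, hi⟩ := h1
  have h2 := abs_apply_le_norm (toPlane r) i
  have h3 : r i = vecGcd r * c i := congrFun hc i
  have h4 : (1 : ℝ) ≤ |(c i : ℝ)| := by exact_mod_cast Int.one_le_abs hi
  rw [toPlane_apply, h3] at h2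
  push_cast at h2
  rw [abs_mul, Nat.abs_cast] at h2
  have h5 : (0 : ℝ) ≤ vecGcd r := Nat.cast_nonneg _
  nlinarith

/-- The grouped sum represents the delta symbol. -/
theorem exists_delta_sub_deltaSum_bound (hω : IsWeight ω) (hω₀ : IsCutoff ω₀) (N : ℝ) :
    ∃ C : ℝ, 0 ≤ C ∧ ∀ Q : ℝ, 1 ≤ Q → ∀ n : Fin 2 → ℤ,
      ‖delta n - deltaSum ω₀ ω Q n‖ ≤ C * Q ^ (-N) := by
  obtain ⟨C₁, hC₁0, hC₁⟩ := exists_delta_sub_main_bound hω hω₀ ⌈N⌉₊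
  obtain ⟨C₂, hC₂0, hC₂⟩ := exists_gcd_mul_sum_bound hω ⌈N⌉₊
  obtain ⟨B, hB0, hB⟩ := hω.exists_bound
  obtain ⟨B₀, hB₀0, hB₀⟩ := hω₀.exists_bound
  have hc := normConst_pos hω
  refine ⟨C₁ + 9 * (B * (normConst ω * B₀ * C₂)), by positivity, fun Q hQ n => ?_⟩
  have hQ0 : 0 < Q := by linarith
  set y := ω₀ (‖toPlane n‖ / Q ^ (3 / 2 : ℝ)) with hy
  set P := (box ⌊Q⌋₊).filter (fun r => intDot r n = 0 ∧ vecGcd r ∣ vecGcd n) with hP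
  set Z : (Fin 2 → ℤ) → ℝ := fun r =>
    vecGcd r * (∑ l ∈ Finset.Icc 1 ⌊Q⌋₊, ω (vecGcd r / Q * l)) - Q with hZ
  have h1 : ∑ r ∈ P, vecWeight ω Q r * ((normConst ω / Q ^ 2 * y *
        (vecGcd r * ∑ l ∈ Finset.Icc 1 ⌊Q⌋₊, ω (vecGcd r / Q * l)) : ℝ) : ℂ) =
      ((normConst ω / Q * y : ℝ) : ℂ) * ∑ r ∈ P, vecWeight ω Q r +
        ∑ r ∈ P, vecWeight ω Q r * ((normConst ω / Q ^ 2 * y * Z r : ℝ) : ℂ) := by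
    rw [Finset.mul_sum, ← Finset.sum_add_distrib]
    refine Finset.sum_congr rfl fun r _ => ?_
    rw [mul_comm _ (vecWeight ω Q r), ← mul_add, ← Complex.ofReal_add]
    congr 2
    simp only [hZ]
    field_simp
    ring
  have h2 : ‖∑ r ∈ P, vecWeight ω Q r * ((normConst ω / Q ^ 2 * y * Z r : ℝ) : ℂ)‖ ≤
      9 * (B * (normConst ω * B₀ * C₂)) * (Q ^ ⌈N⌉₊)⁻¹ := by
    have h3 : ∀ r ∈ P, ‖vecWeight ω Q r * ((normConst ω / Q ^ 2 * y * Z r : ℝ) : ℂ)‖ ≤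
        B * (normConst ω / Q ^ 2 * B₀ * (C₂ * (Q ^ ⌈N⌉₊)⁻¹)) := by
      intro r _
      by_cases hr : vecWeight ω Q r = 0
      · rw [hr, zero_mul, norm_zero]
        positivity
      · have hr0 := vecGcd_pos_of_vecWeight hω hQ hr
        rw [norm_mul, Complex.norm_real, norm_mul, norm_mul, Real.norm_eq_abs, Real.norm_eq_abs,
          Real.norm_eq_abs, abs_of_pos (by positivity : 0 < normConst ω / Q ^ 2)]
        refine mul_le_mul (norm_vecWeight_le hω hB Q r) ?_ (by positivity) hB0
        refine mul_le_mul ?_ (hC₂ Q _ hQ hr0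
          ((vecGcd_le_norm hr0).trans (vecWeight_bounds hω hQ hr).2.le)) (abs_nonneg _) (by positivity)
        gcongr
        exact hB₀ _
    refine (norm_sum_le_of_le _ h3).trans ?_
    rw [Finset.sum_const, nsmul_eq_mul]
    have h4 : (P.card : ℝ) ≤ 9 * Q ^ 2 :=
      (Nat.cast_le.2 (Finset.card_filter_le _ _)).trans (card_box_le hQ)
    refine (mul_le_mul_of_nonneg_right h4 (by positivity)).trans (le_of_eq ?_)
    field_simp
  rw [deltaSum_eq hω hω₀ hQ, h1, ← add_assoc, ← sub_sub]
  calc _ ≤ C₁ * (Q ^ ⌈N⌉₊)⁻¹ + 9 * (B * (normConst ω * B₀ * C₂)) * (Q ^ ⌈N⌉₊)⁻¹ :=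
        (norm_sub_le _ _).trans (add_le_add (hC₁ Q hQ n) h2)
    _ = (C₁ + 9 * (B * (normConst ω * B₀ * C₂))) * (Q ^ ⌈N⌉₊)⁻¹ := by ring
    _ ≤ _ := by
        gcongr
        exact inv_pow_ceil_le hQ N

end DeltaSum

/-! ### The two arrangements of the delta sum -/

section Arrangements

variable {ω ω₀ : ℝ → ℝ}

lemma integral_latticeKernel_mul_arcChar (hω : IsWeight ω) (hω₀ : IsCutoff ω₀) {Q : ℝ} (hQ : 1 ≤ Q)
    {a : Fin 2 → ℤ} {q : ℕ} (hq : 1 ≤ q) (h : gcdWith a q = 1) (n : Fin 2 → ℤ) :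
    ∫ w, latticeKernel ω₀ ω Q (lattice a q) w * arcChar a q w n =
      (∫ w, p1 ω₀ ω Q q w * arcChar a q w n) +
      ∑ r ∈ (box ⌊Q⌋₊).filter (fun r => (q : ℤ) ∣ dotPerp r a), vecWeight ω Q r *
        ∫ w, p2 ω₀ ω Q r (vecGcd r / gcdWith r q) q w * arcChar a q w n := by
  simp_rw [latticeKernel_eq_sum hω hQ h, add_mul, Finset.sum_mul]
  have h1 : ∀ r, Integrable fun w =>
      vecWeight ω Q r * p2 ω₀ ω Q r (vecGcd r / gcdWith r q) q w * arcChar a q w n := fun r =>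
    integrable_mul_arcChar (vecWeight_mul_p2_integrable hω hω₀ hQ hq r) a q n
  rw [integral_add (integrable_mul_arcChar (integrable_p1 hω hω₀ hQ hq) a q n)
    (integrable_finsetSum _ fun r _ => h1 r), integral_finsetSum _ fun r _ => h1 r]
  simp_rw [mul_assoc, integral_const_mul]

/-- The sum over lattices, with the sums over `a` and `r` interchanged. -/
theorem sum_integral_latticeKernel (hω : IsWeight ω) (hω₀ : IsCutoff ω₀) {Q : ℝ} (hQ : 1 ≤ Q)
    (n : Fin 2 → ℤ) :
    ∑ q ∈ Finset.Icc 1 ⌊Q⌋₊, ∑ a ∈ reducedResidues q,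
      (∫ w, latticeKernel ω₀ ω Q (lattice a q) w * arcChar a q w n) = deltaSum ω₀ ω Q n := by
  have h1 : ∀ q ∈ Finset.Icc 1 ⌊Q⌋₊, ∑ a ∈ reducedResidues q,
      (∫ w, latticeKernel ω₀ ω Q (lattice a q) w * arcChar a q w n) =
      ∑ a ∈ reducedResidues q, (∫ w, p1 ω₀ ω Q q w * arcChar a q w n) +
        ∑ r ∈ box ⌊Q⌋₊, vecWeight ω Q r *
          ∑ a ∈ (reducedResidues q).filter (fun a => (q : ℤ) ∣ dotPerp r a),
            ∫ w, p2 ω₀ ω Q r (vecGcd r / gcdWith r q) q w * arcChar a q w n := by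
    intro q hq
    have h2 : ∀ a ∈ reducedResidues q, _ := fun a ha => integral_latticeKernel_mul_arcChar hω hω₀ hQ
      (Finset.mem_Icc.1 hq).1 (Finset.mem_filter.1 ha).2 n
    rw [Finset.sum_congr rfl h2, Finset.sum_add_distrib]
    congr 1
    simp_rw [Finset.sum_filter, Finset.mul_sum]
    rw [Finset.sum_comm]
    simp_rw [mul_ite, mul_zero]
  rw [Finset.sum_congr rfl h1, Finset.sum_add_distrib, deltaSum]
  congr 1
  rw [Finset.sum_comm]
  simp_rw [Finset.mul_sum]

/-- For `d k = gcd(r)` the vector `r` has `gcd(r, q) = d` exactly if `d ∣ q` and `q / d` is coprime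
to `k`. -/
lemma gcd_mul_eq_left_iff {d k q : ℕ} (hd : 0 < d) :
    Nat.gcd (d * k) q = d ↔ d ∣ q ∧ Nat.gcd (q / d) k = 1 := by
  constructor
  · intro h
    have h1 : d ∣ q := h ▸ Nat.gcd_dvd_right (d * k) q
    obtain ⟨m, rfl⟩ := h1
    refine ⟨dvd_mul_right _ _, ?_⟩
    rw [Nat.gcd_mul_left] at h
    rw [Nat.mul_div_cancel_left _ hd, Nat.gcd_comm]
    exact Nat.eq_of_mul_eq_mul_left hd (by rw [h, mul_one])
  · rintro ⟨⟨m, rfl⟩, h⟩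
    rw [Nat.mul_div_cancel_left _ hd, Nat.gcd_comm] at h
    rw [Nat.gcd_mul_left, h, mul_one]

/-- As `k` is coprime to `q / d`, it may be dropped from the congruence modulo `q`. -/
lemma dvd_dotPerp_smul_iff {d k q : ℕ} (hd : 0 < d) (h : d ∣ q ∧ Nat.gcd (q / d) k = 1)
    (c a : Fin 2 → ℤ) :
    (q : ℤ) ∣ dotPerp (d • c) a ↔ (q : ℤ) ∣ dotPerp ((d * k : ℕ) • c) a := by
  obtain ⟨⟨m, rfl⟩, h⟩ := h
  rw [Nat.mul_div_cancel_left _ hd] at h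
  have hd0 : (d : ℤ) ≠ 0 := by exact_mod_cast hd.ne'
  have h1 : dotPerp (d • c) a = d * dotPerp c a := by
    simp only [dotPerp, Pi.smul_apply, nsmul_eq_mul]
    ring
  have h2 : dotPerp ((d * k : ℕ) • c) a = d * (k * dotPerp c a) := by
    simp only [dotPerp, Pi.smul_apply, nsmul_eq_mul]
    push_cast
    ring
  rw [h1, h2, Nat.cast_mul, mul_dvd_mul_iff_left hd0, mul_dvd_mul_iff_left hd0]
  exact ⟨fun h3 => h3.mul_left _, (Nat.isCoprime_iff_coprime.2 h).dvd_of_dvd_mul_left⟩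

/-- The part of the sum over `q` with `gcd(r, q) = d`, for `d k = gcd(r)`. -/
noncomputable def sumOverModuli (ω₀ ω : ℝ → ℝ) (Q : ℝ) (n r : Fin 2 → ℤ) (d k : ℕ) : ℂ :=
  ∑ q ∈ (Finset.Icc 1 ⌊Q⌋₊).filter (fun q => gcdWith r q = d),
    ∑ a ∈ (reducedResidues q).filter (fun a => (q : ℤ) ∣ dotPerp r a),
      ∫ w : Plane, p2 ω₀ ω Q r k q w * arcChar a q w n

lemma vecGcd_nsmul (m : ℕ) (c : Fin 2 → ℤ) : vecGcd (m • c) = m * vecGcd c := by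
  rw [← natCast_zsmul, vecGcd_smul, Int.natAbs_natCast]

/-- The sum over `q ≤ Q / k` may be extended to `q ≤ Q`, since `p₂` vanishes for `k q ≥ Q`. -/
lemma interchangedTerm_eq (hω : IsWeight ω) (hω₀ : IsCutoff ω₀) {Q : ℝ} (hQ : 1 ≤ Q)
    (n : Fin 2 → ℤ) {d k : ℕ} (hd : 0 < d) (hk : 0 < k) {c : Fin 2 → ℤ} (hc : vecGcd c = 1) :
    interchangedTerm ω₀ ω Q n d k c = vecWeight ω Q ((d * k : ℕ) • c) *
      sumOverModuli ω₀ ω Q n ((d * k : ℕ) • c) d k := by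
  have hk1 : (1 : ℝ) ≤ k := by exact_mod_cast hk
  have hQ0 : 0 ≤ Q := by linarith
  set r := (d * k : ℕ) • c with hr
  rw [interchangedTerm, ← hr]
  by_cases hw : vecWeight ω Q r = 0
  · rw [hw, zero_mul, zero_mul]
  have hX := (vecWeight_bounds hω hQ hw).2.le
  congr 1
  rw [sumOverModuli]
  have hgcd : ∀ q, gcdWith r q = d ↔ d ∣ q ∧ Nat.gcd (q / d) k = 1 := fun q => by
    rw [gcdWith, hr, vecGcd_nsmul, hc, mul_one]
    exact gcd_mul_eq_left_iff hd
  simp_rw [hgcd]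
  have h1 : ∀ q ∈ (Finset.Icc 1 ⌊Q / k⌋₊).filter (fun q => d ∣ q ∧ Nat.gcd (q / d) k = 1),
      ∑ a ∈ (reducedResidues q).filter (fun a => (q : ℤ) ∣ dotPerp (d • c) a),
        (∫ w : Plane, p2 ω₀ ω Q r k q w * arcChar a q w n) =
      ∑ a ∈ (reducedResidues q).filter (fun a => (q : ℤ) ∣ dotPerp r a),
        (∫ w : Plane, p2 ω₀ ω Q r k q w * arcChar a q w n) := by
    intro q hq
    refine Finset.sum_congr (Finset.filter_congr fun a _ => ?_) fun _ _ => rfl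
    exact dvd_dotPerp_smul_iff hd (Finset.mem_filter.1 hq).2 c a
  rw [Finset.sum_congr rfl h1]
  refine Finset.sum_subset ?_ ?_
  · refine Finset.filter_subset_filter _ (Finset.Icc_subset_Icc_right (Nat.floor_le_floor ?_))
    exact div_le_self hQ0 hk1
  · intro q hq hq'
    rw [Finset.mem_filter, Finset.mem_Icc] at hq hq'
    have h2 : ⌊Q / k⌋₊ < q := by
      by_contra h
      exact hq' ⟨⟨hq.1.1, by omega⟩, hq.2⟩
    rw [Nat.floor_lt (by positivity), div_lt_iff₀ (by linarith), mul_comm] at h2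
    refine Finset.sum_eq_zero fun a _ => ?_
    simp_rw [p2_eq_zero hω hω₀ hQ hX h2.le, zero_mul, integral_zero]

/-- The sum over `q` sorted by `d = gcd(r, q)`. -/
lemma sum_sumOverModuli_eq (Q : ℝ) (n : Fin 2 → ℤ) {r : Fin 2 → ℤ} (hr : 0 < vecGcd r) :
    ∑ x ∈ (vecGcd r).divisorsAntidiagonal, sumOverModuli ω₀ ω Q n r x.1 x.2 =
      ∑ q ∈ Finset.Icc 1 ⌊Q⌋₊,
        ∑ a ∈ (reducedResidues q).filter (fun a => (q : ℤ) ∣ dotPerp r a),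
          ∫ w : Plane, p2 ω₀ ω Q r (vecGcd r / gcdWith r q) q w * arcChar a q w n := by
  rw [Nat.sum_divisorsAntidiagonal (f := fun d k => sumOverModuli ω₀ ω Q n r d k)]
  simp_rw [sumOverModuli]
  rw [← Finset.sum_fiberwise_of_maps_to (s := Finset.Icc 1 ⌊Q⌋₊) (t := (vecGcd r).divisors)
    (g := fun q => gcdWith r q) fun q _ => Nat.mem_divisors.2 ⟨Nat.gcd_dvd_left _ _, hr.ne'⟩]
  refine Finset.sum_congr rfl fun d _ => Finset.sum_congr rfl fun q hq => ?_
  rw [(Finset.mem_filter.1 hq).2]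

/-- The triple `(d, k, c)` viewed as the vector `r = d k c` together with the factorization `d k`
of `gcd(r)`. -/
noncomputable def Triple.toSigma (t : Triple) : Σ _ : Fin 2 → ℤ, ℕ × ℕ :=
  ⟨((t.1 : ℕ) * (t.2.1 : ℕ)) • (t.2.2 : Fin 2 → ℤ), ((t.1 : ℕ), (t.2.1 : ℕ))⟩

lemma Triple.toSigma_injective : Function.Injective Triple.toSigma := by
  rintro ⟨d, k, c, hc⟩ ⟨d', k', c', hc'⟩ h
  simp only [Triple.toSigma, Sigma.mk.injEq, heq_eq_eq, Prod.mk.injEq, PNat.coe_inj] at h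
  obtain ⟨h1, rfl, rfl⟩ := h
  have h2 : c = c' := by
    have : ((d : ℕ) * (k : ℕ)) ≠ 0 := Nat.mul_ne_zero d.ne_zero k.ne_zero
    exact smul_right_injective _ this h1
  subst h2
  rfl

/-- The sum over the triples `(d, k, c)` is the sum over `r`, with `d` standing for `gcd(r, q)`. -/
theorem tsum_interchangedTerm (hω : IsWeight ω) (hω₀ : IsCutoff ω₀) {Q : ℝ} (hQ : 1 ≤ Q)
    (n : Fin 2 → ℤ) :
    ∑' t : Triple, interchangedTerm ω₀ ω Q n t.1 t.2.1 t.2.2 =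
      ∑ r ∈ box ⌊Q⌋₊, vecWeight ω Q r * ∑ q ∈ Finset.Icc 1 ⌊Q⌋₊,
        ∑ a ∈ (reducedResidues q).filter (fun a => (q : ℤ) ∣ dotPerp r a),
          ∫ w : Plane, p2 ω₀ ω Q r (vecGcd r / gcdWith r q) q w * arcChar a q w n := by
  set f : (Σ _ : Fin 2 → ℤ, ℕ × ℕ) → ℂ := fun y =>
    if y.2 ∈ (vecGcd y.1).divisorsAntidiagonal then
      vecWeight ω Q y.1 * sumOverModuli ω₀ ω Q n y.1 y.2.1 y.2.2 else 0 with hf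
  have h1 : ∀ t : Triple, interchangedTerm ω₀ ω Q n t.1 t.2.1 t.2.2 = f t.toSigma := by
    rintro ⟨d, k, c, hc⟩
    have h2 : ((d : ℕ), (k : ℕ)) ∈
        (vecGcd (((d : ℕ) * (k : ℕ)) • c)).divisorsAntidiagonal := by
      rw [vecGcd_nsmul, hc, mul_one, Nat.mem_divisorsAntidiagonal]
      exact ⟨rfl, Nat.mul_ne_zero d.ne_zero k.ne_zero⟩
    simp only [hf, Triple.toSigma]
    rw [if_pos h2, interchangedTerm_eq hω hω₀ hQ n d.pos k.pos hc]
  have h3 : Function.support f ⊆ Set.range Triple.toSigma := by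
    rintro ⟨r, d, k⟩ hy
    simp only [hf, Function.mem_support, ne_eq, ite_eq_right_iff, not_forall] at hy
    obtain ⟨h4, _⟩ := hy
    rw [Nat.mem_divisorsAntidiagonal] at h4
    obtain ⟨c, hc⟩ := exists_eq_smul_of_dvd (d := (vecGcd r : ℤ)) (b := r) fun i => vecGcd_dvd r i
    have hc1 : vecGcd c = 1 := by
      have h5 : vecGcd r = vecGcd r * vecGcd c := by
        conv_lhs => rw [hc, vecGcd_smul, Int.natAbs_natCast]
      exact Nat.eq_of_mul_eq_mul_left (Nat.pos_of_ne_zero h4.2) (by rw [mul_one]; exact h5.symm)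
    obtain ⟨hd, hk⟩ : d ≠ 0 ∧ k ≠ 0 := by
      rw [← mul_ne_zero_iff]
      simpa [h4.1] using h4.2
    refine ⟨(⟨d, Nat.pos_of_ne_zero hd⟩, ⟨k, Nat.pos_of_ne_zero hk⟩, ⟨c, hc1⟩), ?_⟩
    simp only [Triple.toSigma, PNat.mk_coe]
    rw [show (d * k) • c = r by rw [h4.1, ← natCast_zsmul, ← hc]]
  simp_rw [h1]
  rw [Triple.toSigma_injective.tsum_eq h3,
    tsum_eq_sum (s := (box ⌊Q⌋₊).sigma fun r => (vecGcd r).divisorsAntidiagonal), Finset.sum_sigma]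
  · refine Finset.sum_congr rfl fun r _ => ?_
    have h4 : ∀ x ∈ (vecGcd r).divisorsAntidiagonal, f ⟨r, x⟩ =
        vecWeight ω Q r * sumOverModuli ω₀ ω Q n r x.1 x.2 := fun x hx => if_pos hx
    rw [Finset.sum_congr rfl h4, ← Finset.mul_sum]
    by_cases hr : vecWeight ω Q r = 0
    · rw [hr, zero_mul, zero_mul]
    · rw [sum_sumOverModuli_eq Q n (vecGcd_pos_of_vecWeight hω hQ hr)]
  · rintro ⟨r, x⟩ hy
    rw [Finset.mem_sigma, not_and_or] at hy
    simp only [hf]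
    rcases hy with hy | hy
    · rw [vecWeight_eq_zero_of_notMem hω hQ hy, zero_mul, ite_self]
    · rw [if_neg hy]

end Arrangements

/-! ### The kernel of a lattice of small modulus -/

section SmallModulus

variable {ω ω₀ : ℝ → ℝ}

/-- The transform of a radial function is radial. -/
lemma bumpFt_isometry (ω₀ ω : ℝ → ℝ) (t : ℝ) (R : Plane ≃ₗᵢ[ℝ] Plane) (u : Plane) :
    bumpFt ω₀ ω t (R u) = bumpFt ω₀ ω t u := by
  rw [bumpFt, ft, ← R.measurePreserving.integral_comp R.toHomeomorph.measurableEmbedding]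
  rw [bumpFt, ft]
  refine integral_congr_ae (Filter.Eventually.of_forall fun y => ?_)
  simp only [bump, LinearIsometryEquiv.norm_map, LinearIsometryEquiv.inner_map_map]

lemma bumpFt_neg (ω₀ ω : ℝ → ℝ) (t : ℝ) (u : Plane) : bumpFt ω₀ ω t (-u) = bumpFt ω₀ ω t u :=
  bumpFt_isometry ω₀ ω t (LinearIsometryEquiv.neg ℝ) u

lemma bumpFt_perp (ω₀ ω : ℝ → ℝ) (t : ℝ) (u : Plane) :
    bumpFt ω₀ ω t (perp u) = bumpFt ω₀ ω t u := by
  have h1 : ‖perp (EuclideanSpace.single (0 : Fin 2) (1 : ℝ))‖ = 1 := by simp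
  rw [← bumpFt_isometry ω₀ ω t (rotation _ h1) u, rotation_apply]
  congr 1
  ext i
  fin_cases i <;> simp [perp]

/-- Poisson summation for `ω₀(n x) e(-β x)` over the multiples of `τ`. -/
lemma exists_sum_cutoff_bound (hω₀ : IsCutoff ω₀) (N : ℕ) (hN : 1 ≤ N) :
    ∃ C : ℝ, 0 ≤ C ∧ ∀ (τ n β : ℝ) (J : ℕ), 0 < τ → 1 / 2 ≤ n → n ≤ 1 → 1 ≤ τ * (J + 1) →
      τ * |β| ≤ 1 / 2 →
      ‖1 + ∑ j ∈ Finset.Icc 1 J, ((ω₀ (τ * j * n) : ℂ) * (e (-(τ * j * β)) + e (τ * j * β))) -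
        ((τ⁻¹ : ℝ) : ℂ) * ∫ t : ℝ, (ω₀ (t * n) : ℂ) * e (-(t * β))‖ ≤ C * τ ^ N := by
  obtain ⟨C, hC0, hC⟩ := exists_poisson_bound N hN
  have hs : ContDiff ℝ (⊤ : ℕ∞) fun x => (ω₀ x : ℂ) := contDiff_ofReal hω₀.smooth
  have hc : HasCompactSupport fun x => (ω₀ x : ℂ) := hasCompactSupport_of_abs (R := 1 / 2)
    fun x hx => by simp [hω₀.apply_of_half_le hx.le]
  set D := ∫ x, ‖iteratedDeriv (N + 1) (fun x => (ω₀ x : ℂ)) x‖ with hD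
  have hD0 : 0 ≤ D := integral_nonneg fun _ => norm_nonneg _
  refine ⟨C * D, by positivity, fun τ n β J hτ hn hn1 hJ hβ => ?_⟩
  have hn0 : 0 < n := by linarith
  have h1 := hC (fun x => (ω₀ x : ℂ)) (τ * n) 0 (-(β / n)) hs hc (by positivity) (by
    rw [abs_neg, abs_div, abs_of_pos hn0]
    calc τ * n * (|β| / n) = τ * |β| := by field_simp
      _ ≤ 1 / 2 := hβ)
  have h2 : ∀ j : ℤ, (ω₀ (τ * n * j + 0) : ℂ) * e (-(β / n) * (τ * n * j + 0)) =
      (ω₀ (τ * j * n) : ℂ) * e (-(τ * j * β)) := fun j => by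
    rw [add_zero, show τ * n * j = τ * j * n by ring,
      show -(β / n) * (τ * j * n) = -(τ * j * β) by field_simp]
  simp_rw [h2] at h1
  rw [tsum_int_eq_sum _ J] at h1
  · have h3 : ∫ x, (ω₀ x : ℂ) * e (-(β / n) * x) =
        (n : ℂ) * ∫ t : ℝ, (ω₀ (t * n) : ℂ) * e (-(t * β)) := by
      have h4 := Measure.integral_comp_mul_right (fun x => (ω₀ x : ℂ) * e (-(β / n) * x)) n
      rw [abs_of_pos (inv_pos.2 hn0), Complex.real_smul] at h4
      have h5 : ∀ t : ℝ, (ω₀ (t * n) : ℂ) * e (-(β / n) * (t * n)) =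
          (ω₀ (t * n) : ℂ) * e (-(t * β)) := fun t => by
        rw [show -(β / n) * (t * n) = -(t * β) by field_simp]
      simp_rw [h5] at h4
      rw [h4, ← mul_assoc, ← Complex.ofReal_mul, mul_inv_cancel₀ hn0.ne', Complex.ofReal_one, one_mul]
    rw [h3, ← mul_assoc, ← Complex.ofReal_mul, show (τ * n)⁻¹ * n = τ⁻¹ by field_simp] at h1
    simp only [Int.cast_zero, mul_zero, zero_mul, hω₀.apply_zero, neg_zero, e_zero, mul_one,
      Complex.ofReal_one, Int.cast_natCast, Int.cast_neg, mul_neg, neg_mul, hω₀.even, neg_neg,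
      ← mul_add] at h1
    refine h1.trans ?_
    have h6 : (τ * n) ^ N ≤ τ ^ N := by
      gcongr
      nlinarith
    calc C * (τ * n) ^ N * D ≤ C * τ ^ N * D := by gcongr
      _ = C * D * τ ^ N := by ring
  · intro j hj
    have h3 : (J : ℝ) + 1 ≤ |(j : ℝ)| := by
      have : (J : ℤ) + 1 ≤ |j| := hj
      exact_mod_cast this
    rw [hω₀.apply_of_half_le]
    · simp
    · rw [abs_mul, abs_mul, abs_of_pos hτ, abs_of_pos hn0]
      have h4 : 1 ≤ τ * |(j : ℝ)| := hJ.trans (by gcongr)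
      nlinarith

lemma integrable_weight_norm (hω : IsWeight ω) : Integrable fun y : Plane => ω ‖y‖ :=
  (hω.continuous.comp continuous_norm).integrable_of_hasCompactSupport
    (hasCompactSupport_of_norm (R := 1) fun _ hy => hω.apply_of_one_le hy.le)

lemma bumpFt_smul_eq (ω₀ ω : ℝ → ℝ) (t : ℝ) (v : Plane) :
    bumpFt ω₀ ω t (t • v) =
      ∫ y : Plane, (ω ‖y‖ : ℂ) * ((ω₀ (t * ‖y‖) : ℂ) * e (-(t * inner ℝ v y))) := by
  rw [bumpFt, ft]
  refine integral_congr_ae (Filter.Eventually.of_forall fun y => ?_)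
  simp only [bump, inner_smul_left, conj_trivial]
  push_cast
  ring

lemma integrable_bump_term (hω : IsWeight ω) (hω₀ : IsCutoff ω₀) (t : ℝ) (v : Plane) :
    Integrable fun y : Plane => (ω ‖y‖ : ℂ) * ((ω₀ (t * ‖y‖) : ℂ) * e (-(t * inner ℝ v y))) := by
  have h1 := hω.continuous
  have h2 := hω₀.smooth.continuous
  refine Continuous.integrable_of_hasCompactSupport (by fun_prop) ?_
  exact hasCompactSupport_of_norm (R := 1) fun _ hy => by simp [hω.apply_of_one_le hy.le]

lemma integrable_bump_prod (hω : IsWeight ω) (hω₀ : IsCutoff ω₀) (v : Plane) :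
    Integrable (fun p : ℝ × Plane => (ω ‖p.2‖ : ℂ) *
      ((ω₀ (p.1 * ‖p.2‖) : ℂ) * e (-(p.1 * inner ℝ v p.2)))) (volume.prod volume) := by
  have h1 := hω.continuous
  have h2 := hω₀.smooth.continuous
  refine Continuous.integrable_of_hasCompactSupport (by fun_prop) ?_
  refine HasCompactSupport.intro ((isCompact_closedBall (0 : ℝ) 1).prod
    (isCompact_closedBall (0 : Plane) 1)) fun p hp => ?_
  rw [Set.mem_prod, mem_closedBall_zero_iff, mem_closedBall_zero_iff, Real.norm_eq_abs,
    not_and_or, not_le, not_le] at hp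
  have h3 : ω ‖p.2‖ * ω₀ (p.1 * ‖p.2‖) = 0 := by
    rcases hp with hp | hp
    · have := bump_eq_zero_of_one_le hω hω₀ hp.le p.2
      rwa [bump, Complex.ofReal_eq_zero] at this
    · rw [hω.apply_of_one_le hp.le, zero_mul]
  rw [← mul_assoc, ← Complex.ofReal_mul, h3]
  simp

/-- Exchange of the integrals over `t` and `y`. -/
lemma integral_bumpFt_smul (hω : IsWeight ω) (hω₀ : IsCutoff ω₀) (v : Plane) :
    ∫ t : ℝ, bumpFt ω₀ ω t (t • v) = ∫ y : Plane, (ω ‖y‖ : ℂ) *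
      ∫ t : ℝ, (ω₀ (t * ‖y‖) : ℂ) * e (-(t * inner ℝ v y)) := by
  simp_rw [bumpFt_smul_eq, ← integral_const_mul]
  exact integral_integral_swap (integrable_bump_prod hω hω₀ v)

/-- Poisson summation over the samples at `t = τ j`. The term `j = 0` is `∫ ω(|y|) dy = 1 / c`, and
as the samples are even in `j`, those with `j ≠ 0` give twice the sum over `j ≥ 1`. -/
lemma exists_sum_bumpFt_bound (hω : IsWeight ω) (hω₀ : IsCutoff ω₀) (N : ℕ) (hN : 1 ≤ N) :
    ∃ C : ℝ, 0 ≤ C ∧ ∀ (τ : ℝ) (v : Plane) (J : ℕ), 0 < τ → 1 ≤ τ * (J + 1) → τ * ‖v‖ ≤ 1 / 2 →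
      ‖(((normConst ω)⁻¹ : ℝ) : ℂ) + 2 * ∑ j ∈ Finset.Icc 1 J, bumpFt ω₀ ω (τ * j) ((τ * j) • v) -
        ((τ⁻¹ : ℝ) : ℂ) * ∫ t : ℝ, bumpFt ω₀ ω t (t • v)‖ ≤ C * τ ^ N := by
  obtain ⟨C, hC0, hC⟩ := exists_sum_cutoff_bound hω₀ N hN
  have hc := normConst_pos hω
  refine ⟨(normConst ω)⁻¹ * C, by positivity, fun τ v J hτ hJ hv => ?_⟩
  set A : Plane → ℂ := fun y => ∫ t : ℝ, (ω₀ (t * ‖y‖) : ℂ) * e (-(t * inner ℝ v y)) with hA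
  set G : Plane → ℂ := fun y => 1 + ∑ j ∈ Finset.Icc 1 J, ((ω₀ (τ * j * ‖y‖) : ℂ) *
    (e (-(τ * j * inner ℝ v y)) + e (τ * j * inner ℝ v y))) - ((τ⁻¹ : ℝ) : ℂ) * A y with hG
  have hGb : ∀ y, ‖(ω ‖y‖ : ℂ) * G y‖ ≤ ω ‖y‖ * (C * τ ^ N) := by
    intro y
    rw [norm_mul, Complex.norm_real, Real.norm_eq_abs, abs_of_nonneg (hω.nonneg _)]
    by_cases hy : ω ‖y‖ = 0
    · simp [hy]
    · have h1 := hω.support hy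
      refine mul_le_mul_of_nonneg_left (hC τ ‖y‖ (inner ℝ v y) J hτ h1.1.le h1.2.le hJ ?_) (hω.nonneg _)
      have h2 := abs_real_inner_le_norm v y
      have h3 : ‖v‖ * ‖y‖ ≤ ‖v‖ := mul_le_of_le_one_right (norm_nonneg _) h1.2.le
      calc τ * |inner ℝ v y| ≤ τ * ‖v‖ := by gcongr; linarith
        _ ≤ 1 / 2 := hv
  have hwint : Integrable fun y : Plane => (ω ‖y‖ : ℂ) := (integrable_weight_norm hω).ofReal
  have hAint : Integrable fun y => (ω ‖y‖ : ℂ) * A y := by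
    have h1 := (integrable_bump_prod hω hω₀ v).integral_prod_right
    simpa only [integral_const_mul] using h1
  have hterm : ∀ j ∈ Finset.Icc 1 J, 2 * bumpFt ω₀ ω (τ * j) ((τ * j) • v) =
      ∫ y : Plane, (ω ‖y‖ : ℂ) * ((ω₀ (τ * j * ‖y‖) : ℂ) *
        (e (-(τ * j * inner ℝ v y)) + e (τ * j * inner ℝ v y))) := by
    intro j _
    have h1 : bumpFt ω₀ ω (τ * j) ((τ * j) • v) = bumpFt ω₀ ω (τ * j) ((τ * j) • (-v)) := by
      rw [smul_neg, bumpFt_neg]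
    rw [two_mul]
    nth_rewrite 2 [h1]
    rw [bumpFt_smul_eq, bumpFt_smul_eq, ← integral_add (integrable_bump_term hω hω₀ _ _)
      (integrable_bump_term hω hω₀ _ _)]
    refine integral_congr_ae (Filter.Eventually.of_forall fun y => ?_)
    simp only [inner_neg_left, mul_neg, neg_neg]
    ring
  have htint : ∀ j ∈ Finset.Icc 1 J, Integrable fun y : Plane => (ω ‖y‖ : ℂ) *
      ((ω₀ (τ * j * ‖y‖) : ℂ) * (e (-(τ * j * inner ℝ v y)) + e (τ * j * inner ℝ v y))) := by
    intro j _
    have h1 := hω.continuous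
    have h2 := hω₀.smooth.continuous
    refine Continuous.integrable_of_hasCompactSupport (by fun_prop) ?_
    exact hasCompactSupport_of_norm (R := 1) fun _ hy => by simp [hω.apply_of_one_le hy.le]
  have hkey : (((normConst ω)⁻¹ : ℝ) : ℂ) + 2 * ∑ j ∈ Finset.Icc 1 J,
      bumpFt ω₀ ω (τ * j) ((τ * j) • v) - ((τ⁻¹ : ℝ) : ℂ) * ∫ t : ℝ, bumpFt ω₀ ω t (t • v) =
      ∫ y, (ω ‖y‖ : ℂ) * G y := by
    have h1 := integrable_finsetSum _ htint
    have h2 : Integrable fun y : Plane => (ω ‖y‖ : ℂ) + ∑ j ∈ Finset.Icc 1 J, (ω ‖y‖ : ℂ) *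
      ((ω₀ (τ * j * ‖y‖) : ℂ) * (e (-(τ * j * inner ℝ v y)) + e (τ * j * inner ℝ v y))) :=
      hwint.add h1
    have h3 : ∀ y, (ω ‖y‖ : ℂ) * G y = ((ω ‖y‖ : ℂ) + ∑ j ∈ Finset.Icc 1 J, (ω ‖y‖ : ℂ) *
        ((ω₀ (τ * j * ‖y‖) : ℂ) * (e (-(τ * j * inner ℝ v y)) + e (τ * j * inner ℝ v y)))) -
        ((τ⁻¹ : ℝ) : ℂ) * ((ω ‖y‖ : ℂ) * A y) := fun y => by
      rw [← Finset.mul_sum]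
      simp only [hG]
      ring
    simp_rw [h3]
    rw [integral_sub h2 (hAint.const_mul _), integral_add hwint h1, integral_finsetSum _ htint,
      integral_const_mul, integral_bumpFt_smul hω hω₀, Finset.mul_sum, Finset.sum_congr rfl hterm,
      normConst, inv_inv,
      show ∫ y : Plane, (ω ‖y‖ : ℂ) = ((∫ y : Plane, ω ‖y‖ : ℝ) : ℂ) from integral_ofReal]
  rw [hkey]
  refine (norm_integral_le_of_norm_le ((integrable_weight_norm hω).mul_const _)
    (Filter.Eventually.of_forall hGb)).trans (le_of_eq ?_)
  rw [integral_mul_const, normConst, inv_inv, mul_assoc]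

/-- The expansion of `p₁` for small modulus. -/
lemma exists_p1_approx (hω : IsWeight ω) (hω₀ : IsCutoff ω₀) (N : ℕ) (hN : 1 ≤ N) :
    ∃ C : ℝ, 0 ≤ C ∧ ∀ (Q : ℝ) (q : ℕ) (w : Plane), 1 ≤ Q → 1 ≤ q →
      q / Q * ‖Q ^ (3 / 2 : ℝ) • w‖ ≤ 1 / 2 →
      ‖p1 ω₀ ω Q q w - (1 - ((normConst ω * (Q / q) : ℝ) : ℂ) *
        ∫ t : ℝ, bumpFt ω₀ ω t (t • Q ^ (3 / 2 : ℝ) • w))‖ ≤ C * (q / Q) ^ N := by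
  obtain ⟨C, hC0, hC⟩ := exists_sum_bumpFt_bound hω hω₀ N hN
  have hc := normConst_pos hω
  refine ⟨normConst ω * C, by positivity, fun Q q w hQ hq hw => ?_⟩
  obtain ⟨hX1, hXX, hX3⟩ := sqrt_pow_facts hQ
  have hQ0 : 0 < Q := by linarith
  have hq1 : (1 : ℝ) ≤ q := by exact_mod_cast hq
  have hM : Q < ⌊Q⌋₊ + 1 := Nat.lt_floor_add_one Q
  have h1 := hC (q / Q) (Q ^ (3 / 2 : ℝ) • w) ⌊Q⌋₊ (by positivity) (by
    rw [div_mul_eq_mul_div, one_le_div hQ0]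
    nlinarith) hw
  rw [p1_eq_sum_bumpFt hω hω₀ hQ hq (J := ⌊Q⌋₊) (by nlinarith)]
  have h2 : ∀ j : ℕ, bumpFt ω₀ ω (j * q / Q) ((j * q * Q ^ (1 / 2 : ℝ)) • w) =
      bumpFt ω₀ ω (q / Q * j) ((q / Q * j : ℝ) • Q ^ (3 / 2 : ℝ) • w) := fun j => by
    rw [smul_smul, hX3, show (q : ℝ) / Q * j = j * q / Q by ring,
      show (j : ℝ) * q / Q * (Q * Q ^ (1 / 2 : ℝ)) = j * q * Q ^ (1 / 2 : ℝ) by field_simp]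
  simp_rw [h2]
  rw [inv_div] at h1
  have h3 : ((-(2 * normConst ω) : ℝ) : ℂ) * ∑ j ∈ Finset.Icc 1 ⌊Q⌋₊,
      bumpFt ω₀ ω (q / Q * j) ((q / Q * j : ℝ) • Q ^ (3 / 2 : ℝ) • w) -
      (1 - ((normConst ω * (Q / q) : ℝ) : ℂ) *
        ∫ t : ℝ, bumpFt ω₀ ω t (t • Q ^ (3 / 2 : ℝ) • w)) =
      -((normConst ω : ℂ) * ((((normConst ω)⁻¹ : ℝ) : ℂ) + 2 * ∑ j ∈ Finset.Icc 1 ⌊Q⌋₊,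
        bumpFt ω₀ ω (q / Q * j) ((q / Q * j : ℝ) • Q ^ (3 / 2 : ℝ) • w) -
        ((Q / q : ℝ) : ℂ) * ∫ t : ℝ, bumpFt ω₀ ω t (t • Q ^ (3 / 2 : ℝ) • w))) := by
    have h4 : (normConst ω : ℂ) * (((normConst ω)⁻¹ : ℝ) : ℂ) = 1 := by
      rw [← Complex.ofReal_mul, mul_inv_cancel₀ hc.ne', Complex.ofReal_one]
    push_cast at h4 ⊢
    linear_combination h4
  rw [h3, norm_neg, norm_mul, Complex.norm_real, Real.norm_eq_abs, abs_of_pos hc, mul_assoc]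
  gcongr

end SmallModulus

/-! ### Sums over the points of a lattice -/

section LatticeSum

variable {ω ω₀ : ℝ → ℝ}

/-- The lattice `Λ(a, q)` is the disjoint union of the `q` translates `κ a + q ℤ²`. -/
lemma tsum_lattice_eq_sum_tsum {a : Fin 2 → ℤ} {q : ℕ} (hq : 1 ≤ q) (h : gcdWith a q = 1)
    {f : (Fin 2 → ℤ) → ℂ} (hf : f.support.Finite) :
    ∑' r : lattice a q, f r =
      ∑ κ ∈ Finset.range q, ∑' m : Fin 2 → ℤ, f ((κ : ℤ) • a + (q : ℤ) • m) := by
  have hq0 : (0 : ℤ) < q := by exact_mod_cast hq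
  set g : Fin q × (Fin 2 → ℤ) → lattice a q := fun p =>
    ⟨((p.1 : ℕ) : ℤ) • a + (q : ℤ) • p.2, ⟨_, _, rfl⟩⟩ with hg
  have hg1 : ∀ p, (g p : Fin 2 → ℤ) = ((p.1 : ℕ) : ℤ) • a + (q : ℤ) • p.2 := fun p => rfl
  obtain ⟨x, y, z, hxyz⟩ := exists_bezout h
  have hinj : Function.Injective g := by
    rintro ⟨κ, m⟩ ⟨κ', m'⟩ hp
    have h1 : ∀ i, (κ : ℤ) * a i + q * m i = (κ' : ℤ) * a i + q * m' i := fun i =>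
      congrFun (congrArg Subtype.val hp) i
    have h2 : (q : ℤ) ∣ κ - κ' := by
      refine ⟨x * (m' 0 - m 0) + y * (m' 1 - m 1) + z * (κ - κ'), ?_⟩
      linear_combination (-((κ : ℤ) - κ')) * hxyz + x * h1 0 + y * h1 1
    have h3 : (κ : ℤ) - κ' = 0 := by
      have h4 := κ.isLt
      have h5 := κ'.isLt
      refine Int.eq_zero_of_abs_lt_dvd h2 ?_
      rw [abs_lt]
      omega
    have h4 : κ = κ' := Fin.ext (by omega)
    subst h4
    have h5 : m = m' := by
      ext i
      have h6 := h1 i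
      exact mul_left_cancel₀ hq0.ne' (by linarith)
    rw [h5]
  have hsurj : Function.Surjective g := by
    rintro ⟨_, k, m, rfl⟩
    have h1 := Int.emod_nonneg k hq0.ne'
    have h2 := Int.emod_lt_of_pos k hq0
    refine ⟨(⟨(k % q).toNat, by omega⟩, (k / q) • a + m), ?_⟩
    rw [Subtype.ext_iff, hg1]
    ext i
    simp only [Pi.add_apply, Pi.smul_apply, smul_eq_mul]
    rw [Int.toNat_of_nonneg h1]
    linear_combination (a i) * Int.emod_add_mul_ediv k q
  have hs : Summable fun p => f (g p) := by
    refine summable_of_hasFiniteSupport ?_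
    exact hf.preimage (f := fun p => (g p : Fin 2 → ℤ)) (Subtype.val_injective.comp hinj).injOn
  have hbij : Function.Bijective g := ⟨hinj, hsurj⟩
  rw [← (Equiv.ofBijective g hbij).tsum_eq]
  change ∑' p, f (g p) = _
  rw [hs.tsum_prod, tsum_fintype, ← Fin.sum_univ_eq_sum_range
    fun κ => ∑' m : Fin 2 → ℤ, f ((κ : ℤ) • a + (q : ℤ) • m)]

lemma toPlane_add (u v : Fin 2 → ℤ) : toPlane (u + v) = toPlane u + toPlane v := by
  ext i
  simp [toPlane_apply]

/-- The sum over the lattice points of norm about `Q^{1/2}`, for one value of `t`. -/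
lemma exists_lattice_sum_bound (hω : IsWeight ω) (hω₀ : IsCutoff ω₀) (N : ℕ) :
    ∃ C : ℝ, 0 ≤ C ∧ ∀ (Q : ℝ) (q : ℕ) (a : Fin 2 → ℤ) (t : ℝ) (v : Plane), 1 ≤ Q → 1 ≤ q →
      gcdWith a q = 1 → (q : ℝ) ≤ Q ^ (1 / 2 : ℝ) → q / Q ^ (1 / 2 : ℝ) * ‖v‖ ≤ 1 / 2 →
      ‖∑ r ∈ (box ⌊Q⌋₊).filter (fun r => (q : ℤ) ∣ dotPerp r a), vecWeight ω Q r *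
          ((ω₀ (t * ‖(Q ^ (1 / 2 : ℝ))⁻¹ • toPlane r‖) : ℂ) *
            e (t * inner ℝ v (perp ((Q ^ (1 / 2 : ℝ))⁻¹ • toPlane r)))) -
        ((Q / q : ℝ) : ℂ) * bumpFt ω₀ ω t (t • v)‖ ≤ C * (q * (q / Q ^ (1 / 2 : ℝ)) ^ N) := by
  obtain ⟨C, hC0, hC⟩ := exists_poisson_bound_plane (N + 1) (by omega)
  obtain ⟨B, hB0, hB⟩ := exists_bump_bound hω hω₀ (N + 1 + 1)
  refine ⟨C * B, by positivity, fun Q q a t v hQ hq h hqX hv => ?_⟩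
  obtain ⟨hX1, hXX, hX3⟩ := sqrt_pow_facts hQ
  set X := Q ^ (1 / 2 : ℝ) with hX
  have hX0 : 0 < X := by linarith
  have hq0 : (0 : ℝ) < q := by exact_mod_cast hq
  have hweight : ∀ r : Fin 2 → ℤ, vecWeight ω Q r * (ω₀ (t * ‖X⁻¹ • toPlane r‖) : ℂ) =
      bump ω₀ ω t (X⁻¹ • toPlane r) := fun r => by
    rw [bump, norm_inv_smul_toPlane hQ, vecWeight]
    push_cast
    rfl
  simp_rw [← mul_assoc, hweight]
  rcases le_or_gt 1 |t| with ht | ht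
  · simp_rw [bump_eq_zero_of_one_le hω hω₀ ht, bumpFt_eq_zero_of_one_le hω hω₀ ht]
    simp only [zero_mul, Finset.sum_const_zero, mul_zero, sub_zero, norm_zero]
    positivity
  -- the linear form `y ↦ t v · y^⊥` is the scalar product with `θ`
  set θ : Plane := (-t) • perp v with hθ
  have hθi : ∀ y, t * inner ℝ v (perp y) = inner ℝ θ y := fun y => by
    rw [hθ, inner_smul_left, inner_plane, inner_plane]
    simp only [perp_apply_zero, perp_apply_one, conj_trivial]
    ring
  have hθn : q / X * ‖θ‖ ≤ 1 / 2 := by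
    rw [hθ, norm_smul, norm_perp, norm_neg, Real.norm_eq_abs]
    calc q / X * (|t| * ‖v‖) ≤ q / X * (1 * ‖v‖) := by gcongr
      _ ≤ 1 / 2 := by rwa [one_mul]
  simp_rw [hθi]
  set F : (Fin 2 → ℤ) → ℂ := fun r =>
    bump ω₀ ω t (X⁻¹ • toPlane r) * e (inner ℝ θ (X⁻¹ • toPlane r)) with hF
  have h1 : ∑ r ∈ (box ⌊Q⌋₊).filter (fun r => (q : ℤ) ∣ dotPerp r a), F r =
      ∑' r : lattice a q, F r := by
    have h2 := tsum_lattice_eq_sum hω hQ h fun r => (ω₀ (t * ‖X⁻¹ • toPlane r‖) : ℂ) *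
      e (inner ℝ θ (X⁻¹ • toPlane r))
    simp_rw [← mul_assoc, hweight] at h2
    exact h2.symm
  have hFs : F.support.Finite := by
    refine (box ⌊Q⌋₊).finite_toSet.subset fun r hr => ?_
    by_contra h2
    refine hr ?_
    simp only [hF]
    rw [← hweight, vecWeight_eq_zero_of_notMem hω hQ h2, zero_mul, zero_mul]
  have h2 : ((Q / q : ℝ) : ℂ) * bumpFt ω₀ ω t (t • v) = ∑ κ ∈ Finset.range q,
      ((((q / X) ^ 2)⁻¹ : ℝ) : ℂ) * ∫ y, bump ω₀ ω t y * e (inner ℝ θ y) := by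
    have h3 : ∫ y, bump ω₀ ω t y * e (inner ℝ θ y) = bumpFt ω₀ ω t (t • v) := by
      rw [← bumpFt_perp, bumpFt, ft]
      refine integral_congr_ae (Filter.Eventually.of_forall fun y => ?_)
      have h4 : perp (t • v) = -θ := by
        rw [hθ]
        ext i
        fin_cases i <;> simp [perp]
      simp only [h4, inner_neg_left, neg_neg]
    rw [h3, Finset.sum_const, Finset.card_range, nsmul_eq_mul, ← mul_assoc, ← Complex.ofReal_natCast,
      ← Complex.ofReal_mul]
    congr 2
    rw [← hXX]
    field_simp
  have h3 : ∀ (κ : ℕ) (m : Fin 2 → ℤ), F ((κ : ℤ) • a + (q : ℤ) • m) =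
      bump ω₀ ω t ((q / X) • toPlane m + ((κ : ℝ) / X) • toPlane a) *
        e (inner ℝ θ ((q / X) • toPlane m + ((κ : ℝ) / X) • toPlane a)) := fun κ m => by
    simp only [hF]
    rw [toPlane_add, toPlane_smul, toPlane_smul, smul_add, smul_smul, smul_smul, add_comm,
      inv_mul_eq_div, inv_mul_eq_div]
    simp
  rw [h1, tsum_lattice_eq_sum_tsum hq h hFs, h2, ← Finset.sum_sub_distrib]
  simp_rw [h3]
  refine (norm_sum_le_of_le _ fun (κ : ℕ) _ =>
    hC (bump ω₀ ω t) B (q / X) (((κ : ℝ) / X) • toPlane a) θ (contDiff_bump hω hω₀ t)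
      (fun y hy => bump_eq_zero hω t hy.le) (fun n hn y => hB t n hn y) (by positivity)
      ((div_le_one hX0).2 hqX) hθn).trans (le_of_eq ?_)
  rw [Finset.sum_const, Finset.card_range, nsmul_eq_mul, pow_succ, mul_div_assoc,
    div_self (by positivity)]
  ring

lemma integrable_cutoff_line (hω₀ : IsCutoff ω₀) {s : ℝ} (hs : 0 < s) (x : ℝ) :
    Integrable fun t : ℝ => (ω₀ (t * s) : ℂ) * e (t * x) := by
  have h := hω₀.smooth.continuous
  refine Continuous.integrable_of_hasCompactSupport (by fun_prop) ?_
  refine hasCompactSupport_of_abs (R := 1 / s) fun t ht => ?_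
  rw [hω₀.apply_of_half_le]
  · simp
  · rw [div_lt_iff₀ hs] at ht
    rw [abs_mul, abs_of_pos hs]
    linarith

/-- The sum over `r` in the kernel of a lattice, for small modulus. -/
lemma exists_sum_p2_approx (hω : IsWeight ω) (hω₀ : IsCutoff ω₀) (N : ℕ) :
    ∃ C : ℝ, 0 ≤ C ∧ ∀ (Q : ℝ) (q : ℕ) (a : Fin 2 → ℤ) (w : Plane), 1 ≤ Q → 1 ≤ q →
      gcdWith a q = 1 → (q : ℝ) ≤ Q ^ (1 / 2 : ℝ) →
      q / Q ^ (1 / 2 : ℝ) * ‖Q ^ (3 / 2 : ℝ) • w‖ ≤ 1 / 4 →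
      ‖∑ r ∈ (box ⌊Q⌋₊).filter (fun r => (q : ℤ) ∣ dotPerp r a),
          vecWeight ω Q r * p2 ω₀ ω Q r (vecGcd r / gcdWith r q) q w -
        ((normConst ω * (Q / q) : ℝ) : ℂ) *
          ∫ t : ℝ, bumpFt ω₀ ω t (t • Q ^ (3 / 2 : ℝ) • w)‖ ≤
        C * (Q ^ 2 * (q / Q ^ (1 / 2 : ℝ)) ^ N) := by
  obtain ⟨C₁, hC₁0, hC₁⟩ := exists_ft_kernel_approx hω hω₀ (N + 1) (by omega)
  obtain ⟨C₂, hC₂0, hC₂⟩ := exists_lattice_sum_bound hω hω₀ N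
  obtain ⟨B, hB0, hB⟩ := hω.exists_bound
  have hc := normConst_pos hω
  refine ⟨9 * (B * (normConst ω * C₁)) + normConst ω * (2 * C₂), by positivity,
    fun Q q a w hQ hq h hqX hw => ?_⟩
  obtain ⟨hX1, hXX, hX3⟩ := sqrt_pow_facts hQ
  have hXQ := sqrt_le_self hQ
  set X := Q ^ (1 / 2 : ℝ) with hX
  set v := Q ^ (3 / 2 : ℝ) • w with hv
  have hX0 : 0 < X := by linarith
  have hQ0 : 0 < Q := by linarith
  have hq0 : (0 : ℝ) < q := by exact_mod_cast hq
  have hqX1 : q / X ≤ 1 := (div_le_one hX0).2 hqX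
  set S := (box ⌊Q⌋₊).filter (fun r => (q : ℤ) ∣ dotPerp r a) with hS
  set L : (Fin 2 → ℤ) → ℝ → ℂ := fun r t => (ω₀ (t * ‖X⁻¹ • toPlane r‖) : ℂ) *
    e (t * inner ℝ v (perp (X⁻¹ • toPlane r))) with hL
  -- each `p₂` is replaced by an integral over a line
  have hA : ‖∑ r ∈ S, (vecWeight ω Q r * p2 ω₀ ω Q r (vecGcd r / gcdWith r q) q w -
      (normConst ω : ℂ) * (vecWeight ω Q r * ∫ t, L r t))‖ ≤
      9 * (B * (normConst ω * C₁)) * (Q ^ 2 * (q / X) ^ N) := by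
    have h1 : ∀ r ∈ S, ‖vecWeight ω Q r * p2 ω₀ ω Q r (vecGcd r / gcdWith r q) q w -
        (normConst ω : ℂ) * (vecWeight ω Q r * ∫ t, L r t)‖ ≤
        B * (normConst ω * (C₁ * (q / X) ^ N)) := by
      intro r _
      by_cases hr : vecWeight ω Q r = 0
      · rw [hr, zero_mul, zero_mul, mul_zero, sub_zero, norm_zero]
        positivity
      have hr0 := vecGcd_pos_of_vecWeight hω hQ hr
      have hr1 := vecWeight_bounds hω hQ hr
      have hk : ((vecGcd r / gcdWith r q : ℕ) : ℝ) ≤ X := by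
        refine le_trans (Nat.cast_le.2 (Nat.div_le_self _ _)) ((vecGcd_le_norm hr0).trans hr1.2.le)
      have hk1 : (1 : ℝ) ≤ (vecGcd r / gcdWith r q : ℕ) := by
        exact_mod_cast div_gcdWith_pos hr0 q
      set k := vecGcd r / gcdWith r q with hkdef
      have hη : (k : ℝ) * q / Q ≤ q / X := by
        rw [div_le_div_iff₀ hQ0 hX0, ← hXX]
        nlinarith [mul_le_mul_of_nonneg_left hk (mul_nonneg hq0.le hX0.le)]
      have h2 := hC₁ (k * q / Q) (X⁻¹ • toPlane r) v (by positivity)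
        (by rw [norm_inv_smul_toPlane hQ, le_div_iff₀ hX0]; linarith [hr1.1])
        (by rw [norm_inv_smul_toPlane hQ, div_le_one hX0]; exact hr1.2.le)
        (le_trans (by gcongr) hw)
      rw [p2_eq_ft_kernel ω₀ ω hQ, show ∀ x y z u : ℂ, x * (y * z) - y * (x * u) = x * (y * (z - u)) from
        fun x y z u => by ring, norm_mul, norm_mul, Complex.norm_real, Real.norm_eq_abs, abs_of_pos hc]
      refine mul_le_mul (norm_vecWeight_le hω hB Q r) ?_ (by positivity) hB0
      refine mul_le_mul_of_nonneg_left (h2.trans ?_) hc.le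
      calc C₁ * (k * q / Q) ^ (N + 1) ≤ C₁ * (q / X) ^ (N + 1) := by gcongr
        _ ≤ C₁ * (q / X) ^ N := mul_le_mul_of_nonneg_left
          (pow_le_pow_of_le_one (by positivity) hqX1 (Nat.le_succ N)) hC₁0
    refine (norm_sum_le_of_le _ h1).trans ?_
    rw [Finset.sum_const, nsmul_eq_mul]
    have h4 : (S.card : ℝ) ≤ 9 * Q ^ 2 :=
      (Nat.cast_le.2 (Finset.card_filter_le _ _)).trans (card_box_le hQ)
    refine (mul_le_mul_of_nonneg_right h4 (by positivity)).trans (le_of_eq ?_)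
    ring
  -- the lattice sum is evaluated for each `t`
  have hint : ∀ r ∈ S, Integrable fun t => vecWeight ω Q r * L r t := by
    intro r _
    by_cases hr : vecWeight ω Q r = 0
    · simp [hr]
    · have hr1 := (vecWeight_bounds hω hQ hr).1
      refine (integrable_cutoff_line hω₀ ?_ _).const_mul _
      rw [norm_inv_smul_toPlane hQ]
      exact div_pos (by linarith [div_pos hX0 two_pos]) hX0
  have hKint : Integrable fun t : ℝ => bumpFt ω₀ ω t (t • v) := by
    simp_rw [bumpFt_smul_eq]
    exact (integrable_bump_prod hω hω₀ v).integral_prod_left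
  have hB' : ‖∑ r ∈ S, vecWeight ω Q r * (∫ t, L r t) -
      ((Q / q : ℝ) : ℂ) * ∫ t : ℝ, bumpFt ω₀ ω t (t • v)‖ ≤ 2 * C₂ * (Q ^ 2 * (q / X) ^ N) := by
    simp_rw [← integral_const_mul]
    rw [← integral_finsetSum _ hint, ← integral_sub (integrable_finsetSum _ hint)
      (hKint.const_mul _)]
    refine (norm_integral_le_of_support zero_le_one (B := C₂ * (q * (q / X) ^ N))
      (fun t _ => hC₂ Q q a t v hQ hq h hqX (hw.trans (by norm_num))) fun t ht => ?_).trans ?_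
    · rw [bumpFt_eq_zero_of_one_le hω hω₀ ht.le, mul_zero, sub_zero]
      refine Finset.sum_eq_zero fun r _ => ?_
      have h1 := bump_eq_zero_of_one_le hω hω₀ ht.le (X⁻¹ • toPlane r)
      rw [bump, norm_inv_smul_toPlane hQ, Complex.ofReal_mul] at h1
      rw [norm_inv_smul_toPlane hQ, ← mul_assoc, vecWeight, h1, zero_mul]
    · have h1 : (q : ℝ) ≤ Q ^ 2 := by nlinarith
      calc 2 * 1 * (C₂ * (q * (q / X) ^ N)) = 2 * C₂ * (q * (q / X) ^ N) := by ring
        _ ≤ 2 * C₂ * (Q ^ 2 * (q / X) ^ N) := by gcongr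
  have hfinal : ∑ r ∈ S, vecWeight ω Q r * p2 ω₀ ω Q r (vecGcd r / gcdWith r q) q w -
        ((normConst ω * (Q / q) : ℝ) : ℂ) * ∫ t : ℝ, bumpFt ω₀ ω t (t • v) =
      ∑ r ∈ S, (vecWeight ω Q r * p2 ω₀ ω Q r (vecGcd r / gcdWith r q) q w -
        (normConst ω : ℂ) * (vecWeight ω Q r * ∫ t, L r t)) +
      (normConst ω : ℂ) * (∑ r ∈ S, vecWeight ω Q r * (∫ t, L r t) -
        ((Q / q : ℝ) : ℂ) * ∫ t : ℝ, bumpFt ω₀ ω t (t • v)) := by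
    rw [Finset.sum_sub_distrib, ← Finset.mul_sum]
    push_cast
    ring
  rw [hfinal]
  refine (norm_add_le _ _).trans ?_
  rw [norm_mul, Complex.norm_real, Real.norm_eq_abs, abs_of_pos hc, add_mul, mul_assoc (normConst ω)]
  gcongr

/-- The bound obtained by adding up the bounds for `p₁` and `p₂`. -/
lemma exists_latticeKernel_trivial_bound (hω : IsWeight ω) (hω₀ : IsCutoff ω₀) :
    ∃ C : ℝ, 0 ≤ C ∧ ∀ (Q : ℝ) (q : ℕ) (a : Fin 2 → ℤ) (w : Plane), 1 ≤ Q → 1 ≤ q →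
      gcdWith a q = 1 → ‖latticeKernel ω₀ ω Q (lattice a q) w - 1‖ ≤ C * Q ^ 2 := by
  obtain ⟨C₁, hC₁0, hC₁⟩ := exists_p1_bound hω hω₀ 0
  obtain ⟨C₂, hC₂0, hC₂⟩ := exists_p2_bound hω hω₀ 0
  obtain ⟨B, hB0, hB⟩ := hω.exists_bound
  refine ⟨C₁ + 9 * (B * C₂) + 1, by positivity, fun Q q a w hQ hq h => ?_⟩
  have hQ0 : 0 < Q := by linarith
  have hq1 : (1 : ℝ) ≤ q := by exact_mod_cast hq
  have hQ2 : Q ≤ Q ^ 2 := by nlinarith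
  have h1 : ‖p1 ω₀ ω Q q w‖ ≤ C₁ * Q ^ 2 := by
    refine (hC₁ Q hQ q hq w).trans (mul_le_mul_of_nonneg_left ?_ hC₁0)
    rw [neg_zero, Real.rpow_zero, mul_one]
    refine (div_le_self hQ0.le ?_).trans hQ2
    have h2 : 0 ≤ ‖w‖ * Q ^ (3 / 2 : ℝ) := by positivity
    nlinarith
  have h2 : ∀ r ∈ (box ⌊Q⌋₊).filter (fun r => (q : ℤ) ∣ dotPerp r a),
      ‖vecWeight ω Q r * p2 ω₀ ω Q r (vecGcd r / gcdWith r q) q w‖ ≤ B * C₂ := by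
    intro r _
    by_cases hr : vecWeight ω Q r = 0
    · rw [hr, zero_mul, norm_zero]
      positivity
    have hr1 := vecWeight_bounds hω hQ hr
    have h3 := hC₂ Q hQ r _ q (div_gcdWith_pos (vecGcd_pos_of_vecWeight hω hQ hr) q) hq hr1.1.le
      hr1.2.le w
    rw [neg_zero, Real.rpow_zero, mul_one] at h3
    rw [norm_mul]
    exact mul_le_mul (norm_vecWeight_le hω hB Q r) h3 (norm_nonneg _) hB0
  have h3 : ‖∑ r ∈ (box ⌊Q⌋₊).filter (fun r => (q : ℤ) ∣ dotPerp r a),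
      vecWeight ω Q r * p2 ω₀ ω Q r (vecGcd r / gcdWith r q) q w‖ ≤ 9 * (B * C₂) * Q ^ 2 := by
    refine (norm_sum_le_of_le _ h2).trans ?_
    rw [Finset.sum_const, nsmul_eq_mul]
    have h4 : (((box ⌊Q⌋₊).filter (fun r => (q : ℤ) ∣ dotPerp r a)).card : ℝ) ≤ 9 * Q ^ 2 :=
      (Nat.cast_le.2 (Finset.card_filter_le _ _)).trans (card_box_le hQ)
    refine (mul_le_mul_of_nonneg_right h4 (by positivity)).trans (le_of_eq ?_)
    ring
  rw [latticeKernel_eq_sum hω hQ h]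
  refine (norm_sub_le _ _).trans ((add_le_add ((norm_add_le _ _).trans (add_le_add h1 h3))
    (le_of_eq norm_one)).trans ?_)
  nlinarith

/-- For small modulus and small argument the kernel of a lattice is close to `1`: the main terms of
`p₁` and of the sum over `r` cancel. -/
theorem exists_latticeKernel_sub_one_bound (hω : IsWeight ω) (hω₀ : IsCutoff ω₀) {δ : ℝ}
    (hδ : 0 < δ) (N : ℝ) : ∃ C : ℝ, ∀ Q : ℝ, 1 ≤ Q → ∀ (q : ℕ) (a : Fin 2 → ℤ), 1 ≤ q →
      gcdWith a q = 1 → (q : ℝ) < Q ^ (1 / 2 - δ) → ∀ w : Plane,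
        ‖w‖ < (q : ℝ)⁻¹ * Q ^ (-1 - δ) → ‖latticeKernel ω₀ ω Q (lattice a q) w - 1‖ ≤ C * Q ^ (-N) := by
  -- so that `Q ^ 2 * (Q ^ (-δ)) ^ K ≤ Q ^ (-N)`, where `Q ^ 2` bounds the number of vectors `r`
  set K := ⌈(N + 2) / δ⌉₊ with hK
  obtain ⟨C₁, hC₁0, hC₁⟩ := exists_p1_approx hω hω₀ (K + 1) (by omega)
  obtain ⟨C₂, hC₂0, hC₂⟩ := exists_sum_p2_approx hω hω₀ K
  obtain ⟨C₃, hC₃0, hC₃⟩ := exists_latticeKernel_trivial_bound hω hω₀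
  refine ⟨C₁ + C₂ + C₃ * 4 ^ K, fun Q hQ q a hq h hqδ w hw => ?_⟩
  obtain ⟨hX1, hXX, hX3⟩ := sqrt_pow_facts hQ
  have hXQ := sqrt_le_self hQ
  have hQ0 : 0 < Q := by linarith
  have hq0 : (0 : ℝ) < q := by exact_mod_cast hq
  set ε := Q ^ (-δ) with hε
  have hε0 : 0 < ε := by positivity
  have hε1 : ε ≤ 1 := Real.rpow_le_one_of_one_le_of_nonpos hQ (by linarith)
  rw [show (1 / 2 - δ : ℝ) = 1 / 2 + -δ by ring, Real.rpow_add hQ0, ← hε] at hqδ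
  rw [show (-1 - δ : ℝ) = -1 + -δ by ring, Real.rpow_add hQ0, ← hε, Real.rpow_neg_one] at hw
  set X := Q ^ (1 / 2 : ℝ) with hX
  have hX0 : 0 < X := by linarith
  have hqX : q / X ≤ ε := by
    rw [div_le_iff₀ hX0, mul_comm]
    exact hqδ.le
  have hv : q / X * ‖Q ^ (3 / 2 : ℝ) • w‖ ≤ ε := by
    rw [norm_smul, Real.norm_eq_abs, abs_of_pos (by positivity), hX3]
    calc q / X * (Q * X * ‖w‖) ≤ q / X * (Q * X * ((q : ℝ)⁻¹ * (Q⁻¹ * ε))) := by gcongr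
      _ = ε := by field_simp
  have hfin : Q ^ 2 * ε ^ K ≤ Q ^ (-N) := by
    rw [hε, ← Real.rpow_natCast, ← Real.rpow_natCast, ← Real.rpow_mul hQ0.le, ← Real.rpow_add hQ0]
    refine Real.rpow_le_rpow_of_exponent_le hQ ?_
    have h1 := Nat.le_ceil ((N + 2) / δ)
    rw [← hK, div_le_iff₀ hδ] at h1
    push_cast
    linarith
  refine le_trans ?_ (mul_le_mul_of_nonneg_left hfin (by positivity))
  rcases le_or_gt ε (1 / 4) with h4 | h4
  · have hqX1 : (q : ℝ) ≤ X := by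
      rw [div_le_iff₀ hX0] at hqX
      nlinarith
    have h1 := hC₂ Q q a w hQ hq h hqX1 (hv.trans h4)
    have h5 : (q : ℝ) / Q ≤ q / X := by gcongr
    have h2 := hC₁ Q q w hQ hq ((mul_le_mul_of_nonneg_right h5 (norm_nonneg _)).trans
      (hv.trans (h4.trans (by norm_num))))
    rw [latticeKernel_eq_sum hω hQ h]
    have h6 : C₁ * (q / Q : ℝ) ^ (K + 1) ≤ C₁ * (Q ^ 2 * ε ^ K) := by
      refine mul_le_mul_of_nonneg_left ?_ hC₁0
      calc (q / Q : ℝ) ^ (K + 1) ≤ ε ^ (K + 1) := by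
            gcongr
            exact h5.trans hqX
        _ ≤ ε ^ K := pow_le_pow_of_le_one hε0.le hε1 (Nat.le_succ K)
        _ ≤ Q ^ 2 * ε ^ K := le_mul_of_one_le_left (by positivity) (one_le_pow₀ hQ)
    have h7 : C₂ * (Q ^ 2 * (q / X) ^ K) ≤ C₂ * (Q ^ 2 * ε ^ K) := by gcongr
    have h8 : 0 ≤ C₃ * 4 ^ K * (Q ^ 2 * ε ^ K) := by positivity
    calc _ = ‖(p1 ω₀ ω Q q w - (1 - ((normConst ω * (Q / q) : ℝ) : ℂ) *
          ∫ t : ℝ, bumpFt ω₀ ω t (t • Q ^ (3 / 2 : ℝ) • w))) +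
          (∑ r ∈ (box ⌊Q⌋₊).filter (fun r => (q : ℤ) ∣ dotPerp r a),
            vecWeight ω Q r * p2 ω₀ ω Q r (vecGcd r / gcdWith r q) q w -
          ((normConst ω * (Q / q) : ℝ) : ℂ) *
            ∫ t : ℝ, bumpFt ω₀ ω t (t • Q ^ (3 / 2 : ℝ) • w))‖ := by
          congr 1
          ring
      _ ≤ C₁ * (Q ^ 2 * ε ^ K) + C₂ * (Q ^ 2 * ε ^ K) :=
        (norm_add_le _ _).trans (add_le_add (h2.trans h6) (h1.trans h7))
      _ ≤ _ := by linarith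
  · -- for bounded `Q` the trivial bound suffices
    have h5 : 1 ≤ (4 * ε) ^ K := one_le_pow₀ (by linarith)
    have h6 : 0 ≤ (C₁ + C₂) * (Q ^ 2 * ε ^ K) := by positivity
    calc _ ≤ C₃ * Q ^ 2 := hC₃ Q q a w hQ hq h
      _ ≤ C₃ * Q ^ 2 * (4 * ε) ^ K := le_mul_of_one_le_right (by positivity) h5
      _ = C₃ * 4 ^ K * (Q ^ 2 * ε ^ K) := by rw [mul_pow]; ring
      _ ≤ _ := by linarith

end LatticeSum

end DeltaSymbol

theorem theorem1p2 (ω ω₀ : ℝ → ℝ) (hω : DeltaSymbol.IsWeight ω)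
    (hω₀ : DeltaSymbol.IsCutoff ω₀) :
    ∃ p : ℝ → AddSubgroup (Fin 2 → ℤ) → DeltaSymbol.Plane → ℂ,
      -- the decomposition of the kernel attached to the lattice `Λ(a, q)`
      (∀ Q : ℝ, 1 ≤ Q → ∀ (q : ℕ) (a : Fin 2 → ℤ), 1 ≤ q → DeltaSymbol.gcdWith a q = 1 →
        ∀ w : DeltaSymbol.Plane,
          p Q (DeltaSymbol.lattice a q) w =
            DeltaSymbol.p1 ω₀ ω Q q w +
              ∑' r : DeltaSymbol.lattice a q,
                DeltaSymbol.vecWeight ω Q r *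
                  DeltaSymbol.p2 ω₀ ω Q r
                    (DeltaSymbol.vecGcd r / DeltaSymbol.gcdWith r q) q w) ∧
      -- the integrals below converge absolutely
      (∀ Q : ℝ, 1 ≤ Q → ∀ (q : ℕ) (a : Fin 2 → ℤ), 1 ≤ q → DeltaSymbol.gcdWith a q = 1 →
        Integrable (p Q (DeltaSymbol.lattice a q))) ∧
      (∀ Q : ℝ, 1 ≤ Q → ∀ q : ℕ, 1 ≤ q → Integrable (DeltaSymbol.p1 ω₀ ω Q q)) ∧
      (∀ Q : ℝ, 1 ≤ Q → ∀ (r : Fin 2 → ℤ) (k q : ℕ), 1 ≤ k → 1 ≤ q →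
        Integrable (DeltaSymbol.p2 ω₀ ω Q r k q)) ∧
      -- the two-dimensional delta symbol
      (∀ N : ℝ, 0 < N → ∃ C : ℝ, ∀ Q : ℝ, 1 ≤ Q → ∀ n : Fin 2 → ℤ,
        ‖DeltaSymbol.delta n -
            ∑ q ∈ Finset.Icc 1 ⌊Q⌋₊, ∑ a ∈ DeltaSymbol.reducedResidues q,
              (∫ w : DeltaSymbol.Plane,
                p Q (DeltaSymbol.lattice a q) w * DeltaSymbol.arcChar a q w n)‖
          ≤ C * Q ^ (-N)) ∧
      -- the kernel is close to `1` for small `q` and `w`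
      (∀ δ : ℝ, 0 < δ → ∀ N : ℝ, 0 < N → ∃ C : ℝ, ∀ Q : ℝ, 1 ≤ Q →
        ∀ (q : ℕ) (a : Fin 2 → ℤ), 1 ≤ q → DeltaSymbol.gcdWith a q = 1 →
          (q : ℝ) < Q ^ (1 / 2 - δ) →
          ∀ w : DeltaSymbol.Plane, ‖w‖ < (q : ℝ)⁻¹ * Q ^ (-1 - δ) →
            ‖p Q (DeltaSymbol.lattice a q) w - 1‖ ≤ C * Q ^ (-N)) ∧
      -- the decay of `p_{1,q}`
      (∀ N : ℝ, 0 < N → ∃ C : ℝ, ∀ Q : ℝ, 1 ≤ Q → ∀ q : ℕ, 1 ≤ q →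
        ∀ w : DeltaSymbol.Plane,
          ‖DeltaSymbol.p1 ω₀ ω Q q w‖ ≤
            C * (Q / (q * (1 + ‖w‖ * Q ^ (3 / 2 : ℝ))) *
              (1 + ‖w‖ * q * Q ^ (1 / 2 : ℝ)) ^ (-N))) ∧
      -- the decay of `p_{2,r,k,q}`, for `r` of size `Q^{1/2}`
      (∀ N : ℝ, 0 < N → ∃ C : ℝ, ∀ Q : ℝ, 1 ≤ Q → ∀ (r : Fin 2 → ℤ) (k q : ℕ),
        1 ≤ k → 1 ≤ q →
          Q ^ (1 / 2 : ℝ) / 2 ≤ ‖DeltaSymbol.toPlane r‖ →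
          ‖DeltaSymbol.toPlane r‖ ≤ Q ^ (1 / 2 : ℝ) →
          ∀ w : DeltaSymbol.Plane,
            ‖DeltaSymbol.p2 ω₀ ω Q r k q w‖ ≤
              C * (1 + ‖w‖ * k * q * Q ^ (1 / 2 : ℝ) +
                |inner ℝ w (DeltaSymbol.perp (DeltaSymbol.toPlane r))| * Q) ^ (-N)) ∧
      -- the delta symbol after interchanging the sums over `a` and `r`
      (∀ N : ℝ, 0 < N → ∃ C : ℝ, ∀ Q : ℝ, 1 ≤ Q → ∀ n : Fin 2 → ℤ,
        ‖DeltaSymbol.delta n -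
            ((∑ q ∈ Finset.Icc 1 ⌊Q⌋₊, ∑ a ∈ DeltaSymbol.reducedResidues q,
                (∫ w : DeltaSymbol.Plane,
                  DeltaSymbol.p1 ω₀ ω Q q w * DeltaSymbol.arcChar a q w n)) +
              ∑' t : DeltaSymbol.Triple,
                DeltaSymbol.interchangedTerm ω₀ ω Q n t.1 t.2.1 t.2.2)‖
          ≤ C * Q ^ (-N)) := by
  obtain hp := DeltaSymbol.latticeKernel_lattice ω₀ ω
  refine ⟨fun Q Λ w => DeltaSymbol.latticeKernel ω₀ ω Q Λ w, ?_, ?_, ?_, ?_, ?_, ?_, ?_, ?_, ?_⟩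
  · intro Q _ q a _ h w
    exact hp Q h w
  · intro Q hQ q a hq h
    exact DeltaSymbol.integrable_latticeKernel hω hω₀ hQ hq h
  · intro Q hQ q hq
    exact DeltaSymbol.integrable_p1 hω hω₀ hQ hq
  · intro Q hQ r k q hk hq
    exact DeltaSymbol.integrable_p2 hω hω₀ hQ r hk hq
  · intro N _
    obtain ⟨C, _, hC⟩ := DeltaSymbol.exists_delta_sub_deltaSum_bound hω hω₀ N
    refine ⟨C, fun Q hQ n => ?_⟩
    rw [DeltaSymbol.sum_integral_latticeKernel hω hω₀ hQ n]
    exact hC Q hQ n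
  · intro δ hδ N _
    exact DeltaSymbol.exists_latticeKernel_sub_one_bound hω hω₀ hδ N
  · intro N _
    obtain ⟨C, _, hC⟩ := DeltaSymbol.exists_p1_bound hω hω₀ N
    exact ⟨C, hC⟩
  · intro N _
    obtain ⟨C, _, hC⟩ := DeltaSymbol.exists_p2_bound hω hω₀ N
    exact ⟨C, hC⟩
  · intro N _
    obtain ⟨C, _, hC⟩ := DeltaSymbol.exists_delta_sub_deltaSum_bound hω hω₀ N
    refine ⟨C, fun Q hQ n => ?_⟩
    rw [DeltaSymbol.tsum_interchangedTerm hω hω₀ hQ n]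
    exact hC Q hQ n
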